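/- **Setting.** Let $(w_1(y),w_2(y))_{y\in\mathbb Z}$ be an i.i.d. sequence of pairs of positive random variables on a probability space $(\Omega,\mathcal F,\mathbb P)$. Assume that the laws of $w_1:=w_1(0)$ and $w_2:=w_2(0)$ are compactly supported in $(0,+\infty)$, that $w_1$ and $w_2$ are independent, that $w_2$ is not deterministic, and that $\mathbb E(\log w_2)=0$. Let $H_1,H_2\in\mathbb R$. For integers $L,N\ge 1$ with $L$ even and $N$ odd, let $T_{L,N}=(\mathbb Z/2L\mathbb Z)\times(\mathbb Z/2N\mathbb Z)$ with its nearest-neighbour graph structure, with coordinates $1\le x\le 2L$, $-N<y\le N$. The vertex $(x,y)$ is black if $x+y$ is odd and white otherwise. The horizontal edge $e=\{(x,y),(x+1,y)\}$ has weight $w(e)=w_1(y)e^{-H_2}$ if $(x,y)$ is black and $w(e)=w_1(y)e^{H_2}$ if $(x,y)$ is white; the vertical edge $e=\{(x,y),(x,y+1)\}$ has weight $w(e)=w_2(y)e^{H_1}$ if $(x,y)$ is black and $w(e)=w_2(y)e^{-H_1}$ if $(x,y)$ is white. Let $$Z_{L,N}=\sum_{D}\ \prod_{e\in D}w(e),$$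 where the sum runs over the perfect matchings $D$ of $T_{L,N}$. For $\theta\in\mathbb R$ and $w_1,w_2>0$ let $$M^\theta_{H_2}(w_1,w_2)=\begin{pmatrix}2w_1\sin(\theta+iH_2)& w_2^2\\ 1&0\end{pmatrix},$$ and let $\mathcal L(\theta,H_2)=\lim_{n\to\infty}\frac1n\,\mathbb E\log\big\|M_0\cdots M_{n-1}\big\|$, with $M_y=M^\theta_{H_2}(w_1(y),w_2(y))$, be the top Lyapunov exponent of the product of these i.i.d. matrices. **Proposition 1.1.** For every $\theta\in\mathbb R$ the limit defining $\mathcal L(\theta,H_2)$ exists and $\mathcal L(\theta,H_2)\ge 0$; the function $\theta\mapsto\max[\mathcal L(\theta,H_2),|H_1|]$ is integrable on $[0,\pi/2]$. The limit $$F=F(H_1,H_2)=\lim_{L\to\infty}\ \lim_{N\to\infty}\frac1{4LN}\log Z_{L,N}$$ ($L$ even, $N$ odd) exists $\mathbb P$-almost surely and in $\mathbb L^1$ and is deterministic: for every even $L\ge 2$ the inner limit exists $\mathbb P$-almost surely and in $\mathbb L^1$ and is a deterministic number, and these numbers converge, as $L\to\infty$, to $$F=\frac1\pi\int_0^{\pi/2}\max\big[\mathcal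 L(\theta,H_2),|H_1|\big]\,d\theta .$$ -/

import Mathlib

open MeasureTheory ProbabilityTheory Filter Topology

namespace LayeredDimer

/-- Vertices of the discrete torus `(ℤ/2Lℤ) × (ℤ/2Nℤ)`. -/
abbrev Vertex (L N : ℕ) : Type := ZMod (2 * L) × ZMod (2 * N)

/-- The vertex to the right of `p`. -/
def right {L N : ℕ} (p : Vertex L N) : Vertex L N := (p.1 + 1, p.2)

/-- The vertex above `p`. -/
def up {L N : ℕ} (p : Vertex L N) : Vertex L N := (p.1, p.2 + 1)

theorem zmod_two_mul_one_ne_zero (n : ℕ) : (1 : ZMod (2 * n)) ≠ 0 := by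
  intro h
  have h1 : 2 * n ∣ 1 := (ZMod.natCast_eq_zero_iff 1 (2 * n)).1 (by simpa using h)
  have h2 : 2 ∣ 1 := dvd_trans (Dvd.intro n rfl) h1
  omega

/-- The nearest-neighbour graph of the torus. -/
def torusGraph (L N : ℕ) : SimpleGraph (Vertex L N) where
  Adj p q := q = right p ∨ p = right q ∨ q = up p ∨ p = up q
  symm := ⟨fun p q h => by tauto⟩
  loopless := ⟨fun p h => by
    have h1 := zmod_two_mul_one_ne_zero L
    have h2 := zmod_two_mul_one_ne_zero N
    rcases h with h | h | h | h <;> simp_all [right, up, Prod.ext_iff]⟩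

/-- The row of a vertex, as the representative `y` with `-N < y ≤ N`. -/
def row {L N : ℕ} (p : Vertex L N) : ℤ := p.2.valMinAbs

/-- The vertex `(x, y)` is black if `x + y` is odd and white otherwise. Both side lengths are
even, so the parity does not depend on the representatives. -/
def IsBlack {L N : ℕ} (p : Vertex L N) : Prop := Odd (p.1.valMinAbs + p.2.valMinAbs)

open Classical in
/-- Weight of the horizontal edge from `p` to `right p`. -/
noncomputable def horizontalWeight {L N : ℕ} (w₁ : ℤ → ℝ) (H₂ : ℝ) (p : Vertex L N) : ℝ :=
  if IsBlack p then w₁ (row p) * Real.exp (-H₂) else w₁ (row p) * Real.exp H₂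

open Classical in
/-- Weight of the vertical edge from `p` to `up p`. -/
noncomputable def verticalWeight {L N : ℕ} (w₂ : ℤ → ℝ) (H₁ : ℝ) (p : Vertex L N) : ℝ :=
  if IsBlack p then w₂ (row p) * Real.exp H₁ else w₂ (row p) * Real.exp (-H₁)

/-- Weight of an unoriented edge. If `2 ≤ L` and `2 ≤ N`, exactly one of the four terms is active on
each edge of the torus. (On a side of length two, where the torus has pairs of parallel edges,
the weights of the parallel edges are added, which gives the same partition function.) -/
noncomputable def edgeWeight {L N : ℕ} (w₁ w₂ : ℤ → ℝ) (H₁ H₂ : ℝ) :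
    Sym2 (Vertex L N) → ℝ :=
  Sym2.lift ⟨fun p q =>
    (if q = right p then horizontalWeight w₁ H₂ p else 0)
      + (if p = right q then horizontalWeight w₁ H₂ q else 0)
      + (if q = up p then verticalWeight w₂ H₁ p else 0)
      + (if p = up q then verticalWeight w₂ H₁ q else 0), fun p q => by ring⟩

/-- The partition function: the sum over the perfect matchings `D` of the torus of the product of
the weights of the edges of `D`. All sums and products are finite for `L, N ≥ 1`. -/
noncomputable def partitionFunction (L N : ℕ) (w₁ w₂ : ℤ → ℝ) (H₁ H₂ : ℝ) : ℝ :=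
  ∑ᶠ D : {D : (torusGraph L N).Subgraph // D.IsPerfectMatching},
    ∏ᶠ e : D.1.edgeSet, edgeWeight w₁ w₂ H₁ H₂ e.1

/-- The finite-volume free energy per unit volume, `(1 / (4 L N)) log Z`. -/
noncomputable def freeEnergy (L N : ℕ) (w₁ w₂ : ℤ → ℝ) (H₁ H₂ : ℝ) : ℝ :=
  1 / (4 * (L : ℝ) * (N : ℝ)) * Real.log (partitionFunction L N w₁ w₂ H₁ H₂)

/-- The transfer matrix `M^θ_{H₂}(w₁, w₂)`. -/
noncomputable def transferMatrix (θ H₂ w₁ w₂ : ℝ) : Matrix (Fin 2) (Fin 2) ℂ :=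
  !![2 * (w₁ : ℂ) * Complex.sin ((θ : ℂ) + Complex.I * (H₂ : ℂ)), (w₂ : ℂ) ^ 2; 1, 0]

section Lyapunov

attribute [local instance] Matrix.linftyOpNormedAddCommGroup

variable {Ω : Type*}

/-- `log ‖A₀ A₁ ⋯ Aₙ₋₁‖`, with the operator norm associated with the sup norm of `ℂ²`. -/
noncomputable def logNormProd (A : ℕ → Ω → Matrix (Fin 2) (Fin 2) ℂ) (n : ℕ) (ω : Ω) : ℝ :=
  Real.log ‖((List.range n).map (fun i => A i ω)).prod‖

end Lyapunov

/-- The real number `γ` is the top Lyapunov exponent of the product of the i.i.d. random matrices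
`A₀, A₁, …`: the variables `log ‖A₀ ⋯ Aₙ₋₁‖` are integrable and
`γ = lim (1 / n) 𝔼 log ‖A₀ ⋯ Aₙ₋₁‖`. -/
def HasTopLyapunovExponent {Ω : Type*} [MeasurableSpace Ω] (P : Measure Ω)
    (A : ℕ → Ω → Matrix (Fin 2) (Fin 2) ℂ) (γ : ℝ) : Prop :=
  (∀ n, Integrable (logNormProd A n) P) ∧
    Tendsto (fun n : ℕ => 1 / (n : ℝ) * ∫ ω, logNormProd A n ω ∂P) atTop (𝓝 γ)

/-- The top Lyapunov exponent as a number; it is meaningful when the limit exists, that is, when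
`HasTopLyapunovExponent P A γ` holds for some `γ`, which is then its value. -/
noncomputable def topLyapunovExponent {Ω : Type*} [MeasurableSpace Ω] (P : Measure Ω)
    (A : ℕ → Ω → Matrix (Fin 2) (Fin 2) ℂ) : ℝ :=
  limUnder atTop (fun n : ℕ => 1 / (n : ℝ) * ∫ ω, logNormProd A n ω ∂P)

/-- The random transfer matrices `M^θ_{y, H₂} = M^θ_{H₂}(w₁(y), w₂(y))`, `y ∈ ℕ`. -/
noncomputable def randomTransferMatrix {Ω : Type*} (w₁ w₂ : ℤ → Ω → ℝ) (θ H₂ : ℝ) (y : ℕ) (ω : Ω) :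
    Matrix (Fin 2) (Fin 2) ℂ :=
  transferMatrix θ H₂ (w₁ y ω) (w₂ y ω)

/-- `𝓛(θ, H₂)`, the top Lyapunov exponent of the product of the random transfer matrices. -/
noncomputable def lyapunov {Ω : Type*} [MeasurableSpace Ω] (P : Measure Ω) (w₁ w₂ : ℤ → Ω → ℝ)
    (θ H₂ : ℝ) : ℝ :=
  topLyapunovExponent P (randomTransferMatrix w₁ w₂ θ H₂)

end LayeredDimer

/-!
A perfect matching of the torus is a family of particle paths winding in the vertical direction: on
a vertical edge a particle is present or absent according to the occupation of the edge and the
colour of its lower end. Reading the torus row by row, the partition function is the trace of a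
product of matrices indexed by the particle configurations, one matrix per row
(`partitionFunction_eq_trace`), and these matrices conserve the number of particles.

The particles are free fermions. If a phase `u` is gained per step to the right and
`u ^ (2 L) = (-1) ^ (n + 1)`, the row matrix restricted to `n` particles is, up to a gauge, the
`n`-th compound of a one-particle matrix: the boundary phase compensates the sign of the permutation
that occurs when a particle crosses the cut (`compound_hopMatrix`). On plane waves the one-particle
matrix acts through the `2 × 2` transfer matrices of momentum `θ` (`rowMatrix_mul_planeWaves`). The
expansion of `det (1 + M)` in principal minors then factorizes over the momenta.

* Upper bound: the partition function is at most the sum of two products over momenta, one for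
  each parity of `n`. The factors are, up to a constant, the quantities `modeSize`: the norm of the
  product of the transfer matrices plus the weights of the two states, empty and full, that feel
  only the field `± H₁` (`trace_rowWeight_le`).
* Lower bound: for an arbitrary phase of modulus one, minors are dominated by weights of paths
  (`norm_compound_hopMatrix_le`), so up to a constant the weight of the paths of the one-particle
  matrix `C` with free ends dominates `|det (1 + C D)|` for every matrix `D` of bounded size. The
  choice of `D` that aligns every `2 × 2` block gives a product of quantities `modeSize` over momenta
  with an arbitrary offset (`prod_modeSize_le`).

For a fixed circumference, the sectors of fixed particle number are uniformly mixing, since the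
weights are bounded away from `0` and `∞`. Hence the logarithms of their weights are additive along
the rows up to a bounded error, and the law of large numbers over long blocks yields an almost sure
deterministic limit (`exists_ae_tendsto_of_almost_additive`, `exists_ae_tendsto_log_rowsSum`).
Convergence in `L¹` follows by domination.

The limit at circumference `2 L` lies between two Riemann sums. From below, it dominates the sums of
`max (𝓛 (θ, H₂)) |H₁|` over the shifted momenta for every shift (`sum_lyapunov_le`). From above, it
is bounded by sums of a continuous function, the mean logarithm of the norm of a product of fixed
length; by subadditivity the exponent is the infimum of these means per row
(`exists_le_sum_meanLogNorm`).
Averaging the lower bound over the shift turns the sum into an integral, so no continuity of the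
Lyapunov exponent in the angle is needed (`tendsto_of_riemann_sums`). The reflection `θ ↦ π - θ`
reduces the integral to half of the interval, and the exponent is non-negative because the
logarithms of the determinants are centred. Weights that lie in a compact set almost surely are
replaced by weights that lie in it everywhere (`exists_isEnvironment`).
-/

namespace LayeredDimer

/-! ### Compound matrices -/

section Compound

variable {X : Type*} [LinearOrder X]

/-- The `n`-th compound matrix of `M`: its entries are the minors of order `n`, the rows and columns
being listed in increasing order. -/
noncomputable def compound (n : ℕ) (M : Matrix X X ℂ) :
    Matrix (Set.powersetCard X n) (Set.powersetCard X n) ℂ :=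
  Matrix.of fun s t => (M.submatrix (Set.powersetCard.ofFinEmbEquiv.symm s)
    (Set.powersetCard.ofFinEmbEquiv.symm t)).det

theorem compound_smul (n : ℕ) (c : ℂ) (M : Matrix X X ℂ) :
    compound n (c • M) = c ^ n • compound n M := by
  ext s t
  simp [compound, Matrix.submatrix_smul]

variable [Fintype X]

theorem compound_eq_toMatrix (n : ℕ) (M : Matrix X X ℂ) :
    compound n M = LinearMap.toMatrix ((Pi.basisFun ℂ X).exteriorPower n)
      ((Pi.basisFun ℂ X).exteriorPower n) (exteriorPower.map n (Matrix.toLin' M)) := by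
  ext s t
  rw [LinearMap.toMatrix_apply, exteriorPower.basis_apply,
    exteriorPower.map_apply_ιMulti_family, exteriorPower.basis_repr_apply,
    exteriorPower.ιMulti_family, exteriorPower.ιMultiDual_apply_ιMulti, ← Matrix.det_transpose]
  simp only [compound, Matrix.of_apply]
  congr 1
  ext i j
  simp

/-- The **Cauchy–Binet formula**, from the functoriality of exterior powers. -/
theorem compound_mul (n : ℕ) (M N : Matrix X X ℂ) :
    compound n (M * N) = compound n M * compound n N := by
  rw [compound_eq_toMatrix, compound_eq_toMatrix, compound_eq_toMatrix, Matrix.toLin'_mul,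
    exteriorPower.map_comp (f := Matrix.toLin' N) (g := Matrix.toLin' M)]
  exact LinearMap.toMatrix_comp _ _ _ _ _

theorem compound_one (n : ℕ) : compound n (1 : Matrix X X ℂ) = 1 := by
  rw [compound_eq_toMatrix, Matrix.toLin'_one, exteriorPower.map_id, LinearMap.toMatrix_id]

theorem compound_mul_diagonal_apply (n : ℕ) (M : Matrix X X ℂ) (d : X → ℂ)
    (s t : Set.powersetCard X n) :
    compound n (M * Matrix.diagonal d) s t = compound n M s t * ∏ x ∈ t.1, d x := by
  have h : (M * Matrix.diagonal d).submatrix (Set.powersetCard.ofFinEmbEquiv.symm s)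
      (Set.powersetCard.ofFinEmbEquiv.symm t) = Matrix.of fun i j =>
        d (Set.powersetCard.ofFinEmbEquiv.symm t j) *
          (M.submatrix (Set.powersetCard.ofFinEmbEquiv.symm s)
            (Set.powersetCard.ofFinEmbEquiv.symm t)) i j := by
    ext i j
    simp [mul_comm]
  simp only [compound, Matrix.of_apply]
  rw [h, Matrix.det_mul_row, mul_comm]
  congr 1
  refine (Finset.prod_map Finset.univ
    (Set.powersetCard.ofFinEmbEquiv.symm t).toEmbedding d).symm.trans ?_
  refine Finset.prod_congr ?_ fun _ _ => rfl
  ext x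
  rw [Finset.mem_map]
  simp only [Finset.mem_univ, true_and]
  exact Set.powersetCard.mem_range_ofFinEmbEquiv_symm_iff_mem t x

theorem trace_compound (n : ℕ) (M : Matrix X X ℂ) :
    (compound n M).trace = ∑ s ∈ Finset.univ.powersetCard n,
      (M.submatrix (Subtype.val : s → X) (Subtype.val : s → X)).det := by
  have h1 : ∀ s : Set.powersetCard X n, compound n M s s =
      (M.submatrix (Subtype.val : s.1 → X) (Subtype.val : s.1 → X)).det := by
    intro s
    rw [← Matrix.det_submatrix_equiv_self (Finset.orderIsoOfFin s.1 s.2).toEquiv]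
    rfl
  simp only [Matrix.trace, Matrix.diag_apply, h1]
  rw [Finset.sum_subtype (p := fun s => s ∈ Set.powersetCard X n)]
  intro s
  simp [Set.powersetCard]

/-- The expansion of `det (1 + M)` in principal minors. -/
theorem det_one_add_eq_sum_trace_compound (M : Matrix X X ℂ) :
    (1 + M).det = ∑ n ∈ Finset.range (Fintype.card X + 1), (compound n M).trace := by
  simp only [trace_compound]
  have : (1 + M).det = ∑ s : Finset X,
      (M.submatrix (Subtype.val : s → X) (Subtype.val : s → X)).det := by
    rw [add_comm]
    change Matrix.detRowAlternating (M + 1) = _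
    have := (Matrix.detRowAlternating (R := ℂ) (n := X)).map_add_univ M (1 : Matrix X X ℂ)
    refine this.trans ?_
    refine Finset.sum_congr rfl fun s _ => ?_
    exact Matrix.det_piecewise_one_eq_submatrix_det M s
  rw [this, ← Finset.powerset_univ, Finset.sum_powerset]
  rfl

end Compound

/-! ### Particles moving in a row -/

section PermSign

theorem sign_eq_one_of_strictMono {n : ℕ} (π : Equiv.Perm (Fin n))
    (h : ∀ i j, i < j → π i < π j) : Equiv.Perm.sign π = 1 := by
  rw [Equiv.Perm.sign_eq_prod_prod_Ioi]
  refine Finset.prod_eq_one fun i _ => Finset.prod_eq_one fun j hj => ?_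
  rw [if_pos (h i j (Finset.mem_Ioi.1 hj))]

/-- A permutation that preserves the order of all pairs avoiding `i₀` and reverses all pairs that
contain `i₀` has the sign of a cycle of full length. -/
theorem sign_of_reverse_at {n : ℕ} (π : Equiv.Perm (Fin n)) (i₀ : Fin n)
    (h : ∀ i j, i < j → (π i < π j ↔ i ≠ i₀ ∧ j ≠ i₀)) :
    Equiv.Perm.sign π = (-1) ^ (n + 1) := by
  rw [Equiv.Perm.sign_eq_prod_prod_Ioi]
  have h1 : ∀ i, (∏ j ∈ Finset.Ioi i, (if π i < π j then (1 : ℤˣ) else -1)) =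
      (if i < i₀ then -1 else 1) * (if i = i₀ then (-1) ^ (n - 1 - (i₀ : ℕ)) else 1) := by
    intro i
    rcases lt_trichotomy i i₀ with hi | rfl | hi
    · rw [if_pos hi, if_neg hi.ne, mul_one, Finset.prod_eq_single i₀]
      · rw [if_neg (by rw [h _ _ hi]; tauto)]
      · intro j hj hne
        rw [if_pos ((h _ _ (Finset.mem_Ioi.1 hj)).2 ⟨hi.ne, hne⟩)]
      · intro hn
        exact absurd (Finset.mem_Ioi.2 hi) hn
    · rw [if_neg (lt_irrefl _), if_pos rfl, one_mul, Finset.prod_congr rfl (g := fun _ => -1),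
        Finset.prod_const, Fin.card_Ioi]
      intro j hj
      rw [if_neg (by rw [h _ _ (Finset.mem_Ioi.1 hj)]; tauto)]
    · rw [if_neg (not_lt.2 hi.le), if_neg hi.ne', mul_one]
      refine Finset.prod_eq_one fun j hj => ?_
      have hj := Finset.mem_Ioi.1 hj
      rw [if_pos ((h _ _ hj).2 ⟨hi.ne', (hi.trans hj).ne'⟩)]
  simp only [h1, Finset.prod_mul_distrib, Finset.prod_ite_eq', Finset.mem_univ, if_true]
  rw [Finset.prod_ite, Finset.prod_const, Finset.prod_const_one, mul_one, ← pow_add]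
  have h2 : (Finset.univ.filter fun x => x < i₀).card = (i₀ : ℕ) := by
    rw [← Fin.card_Iio i₀]
    congr 1
    ext x
    simp
  rw [h2]
  have := i₀.2
  obtain ⟨m, rfl⟩ : ∃ m, n = m + 1 := ⟨n - 1, by omega⟩
  have h3 : (i₀ : ℕ) + (m + 1 - 1 - i₀) = m := by omega
  rw [h3, pow_add, pow_add]
  simp

end PermSign

/-- The order on `ℤ/mℤ` given by the representatives `0, …, m - 1`. -/
@[reducible] def zmodLinearOrder (m : ℕ) [NeZero m] : LinearOrder (ZMod m) :=
  { le := fun x y => x.val ≤ y.val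
    lt := fun x y => x.val < y.val
    le_refl := fun _ => le_refl _
    le_trans := fun _ _ _ h h' => le_trans h h'
    le_antisymm := fun _ _ h h' => ZMod.val_injective m (le_antisymm h h')
    lt_iff_le_not_ge := fun _ _ => lt_iff_le_not_ge
    le_total := fun _ _ => le_total _ _
    toDecidableLE := fun x y => inferInstanceAs (Decidable (x.val ≤ y.val))
    toDecidableLT := fun x y => inferInstanceAs (Decidable (x.val < y.val))
    toDecidableEq := inferInstance }

attribute [local instance] zmodLinearOrder

theorem zmod_lt_iff {m : ℕ} [NeZero m] (x y : ZMod m) : x < y ↔ x.val < y.val := Iff.rfl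

theorem zmod_val_add_one {m : ℕ} [NeZero m] (hm : 1 < m) (x : ZMod m) :
    (x + 1).val = if x.val + 1 = m then 0 else x.val + 1 := by
  have hx := ZMod.val_lt x
  have : Fact (1 < m) := ⟨hm⟩
  rw [ZMod.val_add, ZMod.val_one]
  split_ifs with h
  · rw [h, Nat.mod_self]
  · exact Nat.mod_eq_of_lt (by omega)

section RowKernel

variable {m : ℕ}

/-- The admissible sets `H` of horizontal edges in a row, an edge being named by its left end.
`T` and `T'` are the sets of particles entering and leaving the row from below to above, and `blk`
singles out the black sites. A particle is present above a black site if the vertical edge is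
present, above a white site if it is absent, and with the colours exchanged below the row.
The condition says that every site is covered exactly once. -/
def HopValid (blk : ZMod m → Prop) [DecidablePred blk] (T T' H : Finset (ZMod m)) : Prop :=
  ∀ x, (if (x ∈ T' ↔ blk x) then 1 else 0) + (if (x ∈ T ↔ ¬ blk x) then 1 else 0) +
    (if x ∈ H then 1 else 0) + (if x - 1 ∈ H then 1 else 0) = (1 : ℕ)

open Classical in
/-- The sum over the admissible sets of horizontal edges of the products of their weights. -/
noncomputable def hopKernel [NeZero m] (blk : ZMod m → Prop) [DecidablePred blk]
    (h : ZMod m → ℝ) (T T' : Finset (ZMod m)) : ℝ :=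
  ∑ H ∈ Finset.univ.filter (HopValid blk T T'), ∏ x ∈ H, h x

/-- The one-particle matrix of a row: a particle on a white site stays, a particle on a black site
stays or hops along a horizontal edge, and a phase `u` is gained per step to the right. -/
noncomputable def hopMatrix (blk : ZMod m → Prop) [DecidablePred blk] (h : ZMod m → ℝ) (u : ℂ) :
    Matrix (ZMod m) (ZMod m) ℂ :=
  Matrix.of fun x x' => if x' = x then 1 else if blk x ∧ x' = x + 1 then h x * u
    else if blk x ∧ x' = x - 1 then h x' * u⁻¹ else 0

variable (blk : ZMod m → Prop) [DecidablePred blk]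

/-- `z` is obtained from `x` by moves that the row permits. -/
def Allowed {n : ℕ} (x z : Fin n → ZMod m) : Prop :=
  ∀ i, z i = x i ∨ (blk (x i) ∧ (z i = x i + 1 ∨ z i = x i - 1))

/-- The horizontal edges used by the moves from `x` to `z`. -/
def hopEdges {n : ℕ} (x z : Fin n → ZMod m) : Finset (ZMod m) :=
  (Finset.univ.filter fun i => z i ≠ x i).image fun i => if z i = x i + 1 then x i else x i - 1

/-- The phase of the moves from `x` to `z`. -/
noncomputable def hopPhase {n : ℕ} (u : ℂ) (x z : Fin n → ZMod m) : ℂ :=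
  ∏ i, if z i = x i then 1 else if z i = x i + 1 then u else u⁻¹

variable {blk}

theorem hopEdges_injOn (hb : ∀ x, blk (x + 1) ↔ ¬ blk x) {n : ℕ} {x z : Fin n → ZMod m}
    (hx : Function.Injective x) (ha : Allowed blk x z) :
    Set.InjOn (fun i => if z i = x i + 1 then x i else x i - 1)
      (Finset.univ.filter fun i => z i ≠ x i : Finset (Fin n)) := by
  have hb' : ∀ x, blk (x - 1) ↔ ¬ blk x := fun x => by
    have := hb (x - 1); rw [sub_add_cancel] at this; tauto
  intro i hi j hj hij
  simp only [Finset.coe_filter, Finset.mem_univ, true_and, Set.mem_ofPred_eq] at hi hj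
  have hi' := ((ha i).resolve_left hi).1
  have hj' := ((ha j).resolve_left hj).1
  simp only at hij
  split_ifs at hij with h1 h2 h2
  · exact hx hij
  · rw [hij, hb'] at hi'; exact absurd hj' hi'
  · rw [← hij, hb'] at hj'; exact absurd hi' hj'
  · exact hx (sub_left_injective hij)

theorem prod_hopMatrix (hb : ∀ x, blk (x + 1) ↔ ¬ blk x) {n : ℕ} {x z : Fin n → ZMod m}
    (hx : Function.Injective x) (ha : Allowed blk x z) (h : ZMod m → ℝ) (u : ℂ) :
    ∏ i, hopMatrix blk h u (x i) (z i) =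
      hopPhase u x z * ((∏ y ∈ hopEdges x z, h y : ℝ) : ℂ) := by
  rw [hopEdges, Finset.prod_image (hopEdges_injOn hb hx ha), Finset.prod_filter, hopPhase,
    Complex.ofReal_prod, ← Finset.prod_mul_distrib]
  refine Finset.prod_congr rfl fun i _ => ?_
  simp only [hopMatrix, Matrix.of_apply]
  rcases ha i with h1 | ⟨h1, h2⟩
  · simp [h1]
  · by_cases h0 : z i = x i
    · simp [h0]
    · by_cases h3 : z i = x i + 1
      · rw [if_neg h0, if_pos ⟨h1, h3⟩, if_neg h0, if_pos h3, if_pos h0, if_pos h3, mul_comm]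
      · have h4 := h2.resolve_left h3
        rw [if_neg h0, if_neg (by tauto), if_pos ⟨h1, h4⟩, if_neg h0, if_neg h3, if_pos h0,
          if_neg h3, mul_comm, h4]

theorem hopMatrix_prod_eq_zero {n : ℕ} {x z : Fin n → ZMod m}
    (ha : ¬ Allowed blk x z) (h : ZMod m → ℝ) (u : ℂ) :
    ∏ i, hopMatrix blk h u (x i) (z i) = 0 := by
  simp only [Allowed, not_forall] at ha
  obtain ⟨i, hi⟩ := ha
  refine Finset.prod_eq_zero (Finset.mem_univ i) ?_
  simp only [hopMatrix, Matrix.of_apply]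
  rw [if_neg (by tauto), if_neg (by tauto), if_neg (by tauto)]

theorem mem_hopEdges_black (h2 : (2 : ZMod m) ≠ 0) (hb : ∀ x, blk (x + 1) ↔ ¬ blk x) {n : ℕ}
    {x z : Fin n → ZMod m} (ha : Allowed blk x z) {y : ZMod m} (hy : blk y) :
    (y ∈ hopEdges x z ↔ ∃ i, x i = y ∧ z i = y + 1) ∧
      (y - 1 ∈ hopEdges x z ↔ ∃ i, x i = y ∧ z i = y - 1) := by
  have hb' : ∀ x, blk (x - 1) ↔ ¬ blk x := fun x => by
    have := hb (x - 1); rw [sub_add_cancel] at this; tauto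
  have h1 : (1 : ZMod m) ≠ 0 := fun h => h2 (by linear_combination 2 * h)
  have e1 : ∀ a : ZMod m, a + 1 ≠ a := fun a h => h1 (by linear_combination h)
  have e2 : ∀ a : ZMod m, a - 1 ≠ a := fun a h => h1 (by linear_combination -h)
  have e3 : ∀ a : ZMod m, a - 1 ≠ a + 1 := fun a h => h2 (by linear_combination -h)
  simp only [hopEdges, Finset.mem_image, Finset.mem_filter, Finset.mem_univ, true_and]
  constructor
  · constructor
    · rintro ⟨i, hi, hiy⟩
      have := ((ha i).resolve_left hi)
      split_ifs at hiy with h3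
      · exact ⟨i, hiy, hiy ▸ h3⟩
      · rw [← hiy, hb'] at hy
        exact absurd this.1 hy
    · rintro ⟨i, hi, hz⟩
      refine ⟨i, ?_, ?_⟩
      · rw [hi, hz]; exact e1 y
      · rw [if_pos (by rw [hi, hz]), hi]
  · constructor
    · rintro ⟨i, hi, hiy⟩
      have := ((ha i).resolve_left hi)
      split_ifs at hiy with h3
      · rw [hiy, hb'] at this
        exact absurd hy this.1
      · have h4 := this.2.resolve_left h3
        exact ⟨i, sub_left_injective hiy, by rw [h4, hiy]⟩
    · rintro ⟨i, hi, hz⟩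
      refine ⟨i, ?_, ?_⟩
      · rw [hi, hz]; exact e2 y
      · rw [if_neg (by rw [hi, hz]; exact e3 y), hi]

/-- The edges used by permitted moves without collisions form an admissible set. -/
theorem hopValid_hopEdges (h2 : (2 : ZMod m) ≠ 0) (hb : ∀ x, blk (x + 1) ↔ ¬ blk x) {n : ℕ}
    {x z : Fin n → ZMod m} (hx : Function.Injective x) (hz : Function.Injective z)
    (ha : Allowed blk x z) {T T' : Finset (ZMod m)} (hT : ∀ y, y ∈ T ↔ ∃ i, x i = y)
    (hT' : ∀ y, y ∈ T' ↔ ∃ i, z i = y) : HopValid blk T T' (hopEdges x z) := by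
  have hb' : ∀ x, blk (x - 1) ↔ ¬ blk x := fun x => by
    have := hb (x - 1); rw [sub_add_cancel] at this; tauto
  have h1 : (1 : ZMod m) ≠ 0 := fun h => h2 (by linear_combination 2 * h)
  have e1 : ∀ a : ZMod m, a + 1 ≠ a := fun a h => h1 (by linear_combination h)
  have e2 : ∀ a : ZMod m, a - 1 ≠ a := fun a h => h1 (by linear_combination -h)
  have e3 : ∀ a : ZMod m, a - 1 ≠ a + 1 := fun a h => h2 (by linear_combination -h)
  intro y
  by_cases hy : blk y
  · obtain ⟨m1, m2⟩ := mem_hopEdges_black h2 hb ha hy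
    -- a particle on a black site after the step has not moved
    have m3 : y ∈ T' ↔ ∃ i, x i = y ∧ z i = y := by
      rw [hT']
      constructor
      · rintro ⟨i, hi⟩
        rcases ha i with h | ⟨h, h' | h'⟩
        · exact ⟨i, by rw [← h, hi], hi⟩
        · rw [← hi, h', hb] at hy; exact absurd h hy
        · rw [← hi, h', hb'] at hy; exact absurd h hy
      · rintro ⟨i, -, hi⟩; exact ⟨i, hi⟩
    simp only [m1, m2, m3, hT, hy, not_true_eq_false, iff_false, iff_true]
    by_cases hex : ∃ i, x i = y
    · obtain ⟨i, hi⟩ := hex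
      have u : ∀ w, (∃ j, x j = y ∧ z j = w) ↔ z i = w := by
        intro w
        constructor
        · rintro ⟨j, hj, hw⟩
          rw [hx (hi.trans hj.symm)]; exact hw
        · intro hw; exact ⟨i, hi, hw⟩
      simp only [u]
      rw [if_neg (c := ¬ ∃ i, x i = y) (by push Not; exact ⟨i, hi⟩)]
      rcases ha i with h | ⟨h, h' | h'⟩
      · rw [hi] at h
        simp [h, (e1 y).symm, (e2 y).symm]
      · rw [hi] at h'
        simp [h', e1 y, (e3 y).symm]
      · rw [hi] at h'
        simp [h', e2 y, e3 y]
    · have u : ∀ w, ¬ ∃ j, x j = y ∧ z j = w := by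
        rintro w ⟨j, hj, -⟩; exact hex ⟨j, hj⟩
      simp [u, hex]
  · -- the edges at a white site are those at its black neighbours
    have hy1 : blk (y + 1) := (hb y).2 hy
    have hy2 : blk (y - 1) := (hb' y).2 hy
    have m1 := (mem_hopEdges_black h2 hb ha hy1).2
    have m2 := (mem_hopEdges_black h2 hb ha hy2).1
    rw [add_sub_cancel_right] at m1
    rw [sub_add_cancel] at m2
    have m3 : y ∈ T ↔ ∃ i, x i = y ∧ z i = y := by
      rw [hT]
      constructor
      · rintro ⟨i, hi⟩
        rcases ha i with h | ⟨h, -⟩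
        · exact ⟨i, hi, by rw [h, hi]⟩
        · rw [hi] at h; exact absurd h hy
      · rintro ⟨i, hi, -⟩; exact ⟨i, hi⟩
    simp only [m1, m2, m3, hT', hy, not_false_eq_true, iff_false, iff_true]
    by_cases hex : ∃ i, z i = y
    · obtain ⟨i, hi⟩ := hex
      have u : ∀ w, (∃ j, x j = w ∧ z j = y) ↔ x i = w := by
        intro w
        constructor
        · rintro ⟨j, hj, hw⟩
          rw [hz (hi.trans hw.symm)]; exact hj
        · intro hw; exact ⟨i, hw, hi⟩
      simp only [u]
      rw [if_neg (c := ¬ ∃ i, z i = y) (by push Not; exact ⟨i, hi⟩)]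
      rcases ha i with h | ⟨h, h' | h'⟩
      · rw [hi] at h
        simp [← h, (e1 y).symm, (e2 y).symm]
      · have h' : x i = y - 1 := by rw [← hi, h']; ring
        simp [h', e2 y, e3 y]
      · have h' : x i = y + 1 := by rw [← hi, h']; ring
        simp [h', e1 y, (e3 y).symm]
    · have u : ∀ w, ¬ ∃ j, x j = w ∧ z j = y := by
        rintro w ⟨j, -, hj⟩; exact hex ⟨j, hj⟩
      simp [u, hex]

end RowKernel

section RowKernel

variable {m : ℕ} [NeZero m] {blk : ZMod m → Prop}

/-- The `i`-th particle crosses the cut between the sites `m - 1` and `0`. -/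
def Wraps {n : ℕ} (x z : Fin n → ZMod m) (i : Fin n) : Prop :=
  (z i = x i + 1 ∧ (x i).val + 1 = m ∧ (z i).val = 0) ∨
    (z i = x i - 1 ∧ (x i).val = 0 ∧ (z i).val + 1 = m)

theorem val_of_not_wraps (hm : 2 < m) {n : ℕ} {x z : Fin n → ZMod m} (ha : Allowed blk x z)
    {i : Fin n} (hi : ¬ Wraps x z i) :
    z i = x i ∨ (blk (x i) ∧ z i = x i + 1 ∧ (z i).val = (x i).val + 1) ∨
      (blk (x i) ∧ z i = x i - 1 ∧ (z i).val + 1 = (x i).val) := by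
  rcases ha i with h | ⟨h, h' | h'⟩
  · exact Or.inl h
  · right; left
    refine ⟨h, h', ?_⟩
    have h1 := zmod_val_add_one (by omega) (x i)
    rw [← h'] at h1
    split_ifs at h1 with h2
    · exact absurd (Or.inl ⟨h', h2, h1⟩) hi
    · exact h1
  · right; right
    refine ⟨h, h', ?_⟩
    have h1 := zmod_val_add_one (by omega) (z i)
    rw [show z i + 1 = x i by rw [h']; ring] at h1
    split_ifs at h1 with h2
    · exact absurd (Or.inr ⟨h', h1, h2⟩) hi
    · exact h1.symm

/-- The moves preserve the cyclic order, so two particles change their order only if one of them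
crosses the cut. -/
theorem lt_iff_not_wraps (hm : 2 < m) (hb : ∀ x, blk (x + 1) ↔ ¬ blk x) {n : ℕ}
    {x z : Fin n → ZMod m} (hz : Function.Injective z) (ha : Allowed blk x z) {i j : Fin n}
    (hij : x i < x j) : z i < z j ↔ ¬ Wraps x z i ∧ ¬ Wraps x z j := by
  rw [zmod_lt_iff] at hij ⊢
  have hne : (z i).val ≠ (z j).val := fun h => hij.ne (by
    rw [hz (ZMod.val_injective m h)])
  have hi := ZMod.val_lt (x i)
  have hj := ZMod.val_lt (x j)
  have hi' := ZMod.val_lt (z i)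
  have hj' := ZMod.val_lt (z j)
  have hadj : (x i).val + 1 = (x j).val → (blk (x j) ↔ ¬ blk (x i)) := by
    intro h
    have h1 : x j = x i + 1 := by
      apply ZMod.val_injective m
      rw [zmod_val_add_one (by omega), if_neg (by omega)]
      exact h.symm
    rw [h1]; exact hb _
  constructor
  · intro h
    constructor
    · rintro (h1 | h1) <;> omega
    · rintro (h1 | h1) <;> omega
  · rintro ⟨h1, h2⟩
    have v1 := val_of_not_wraps hm ha h1
    have v2 := val_of_not_wraps hm ha h2
    have w1 : z i = x i → (z i).val = (x i).val := fun h => by rw [h]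
    have w2 : z j = x j → (z j).val = (x j).val := fun h => by rw [h]
    have v1 := v1.imp_left w1
    have v2 := v2.imp_left w2
    by_cases hA : (x i).val + 1 = (x j).val
    · have := hadj hA
      rcases v1 with v1 | v1 | v1 <;> rcases v2 with v2 | v2 | v2 <;> first | omega | tauto
    · rcases v1 with v1 | v1 | v1 <;> rcases v2 with v2 | v2 | v2 <;> omega

/-- At most one particle crosses the cut: of the two sites next to the cut only one is black, and
particles move from black sites only. -/
theorem wraps_unique (hb : ∀ x, blk (x + 1) ↔ ¬ blk x) {n : ℕ}
    {x z : Fin n → ZMod m} (hx : Function.Injective x) (ha : Allowed blk x z) (hm : 2 < m)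
    {i j : Fin n} (hi : Wraps x z i) (hj : Wraps x z j) : i = j := by
  have hblk : ∀ i, Wraps x z i → blk (x i) := by
    intro i hi
    have h1 : (1 : ZMod m) ≠ 0 := by
      have : Fact (1 < m) := ⟨by omega⟩
      exact one_ne_zero
    rcases ha i with h | ⟨h, -⟩
    · rcases hi with h' | h'
      · exact absurd (h.symm.trans h'.1) (fun e => h1 (by linear_combination -e))
      · exact absurd (h.symm.trans h'.1) (fun e => h1 (by linear_combination e))
    · exact h
  have opp : ∀ i j, (x i).val + 1 = m → (x j).val = 0 → (blk (x j) ↔ ¬ blk (x i)) := by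
    intro i j h1 h2
    have : x j = x i + 1 := by
      apply ZMod.val_injective m
      rw [zmod_val_add_one (by omega), if_pos h1, h2]
    rw [this]; exact hb _
  have bi := hblk i hi
  have bj := hblk j hj
  rcases hi with hi | hi <;> rcases hj with hj | hj
  · exact hx (ZMod.val_injective m (by omega))
  · exact absurd bi ((opp i j hi.2.1 hj.2.1).1 bj)
  · exact absurd bj ((opp j i hj.2.1 hi.2.1).1 bi)
  · exact hx (ZMod.val_injective m (by omega))

open Classical in
/-- Up to the gauge `u ^ x`, the phase of a move is `1`, except for the boundary phase `ε = u ^ m`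
of a move across the cut. -/
theorem phase_mul_pow (hm : 2 < m) {n : ℕ} {x z : Fin n → ZMod m} (ha : Allowed blk x z)
    {u ε : ℂ} (hu0 : u ≠ 0) (hu : u ^ m = ε) (hε : ε * ε = 1) (i : Fin n) :
    (if z i = x i then 1 else if z i = x i + 1 then u else u⁻¹) * u ^ (x i).val =
      u ^ (z i).val * (if Wraps x z i then ε else 1) := by
  have h2 : (2 : ZMod m) ≠ 0 := by
    intro h
    have := (ZMod.natCast_eq_zero_iff 2 m).1 (by exact_mod_cast h)
    exact absurd (Nat.le_of_dvd (by norm_num) this) (by omega)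
  have h1 : (1 : ZMod m) ≠ 0 := fun h => h2 (by linear_combination 2 * h)
  have e1 : ∀ a : ZMod m, a + 1 ≠ a := fun a h => h1 (by linear_combination h)
  have e2 : ∀ a : ZMod m, a - 1 ≠ a := fun a h => h1 (by linear_combination -h)
  have e3 : ∀ a : ZMod m, a - 1 ≠ a + 1 := fun a h => h2 (by linear_combination -h)
  by_cases hw : Wraps x z i
  · rw [if_pos hw]
    rcases hw with ⟨h, h', h''⟩ | ⟨h, h', h''⟩
    · rw [if_neg (by rw [h]; exact e1 _), if_pos h, ← pow_succ', h', h'', hu]; simp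
    · rw [if_neg (by rw [h]; exact e2 _), if_neg (by rw [h]; exact e3 _), h', pow_zero, mul_one,
        inv_eq_iff_eq_inv, eq_comm, inv_eq_iff_eq_inv, eq_comm, inv_eq_of_mul_eq_one_left]
      rw [mul_assoc, mul_comm ε, ← mul_assoc, ← pow_succ, h'', hu, hε]
  · rw [if_neg hw, mul_one]
    rcases val_of_not_wraps hm ha hw with h | ⟨-, h, h'⟩ | ⟨-, h, h'⟩
    · rw [if_pos h, h, one_mul]
    · rw [if_neg (by rw [h]; exact e1 _), if_pos h, h', pow_succ']
    · rw [if_neg (by rw [h]; exact e2 _), if_neg (by rw [h]; exact e3 _), ← h', pow_succ']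
      field_simp

/-- The boundary phase compensates the sign of the permutation that sorts the particles after the
moves. -/
theorem sign_mul_hopPhase (hm : 2 < m) (hb : ∀ x, blk (x + 1) ↔ ¬ blk x) {n : ℕ}
    (s t : Set.powersetCard (ZMod m) n) (π : Equiv.Perm (Fin n)) {x z : Fin n → ZMod m}
    (hx : x = Set.powersetCard.ofFinEmbEquiv.symm s)
    (hz : z = Set.powersetCard.ofFinEmbEquiv.symm t ∘ π)
    (ha : Allowed blk x z) {u : ℂ} (hu0 : u ≠ 0) (hu : u ^ m = (-1) ^ (n + 1)) :
    ((Equiv.Perm.sign π : ℤ) : ℂ) * hopPhase u x z * u ^ (∑ i, (x i).val) =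
      u ^ (∑ i, (z i).val) := by
  classical
  have hxi : Function.Injective x := by
    rw [hx]; exact (Set.powersetCard.ofFinEmbEquiv.symm s).injective
  have hzi : Function.Injective z := by
    rw [hz]; exact (Set.powersetCard.ofFinEmbEquiv.symm t).injective.comp π.injective
  have hε : ((-1 : ℂ) ^ (n + 1)) * (-1) ^ (n + 1) = 1 := by
    rw [← mul_pow]; simp
  have hlt : ∀ i j, i < j → (π i < π j ↔ ¬ Wraps x z i ∧ ¬ Wraps x z j) := by
    intro i j hij
    rw [← lt_iff_not_wraps hm hb hzi ha (by rw [hx]; exact OrderEmbedding.strictMono _ hij), hz]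
    exact (OrderEmbedding.lt_iff_lt _).symm
  have hsign : ((Equiv.Perm.sign π : ℤ) : ℂ) =
      ∏ i, (if Wraps x z i then (-1 : ℂ) ^ (n + 1) else 1) := by
    by_cases hw : ∃ i, Wraps x z i
    · obtain ⟨i₀, hi₀⟩ := hw
      have hiff : ∀ i, Wraps x z i ↔ i = i₀ :=
        fun i => ⟨fun h => wraps_unique hb hxi ha hm h hi₀, fun h => h ▸ hi₀⟩
      simp only [hiff] at hlt ⊢
      rw [sign_of_reverse_at π i₀ hlt, Finset.prod_ite_eq' Finset.univ i₀]
      simp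
    · push Not at hw
      rw [sign_eq_one_of_strictMono π fun i j hij => (hlt i j hij).2 ⟨hw i, hw j⟩]
      simp [hw]
  rw [hsign, hopPhase, ← Finset.prod_pow_eq_pow_sum, ← Finset.prod_pow_eq_pow_sum, mul_assoc,
    ← Finset.prod_mul_distrib, ← Finset.prod_mul_distrib]
  refine Finset.prod_congr rfl fun i _ => ?_
  rw [phase_mul_pow hm ha hu0 hu hε i]
  split_ifs
  · linear_combination u ^ (z i).val * hε
  · ring

variable [DecidablePred blk]

/-- The permutations with admissible moves are in bijection with the admissible sets of horizontal
edges. -/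
theorem sum_allowed_eq_hopKernel (hm : 2 < m) (hb : ∀ x, blk (x + 1) ↔ ¬ blk x) {n : ℕ}
    (s t : Set.powersetCard (ZMod m) n) (h : ZMod m → ℝ)
    [DecidablePred fun π : Equiv.Perm (Fin n) => Allowed blk
      (Set.powersetCard.ofFinEmbEquiv.symm s) (Set.powersetCard.ofFinEmbEquiv.symm t ∘ π)] :
    ∑ π ∈ Finset.univ.filter (fun π : Equiv.Perm (Fin n) => Allowed blk
      (Set.powersetCard.ofFinEmbEquiv.symm s) (Set.powersetCard.ofFinEmbEquiv.symm t ∘ π)),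
      ∏ y ∈ hopEdges (Set.powersetCard.ofFinEmbEquiv.symm s)
        (Set.powersetCard.ofFinEmbEquiv.symm t ∘ π), h y = hopKernel blk h s.1 t.1 := by
  classical
  have h2 : (2 : ZMod m) ≠ 0 := by
    intro h
    have := (ZMod.natCast_eq_zero_iff 2 m).1 (by exact_mod_cast h)
    exact absurd (Nat.le_of_dvd (by norm_num) this) (by omega)
  have h1 : (1 : ZMod m) ≠ 0 := fun h => h2 (by linear_combination 2 * h)
  have e1 : ∀ a : ZMod m, a + 1 ≠ a := fun a h => h1 (by linear_combination h)
  have e2 : ∀ a : ZMod m, a - 1 ≠ a := fun a h => h1 (by linear_combination -h)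
  have e3 : ∀ a : ZMod m, a - 1 ≠ a + 1 := fun a h => h2 (by linear_combination -h)
  have hb' : ∀ x, blk (x - 1) ↔ ¬ blk x := fun x => by
    have := hb (x - 1); rw [sub_add_cancel] at this; tauto
  set x : Fin n → ZMod m := ⇑(Set.powersetCard.ofFinEmbEquiv.symm s) with hx
  set z : Fin n → ZMod m := ⇑(Set.powersetCard.ofFinEmbEquiv.symm t) with hz
  have hxi : Function.Injective x := (Set.powersetCard.ofFinEmbEquiv.symm s).injective
  have hzi : Function.Injective z := (Set.powersetCard.ofFinEmbEquiv.symm t).injective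
  have hs : ∀ y, y ∈ s.1 ↔ ∃ i, x i = y := fun y =>
    (Set.powersetCard.mem_range_ofFinEmbEquiv_symm_iff_mem s y).symm
  have ht : ∀ y, y ∈ t.1 ↔ ∃ i, z i = y := fun y =>
    (Set.powersetCard.mem_range_ofFinEmbEquiv_symm_iff_mem t y).symm
  have ht' : ∀ (π : Equiv.Perm (Fin n)) y, y ∈ t.1 ↔ ∃ i, (z ∘ π) i = y := by
    intro π y
    rw [ht]
    exact ⟨fun ⟨i, hi⟩ => ⟨π.symm i, by simpa using hi⟩, fun ⟨i, hi⟩ => ⟨π i, hi⟩⟩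
  unfold hopKernel
  refine Finset.sum_bij (fun π _ => hopEdges x (z ∘ π)) ?_ ?_ ?_ ?_
  · intro π hπ
    simp only [Finset.mem_filter, Finset.mem_univ, true_and] at hπ ⊢
    exact hopValid_hopEdges h2 hb hxi (hzi.comp π.injective) hπ hs (ht' π)
  · intro π hπ π' hπ' he
    simp only [Finset.mem_filter, Finset.mem_univ, true_and] at hπ hπ' he
    ext i : 1
    apply hzi
    change (z ∘ π) i = (z ∘ π') i
    by_cases hbi : blk (x i)
    · obtain ⟨m1, m2⟩ := mem_hopEdges_black h2 hb hπ hbi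
      obtain ⟨m1', m2'⟩ := mem_hopEdges_black h2 hb hπ' hbi
      rw [he, m1'] at m1
      rw [he, m2'] at m2
      have u : ∀ (w : Fin n → ZMod m) v, (∃ j, x j = x i ∧ w j = v) ↔ w i = v := by
        intro w v
        constructor
        · rintro ⟨j, hj, hw⟩
          rw [← hxi hj]; exact hw
        · intro hw; exact ⟨i, rfl, hw⟩
      rw [u, u] at m1 m2
      rcases hπ i with h3 | ⟨-, h3 | h3⟩
      · rcases hπ' i with h4 | ⟨-, h4 | h4⟩
        · rw [h3, h4]
        · rw [m1.1 h4, h4]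
        · rw [m2.1 h4, h4]
      · rw [h3, m1.2 h3]
      · rw [h3, m2.2 h3]
    · rw [(hπ i).resolve_right (fun h => hbi h.1), (hπ' i).resolve_right (fun h => hbi h.1)]
  · intro H hH
    simp only [Finset.mem_filter, Finset.mem_univ, true_and] at hH
    -- the motion of the particles prescribed by `H`
    let f : ZMod m → ZMod m := fun y =>
      if blk y then (if y ∈ H then y + 1 else if y - 1 ∈ H then y - 1 else y) else y
    have hft : ∀ y ∈ s.1, f y ∈ t.1 := by
      intro y hy
      by_cases hby : blk y
      · simp only [f, if_pos hby]
        have v := hH y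
        simp only [hby, hy, not_true_eq_false, iff_true, iff_false, if_false] at v
        by_cases q1 : y ∈ H
        · have v' := hH (y + 1)
          rw [if_pos q1]
          simp only [(hb y), hby, not_true_eq_false, not_false_eq_true, iff_true, iff_false,
            add_sub_cancel_right, q1, if_true] at v'
          by_contra hc
          simp [hc] at v'
        · rw [if_neg q1]
          by_cases q2 : y - 1 ∈ H
          · have v' := hH (y - 1)
            rw [if_pos q2]
            simp only [(hb' y), hby, not_true_eq_false, not_false_eq_true, iff_true, iff_false,
              q2, if_true] at v'
            by_contra hc
            simp only [hc, not_false_eq_true, if_true] at v'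
            omega
          · rw [if_neg q2]
            by_contra hc
            simp [hc, q1, q2] at v
      · simp only [f, if_neg hby]
        have v := hH y
        by_contra hc
        simp only [hby, hy, hc, not_false_eq_true, if_true] at v
        omega
    have hfi : ∀ y ∈ s.1, ∀ y' ∈ s.1, f y = f y' → y = y' := by
      have key1 : ∀ y ∈ s.1, ∀ y' ∈ s.1, blk y → ¬ blk y' → f y = f y' → y = y' := by
        intro y hy y' hy' hby hby' he
        simp only [f, if_pos hby, if_neg hby'] at he
        have v := hH y'
        simp only [hy', hby', not_false_eq_true, iff_false, if_true] at v
        have q1 : y' ∉ H := fun hc => by simp only [hc, if_true] at v; omega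
        have q2 : y' - 1 ∉ H := fun hc => by simp only [hc, if_true] at v; omega
        split_ifs at he with h3 h4
        · rw [← he, add_sub_cancel_right] at q2; exact absurd h3 q2
        · rw [← he] at q1; exact absurd h4 q1
        · exact he
      intro y hy y' hy' he
      by_cases hby : blk y <;> by_cases hby' : blk y'
      · simp only [f, if_pos hby, if_pos hby'] at he
        split_ifs at he with q1 q2 q3 q4 q5 q6
        · exact add_right_cancel he
        · exfalso
          -- both particles would enter the same white site
          have v := hH (y + 1)
          rw [add_sub_cancel_right, if_pos q1, he, if_pos q3] at v
          omega
        · exfalso; rw [← he, hb] at hby'; exact hby' hby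
        · exfalso
          have v := hH (y' + 1)
          rw [add_sub_cancel_right, if_pos q5, ← he, if_pos q4] at v
          omega
        · exact sub_left_injective he
        · exfalso; rw [← he, hb'] at hby'; exact hby' hby
        · exfalso; rw [he, hb] at hby; exact hby hby'
        · exfalso; rw [he, hb'] at hby; exact hby hby'
        · exact he
      · exact key1 y hy y' hy' hby hby' he
      · exact (key1 y' hy' y hy hby' hby he.symm).symm
      · simpa only [f, if_neg hby, if_neg hby'] using he
    have hg : ∀ i, ∃ j, z j = f (x i) := fun i => (ht _).1 (hft _ ((hs _).2 ⟨i, rfl⟩))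
    choose g hg using hg
    have hgi : Function.Injective g := by
      intro i j hij
      apply hxi
      apply hfi _ ((hs _).2 ⟨i, rfl⟩) _ ((hs _).2 ⟨j, rfl⟩)
      rw [← hg, ← hg, hij]
    let π : Equiv.Perm (Fin n) := Equiv.ofBijective g (Finite.injective_iff_bijective.1 hgi)
    have hπ : ∀ i, (z ∘ π) i = f (x i) := hg
    have hall : Allowed blk x (z ∘ π) := by
      intro i
      rw [hπ]
      simp only [f]
      split_ifs <;> tauto
    refine ⟨π, by simpa using hall, ?_⟩
    have hblkH : ∀ y, blk y → y ∈ H ∨ y - 1 ∈ H → y ∈ s.1 := by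
      intro y hby hyH
      by_contra hc
      have v := hH y
      simp only [hby, hc, not_true_eq_false, iff_true, if_true] at v
      rcases hyH with q | q <;> simp only [q, if_true] at v <;> omega
    ext y
    by_cases hby : blk y
    · rw [(mem_hopEdges_black h2 hb hall hby).1]
      constructor
      · rintro ⟨i, hi, hzi⟩
        rw [hπ, hi] at hzi
        simp only [f, if_pos hby] at hzi
        split_ifs at hzi with q1 q2
        · exact q1
        · exact absurd hzi (e3 y)
        · exact absurd hzi (e1 y).symm
      · intro hy
        obtain ⟨i, hi⟩ := (hs y).1 (hblkH y hby (Or.inl hy))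
        exact ⟨i, hi, by rw [hπ, hi]; simp only [f, if_pos hby, if_pos hy]⟩
    · have hby1 : blk (y + 1) := (hb y).2 hby
      have mm := (mem_hopEdges_black h2 hb hall hby1).2
      rw [add_sub_cancel_right] at mm
      rw [mm]
      constructor
      · rintro ⟨i, hi, hzi⟩
        rw [hπ, hi] at hzi
        simp only [f, if_pos hby1, add_sub_cancel_right] at hzi
        split_ifs at hzi with q1 q2
        · exact absurd (by rw [← hzi]; ring : y - 1 = y + 1 - 1 - 1 + 0) (by
            intro _
            exact e3 (y + 1) (by rw [add_sub_cancel_right]; exact hzi.symm))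
        · exact q2
        · exact absurd hzi (e1 y)
      · intro hy
        have hy' : y + 1 ∈ s.1 := hblkH _ hby1 (Or.inr (by rwa [add_sub_cancel_right]))
        obtain ⟨i, hi⟩ := (hs _).1 hy'
        refine ⟨i, hi, ?_⟩
        rw [hπ, hi]
        have hn : y + 1 ∉ H := by
          intro hc
          have v := hH (y + 1)
          rw [add_sub_cancel_right, if_pos hc, if_pos hy] at v
          omega
        simp only [f, if_pos hby1, add_sub_cancel_right, if_neg hn, if_pos hy]
  · intro π _
    rfl

/-- The Leibniz formula for a minor, as a sum over the ways to assign final positions to the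
particles. -/
theorem compound_hopMatrix_apply {n : ℕ} (s t : Set.powersetCard (ZMod m) n)
    (h : ZMod m → ℝ) (u : ℂ) :
    compound n (hopMatrix blk h u) s t = ∑ π : Equiv.Perm (Fin n),
      ((Equiv.Perm.sign π : ℤ) : ℂ) * ∏ i, hopMatrix blk h u
        (Set.powersetCard.ofFinEmbEquiv.symm s i)
        ((Set.powersetCard.ofFinEmbEquiv.symm t ∘ π) i) := by
  rw [compound, Matrix.of_apply, ← Matrix.det_transpose, Matrix.det_apply']
  rfl

/-- With the boundary phase `u ^ m = (-1) ^ (n + 1)`, the minors of order `n` of the one-particle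
matrix are, up to a gauge, sums over admissible sets of edges without signs: a particle that
crosses the cut overtakes the `n - 1` others. -/
theorem compound_hopMatrix (hm : 2 < m) (hb : ∀ x, blk (x + 1) ↔ ¬ blk x) {n : ℕ}
    (s t : Set.powersetCard (ZMod m) n) (h : ZMod m → ℝ) {u : ℂ} (hu0 : u ≠ 0)
    (hu : u ^ m = (-1) ^ (n + 1)) :
    compound n (hopMatrix blk h u) s t * u ^ (∑ x ∈ s.1, x.val) =
      hopKernel blk h s.1 t.1 * u ^ (∑ x ∈ t.1, x.val) := by
  classical
  have hsum : ∀ s : Set.powersetCard (ZMod m) n, ∑ x ∈ s.1, x.val =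
      ∑ i, (Set.powersetCard.ofFinEmbEquiv.symm s i).val := by
    intro s
    refine (Finset.sum_congr ?_ fun _ _ => rfl).trans (Finset.sum_map Finset.univ
      (Set.powersetCard.ofFinEmbEquiv.symm s).toEmbedding fun x => x.val)
    ext x
    rw [Finset.mem_map]
    simp only [Finset.mem_univ, true_and]
    exact (Set.powersetCard.mem_range_ofFinEmbEquiv_symm_iff_mem s x).symm
  rw [compound_hopMatrix_apply, ← sum_allowed_eq_hopKernel hm hb, Complex.ofReal_sum,
    Finset.sum_filter, Finset.sum_mul, Finset.sum_mul]
  refine Finset.sum_congr rfl fun π _ => ?_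
  split_ifs with ha
  · rw [prod_hopMatrix hb (Set.powersetCard.ofFinEmbEquiv.symm s).injective ha, hsum t,
      ← Equiv.sum_comp π, hsum s]
    have := sign_mul_hopPhase hm hb s t π rfl rfl ha hu0 hu
    simp only [Function.comp] at this ⊢
    rw [← this]
    ring
  · rw [hopMatrix_prod_eq_zero ha]; simp

/-- For every phase of modulus one, the signs only produce cancellations, so the minors are
dominated by the sums over admissible sets of edges. -/
theorem norm_compound_hopMatrix_le (hm : 2 < m) (hb : ∀ x, blk (x + 1) ↔ ¬ blk x) {n : ℕ}
    (s t : Set.powersetCard (ZMod m) n) (h : ZMod m → ℝ) (hh : ∀ x, 0 ≤ h x) {u : ℂ}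
    (hu : ‖u‖ = 1) :
    ‖compound n (hopMatrix blk h u) s t‖ ≤ hopKernel blk h s.1 t.1 := by
  classical
  rw [compound_hopMatrix_apply, ← sum_allowed_eq_hopKernel hm hb, Finset.sum_filter]
  refine norm_sum_le_of_le _ fun π _ => ?_
  have hs : ‖((Equiv.Perm.sign π : ℤ) : ℂ)‖ = 1 := by
    rcases Int.units_eq_one_or (Equiv.Perm.sign π) with h | h <;> simp [h]
  rw [norm_mul, hs, one_mul]
  split_ifs with ha
  · rw [prod_hopMatrix hb (Set.powersetCard.ofFinEmbEquiv.symm s).injective ha, norm_mul,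
        Complex.norm_real,
      Real.norm_of_nonneg (Finset.prod_nonneg fun x _ => hh x), hopPhase, norm_prod,
      Finset.prod_eq_one, one_mul]
    intro i _
    split_ifs <;> simp [hu]
  · rw [hopMatrix_prod_eq_zero ha]; simp

end RowKernel

/-! ### Plane waves -/

section Fourier

/-- The parity of a residue modulo `2L`. -/
def par (L : ℕ) : ZMod (2 * L) →+* ZMod 2 := ZMod.castHom (dvd_mul_right 2 L) (ZMod 2)

/-- The site `x` of a row whose index has parity `b` is black. -/
def RowBlack (L : ℕ) (b : ZMod 2) (x : ZMod (2 * L)) : Prop := par L x + b = 1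

instance (L : ℕ) (b : ZMod 2) : DecidablePred (RowBlack L b) :=
  fun x => inferInstanceAs (Decidable (par L x + b = 1))

theorem rowBlack_add_one (L : ℕ) (b : ZMod 2) (x : ZMod (2 * L)) :
    RowBlack L b (x + 1) ↔ ¬ RowBlack L b x := by
  unfold RowBlack
  rw [map_add, map_one]
  generalize par L x = p
  revert p b
  decide

/-- The weight of the horizontal edge from `x` to `x + 1`, in a row of parity `b`. -/
noncomputable def hopWeight (L : ℕ) (b : ZMod 2) (H₂ w : ℝ) (x : ZMod (2 * L)) : ℝ :=
  if RowBlack L b x then w * Real.exp (-H₂) else w * Real.exp H₂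

/-- The one-particle matrix of a row of parity `b`, normalized so that a particle at rest on a white
site has weight `1`. -/
noncomputable def rowMatrix (L : ℕ) [NeZero L] (b : ZMod 2) (H₂ : ℝ) (u : ℂ) (w : ℝ × ℝ) :
    Matrix (ZMod (2 * L)) (ZMod (2 * L)) ℂ :=
  hopMatrix (RowBlack L b) (hopWeight L b H₂ w.1) u *
    Matrix.diagonal fun x => if RowBlack L b x then (w.2 : ℂ) ^ 2 else 1

/-- The momenta `π j / L - π / 2`, as phases. -/
noncomputable def momentum (L : ℕ) (j : Fin L) : ℂ :=
  Complex.exp (Complex.I * (Real.pi * (j : ℕ) / L - Real.pi / 2 : ℝ))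

/-- Plane waves supported on the sites of one colour. The colour of a column is relative to the row
of parity `b + 1`: white for `c = 0` and black for `c = 1`. -/
noncomputable def planeWaves (L : ℕ) (b : ZMod 2) : Matrix (ZMod (2 * L)) (Fin 2 × Fin L) ℂ :=
  Matrix.of fun x q => if par L x + b + 1 = (q.1 : ℕ) then momentum L q.2 ^ x.val else 0

variable {L : ℕ}

theorem momentum_ne_zero (j : Fin L) : momentum L j ≠ 0 := Complex.exp_ne_zero _

theorem par_two : par L 2 = 0 := by
  rw [map_ofNat]; decide

theorem norm_planeWaves_le (b : ZMod 2) (x : ZMod (2 * L)) (q : Fin 2 × Fin L) :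
    ‖planeWaves L b x q‖ ≤ 1 := by
  simp only [planeWaves, Matrix.of_apply]
  split_ifs
  · rw [norm_pow, momentum, Complex.norm_exp_I_mul_ofReal, one_pow]
  · simp

variable [NeZero L]

theorem momentum_pow (hL : Even L) (j : Fin L) : momentum L j ^ (2 * L) = 1 := by
  obtain ⟨l, hl⟩ := hL
  rw [momentum, ← Complex.exp_nat_mul, Complex.exp_eq_one_iff]
  refine ⟨(j : ℤ) - l, ?_⟩
  have h0 : (L : ℂ) ≠ 0 := Nat.cast_ne_zero.2 (NeZero.ne L)
  have h1 : (L : ℂ) = l + l := by rw [hl]; push_cast; ring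
  push_cast
  field_simp
  rw [h1]
  ring

theorem momentum_pow_val_add_one (hL : Even L) (j : Fin L) (x : ZMod (2 * L)) :
    momentum L j ^ (x + 1).val = momentum L j ^ x.val * momentum L j := by
  have h1 : 1 < 2 * L := by have := NeZero.pos L; omega
  rw [zmod_val_add_one h1]
  split_ifs with h
  · rw [← pow_succ, h, momentum_pow hL, pow_zero]
  · rw [pow_succ]

theorem momentum_pow_val_sub_one (hL : Even L) (j : Fin L) (x : ZMod (2 * L)) :
    momentum L j ^ (x - 1).val = momentum L j ^ x.val * (momentum L j)⁻¹ := by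
  have := momentum_pow_val_add_one hL j (x - 1)
  rw [sub_add_cancel] at this
  rw [this, mul_assoc, mul_inv_cancel₀ (momentum_ne_zero j), mul_one]

theorem two_ne_zero_zmod (hL : Even L) : (2 : ZMod (2 * L)) ≠ 0 := by
  intro h
  have := (ZMod.natCast_eq_zero_iff 2 (2 * L)).1 (by exact_mod_cast h)
  have h2 := Nat.le_of_dvd (by norm_num) this
  obtain ⟨l, hl⟩ := hL
  have := NeZero.pos L
  omega

/-- The one-particle matrix as a difference operator. -/
theorem hopMatrix_mulVec {m : ℕ} [NeZero m] (h2 : (2 : ZMod m) ≠ 0) (blk : ZMod m → Prop)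
    [DecidablePred blk] (h : ZMod m → ℝ) (u : ℂ) (v : ZMod m → ℂ) (x : ZMod m) :
    (hopMatrix blk h u).mulVec v x = v x +
      if blk x then h x * u * v (x + 1) + h (x - 1) * u⁻¹ * v (x - 1) else 0 := by
  have h1 : (1 : ZMod m) ≠ 0 := fun h => h2 (by linear_combination 2 * h)
  have e1 : ∀ a : ZMod m, a + 1 ≠ a := fun a h => h1 (by linear_combination h)
  have e2 : ∀ a : ZMod m, a - 1 ≠ a := fun a h => h1 (by linear_combination -h)
  have e3 : ∀ a : ZMod m, a - 1 ≠ a + 1 := fun a h => h2 (by linear_combination -h)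
  have key : ∀ x', hopMatrix blk h u x x' * v x' = (if x' = x then v x' else 0) +
      ((if x' = x + 1 then (if blk x then h x * u * v x' else 0) else 0) +
      (if x' = x - 1 then (if blk x then h x' * u⁻¹ * v x' else 0) else 0)) := by
    intro x'
    simp only [hopMatrix, Matrix.of_apply]
    by_cases hx : x' = x
    · subst hx
      simp [(e1 x').symm, (e2 x').symm]
    · by_cases hy : x' = x + 1
      · subst hy
        by_cases hb : blk x <;> simp [hb, e1, (e3 x).symm]
      · by_cases hz : x' = x - 1
        · subst hz
          by_cases hb : blk x <;> simp [hb, e2, e3]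
        · simp [hx, hy, hz]
  simp only [Matrix.mulVec, dotProduct, key, Finset.sum_add_distrib, Finset.sum_ite_eq',
    Finset.mem_univ, if_true]
  split_ifs <;> simp

/-- A row acts on the plane waves of momentum `θ_j - π / 2` through the transfer matrix. -/
theorem rowMatrix_mul_planeWaves (hL : Even L) (b : ZMod 2) (H₂ κ : ℝ) (w : ℝ × ℝ) :
    rowMatrix L b H₂ (Complex.exp (Complex.I * κ)) w * planeWaves L (b + 1) =
      planeWaves L b * Matrix.blockDiagonal fun j : Fin L =>
        transferMatrix (Real.pi * (j : ℕ) / L + κ) H₂ w.1 w.2 := by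
  ext x ⟨c, j⟩
  have hz := momentum_ne_zero j
  set u := Complex.exp (Complex.I * κ) with hu
  have hu0 : u ≠ 0 := Complex.exp_ne_zero _
  have hsin : 2 * Complex.sin (((Real.pi * (j : ℕ) / L + κ : ℝ) : ℂ) + Complex.I * (H₂ : ℂ)) =
      Real.exp (-H₂) * (u * momentum L j) + Real.exp H₂ * (u * momentum L j)⁻¹ := by
    have h1 : ((Real.pi * (j : ℕ) / L + κ : ℝ) : ℂ) + Complex.I * (H₂ : ℂ) =
        Real.pi / 2 - (-((Real.pi * (j : ℕ) / L + κ - Real.pi / 2 : ℝ) + Complex.I * H₂)) := by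
      push_cast; ring
    rw [h1, Complex.sin_pi_div_two_sub, Complex.cos_neg, Complex.cos, hu, momentum,
      ← Complex.exp_add, ← Complex.exp_neg, Complex.ofReal_exp, Complex.ofReal_exp,
      ← Complex.exp_add, ← Complex.exp_add, mul_div_cancel₀ _ two_ne_zero]
    have hI := Complex.I_mul_I
    congr 1
    · congr 1
      push_cast
      linear_combination H₂ * hI
    · congr 1
      push_cast
      linear_combination -H₂ * hI
  have hR : (planeWaves L b * Matrix.blockDiagonal fun j : Fin L =>
        transferMatrix (Real.pi * (j : ℕ) / L + κ) H₂ w.1 w.2) x (c, j) =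
      ∑ c', planeWaves L b x (c', j) *
        transferMatrix (Real.pi * (j : ℕ) / L + κ) H₂ w.1 w.2 c' c := by
    rw [Matrix.mul_apply, Fintype.sum_prod_type]
    refine Finset.sum_congr rfl fun c' _ => ?_
    rw [Finset.sum_eq_single j]
    · rw [Matrix.blockDiagonal_apply_eq]
    · intro j' _ hj'
      rw [Matrix.blockDiagonal_apply_ne _ _ _ hj', mul_zero]
    · simp
  rw [hR, rowMatrix, Matrix.mul_assoc, Matrix.mul_apply]
  refine (hopMatrix_mulVec (two_ne_zero_zmod hL) (RowBlack L b) (hopWeight L b H₂ w.1) u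
    (fun x' => ((Matrix.diagonal fun x => if RowBlack L b x then (w.2 : ℂ) ^ 2 else 1) *
      planeWaves L (b + 1)) x' (c, j)) x).trans ?_
  simp only [Matrix.diagonal_mul, planeWaves, Matrix.of_apply, map_add, map_sub, map_one,
    RowBlack, hopWeight, momentum_pow_val_add_one hL, momentum_pow_val_sub_one hL, Fin.sum_univ_two]
  have hp : par L x + b = 0 ∨ par L x + b = 1 := by
    generalize par L x + b = p; revert p; decide
  have e1 : ∀ p b : ZMod 2, p + 1 + b = p + b + 1 := by decide
  have e2 : ∀ p b : ZMod 2, p - 1 + b = p + b + 1 := by decide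
  have e3 : ∀ p b : ZMod 2, p + (b + 1) + 1 = p + b := by decide
  have e4 : ∀ p b : ZMod 2, p + 1 + (b + 1) + 1 = p + b + 1 := by decide
  have e5 : ∀ p b : ZMod 2, p - 1 + (b + 1) + 1 = p + b + 1 := by decide
  rw [e1, e2, e3, e4, e5]
  have d1 : (1 : ZMod 2) + 1 = 0 := by decide
  have d2 : (0 : ZMod 2) ≠ 1 := by decide
  rcases hp with hp | hp <;> simp only [hp] <;> fin_cases c <;>
    simp [transferMatrix, d1, d2, mul_comm (2 : ℂ)]
  rw [mul_inv] at hsin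
  push_cast at hsin
  · linear_combination -(momentum L j ^ x.val * w.1) * hsin
  · ring

theorem card_par_eq (p : ZMod 2) :
    ∑ x : ZMod (2 * L), (if par L x = p then (1 : ℂ) else 0) = L := by
  have h : ∀ p, ∑ x : ZMod (2 * L), (if par L x = p then (1 : ℂ) else 0) =
      ∑ x : ZMod (2 * L), (if par L x = p + 1 then (1 : ℂ) else 0) := by
    intro p
    rw [← Equiv.sum_comp (Equiv.addRight (1 : ZMod (2 * L)))
      (fun x => if par L x = p + 1 then (1 : ℂ) else 0)]
    refine Finset.sum_congr rfl fun x _ => ?_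
    simp only [Equiv.coe_addRight, map_add, map_one, add_left_inj]
  have h2 : ∑ x : ZMod (2 * L), (if par L x = p then (1 : ℂ) else 0) +
      ∑ x : ZMod (2 * L), (if par L x = p + 1 then (1 : ℂ) else 0) = 2 * L := by
    rw [← Finset.sum_add_distrib]
    have : ∀ a : ZMod 2, (if a = p then (1 : ℂ) else 0) + (if a = p + 1 then 1 else 0) = 1 := by
      have h3 : ∀ a p : ZMod 2, a = p ∨ a = p + 1 := by decide
      have h4 : ∀ p : ZMod 2, p ≠ p + 1 := by decide
      intro a
      rcases h3 a p with rfl | rfl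
      · simp
      · simp
    simp only [this, Finset.sum_const, Finset.card_univ, ZMod.card]
    simp
  have h1 := h p
  linear_combination (h1 + h2) / 2

theorem sum_par_pow_eq_zero {η : ℂ} (hη : η ^ (2 * L) = 1) (hη2 : η ^ 2 ≠ 1) (p : ZMod 2) :
    ∑ x : ZMod (2 * L), (if par L x = p then η ^ x.val else 0) = 0 := by
  have h1 : 1 < 2 * L := by have := NeZero.pos L; omega
  have hs : ∀ x : ZMod (2 * L), η ^ (x + 1).val = η ^ x.val * η := by
    intro x
    rw [zmod_val_add_one h1]
    split_ifs with h
    · rw [← pow_succ, h, hη, pow_zero]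
    · rw [pow_succ]
  have h : ∑ x : ZMod (2 * L), (if par L x = p then η ^ x.val else 0) =
      η ^ 2 * ∑ x : ZMod (2 * L), (if par L x = p then η ^ x.val else 0) := by
    conv_lhs => rw [← Equiv.sum_comp (Equiv.addRight (2 : ZMod (2 * L)))]
    rw [Finset.mul_sum]
    refine Finset.sum_congr rfl fun x _ => ?_
    simp only [Equiv.coe_addRight, map_add, par_two, add_zero]
    rw [show x + 2 = x + 1 + 1 by ring, hs, hs]
    split_ifs <;> ring
  have h3 : (1 - η ^ 2) * ∑ x : ZMod (2 * L), (if par L x = p then η ^ x.val else 0) = 0 := by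
    linear_combination h
  exact (mul_eq_zero.1 h3).resolve_left (sub_ne_zero.2 hη2.symm)

/-- Orthogonality of the plane waves. -/
theorem planeWaves_conjTranspose_mul (hL : Even L) (b : ZMod 2) :
    (planeWaves L b).conjTranspose * planeWaves L b = (L : ℂ) • 1 := by
  ext ⟨c, j⟩ ⟨c', l⟩
  rw [Matrix.mul_apply]
  simp only [Matrix.conjTranspose_apply, planeWaves, Matrix.of_apply, Matrix.smul_apply,
    Matrix.one_apply, Prod.mk.injEq, smul_eq_mul]
  have hcast : ∀ c c' : Fin 2, ((c : ℕ) : ZMod 2) = (c' : ℕ) → c = c' := by decide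
  by_cases hc : c = c'
  · subst hc
    have key : ∀ x : ZMod (2 * L), star (if par L x + b + 1 = (c : ℕ) then
        momentum L j ^ x.val else 0) * (if par L x + b + 1 = (c : ℕ) then
        momentum L l ^ x.val else 0) = if par L x = (c : ℕ) - b - 1 then
        (star (momentum L j) * momentum L l) ^ x.val else 0 := by
      intro x
      have : par L x + b + 1 = (c : ℕ) ↔ par L x = (c : ℕ) - b - 1 := by
        constructor <;> intro h
        · rw [← h]; ring
        · rw [h]; ring
      simp only [← this]
      split_ifs <;> simp [mul_pow]
    simp only [key]
    have hη : star (momentum L j) * momentum L l =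
        Complex.exp (Complex.I * (Real.pi * (l : ℕ) / L - Real.pi * (j : ℕ) / L : ℝ)) := by
      rw [momentum, momentum, Complex.star_def, ← Complex.exp_conj, ← Complex.exp_add]
      congr 1
      simp only [map_mul, Complex.conj_I, Complex.conj_ofReal]
      push_cast
      ring
    by_cases hj : j = l
    · subst hj
      have : star (momentum L j) * momentum L j = 1 := by rw [hη]; simp
      simp only [this, one_pow, card_par_eq]
      simp
    · rw [sum_par_pow_eq_zero]
      · simp [hj]
      · rw [mul_pow, ← star_pow, momentum_pow hL, momentum_pow hL]; simp
      · rw [hη, ← Complex.exp_nat_mul]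
        intro h1
        rw [Complex.exp_eq_one_iff] at h1
        obtain ⟨n, hn⟩ := h1
        have h0 : (L : ℂ) ≠ 0 := Nat.cast_ne_zero.2 (NeZero.ne L)
        have hpi : (Real.pi : ℂ) ≠ 0 := by exact_mod_cast Real.pi_ne_zero
        have h2 : ((l : ℕ) : ℂ) - (j : ℕ) = n * L := by
          have hI := Complex.I_ne_zero
          push_cast at hn
          field_simp at hn
          linear_combination hn
        have h3 : ((l : ℕ) : ℤ) - (j : ℕ) = n * L := by exact_mod_cast h2
        have hj' := j.2
        have hl' := l.2
        have hn0 : n = 0 := by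
          by_contra hne
          rcases lt_or_gt_of_ne hne with hlt | hgt
          · nlinarith
          · nlinarith
        rw [hn0] at h3
        apply hj
        ext
        omega
  · rw [Finset.sum_eq_zero, if_neg (by tauto), mul_zero]
    intro x _
    by_cases h : par L x + b + 1 = (c : ℕ)
    · rw [if_neg (c := par L x + b + 1 = (c' : ℕ)), mul_zero]
      intro h'
      exact hc (hcast _ _ (h.symm.trans h'))
    · rw [if_neg h]; simp

/-- The inverse of `planeWaves`. -/
noncomputable def planeWavesInv (L : ℕ) (b : ZMod 2) : Matrix (Fin 2 × Fin L) (ZMod (2 * L)) ℂ :=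
  (L : ℂ)⁻¹ • (planeWaves L b).conjTranspose

theorem planeWavesInv_mul (hL : Even L) (b : ZMod 2) : planeWavesInv L b * planeWaves L b = 1 := by
  rw [planeWavesInv, Matrix.smul_mul, planeWaves_conjTranspose_mul hL, smul_smul,
    inv_mul_cancel₀ (Nat.cast_ne_zero.2 (NeZero.ne L)), one_smul]

theorem planeWaves_mul_inv (hL : Even L) (b : ZMod 2) : planeWaves L b * planeWavesInv L b = 1 := by
  have hc : Fintype.card (Fin 2 × Fin L) = Fintype.card (ZMod (2 * L)) := by
    rw [ZMod.card]; simp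
  exact (Matrix.mul_eq_one_comm_of_equiv (Fintype.equivOfCardEq hc)).1 (planeWavesInv_mul hL b)

theorem norm_planeWavesInv_le (b : ZMod 2) (x : ZMod (2 * L)) (q : Fin 2 × Fin L) :
    ‖planeWavesInv L b q x‖ ≤ 1 := by
  rw [planeWavesInv, Matrix.smul_apply, Matrix.conjTranspose_apply, norm_smul, norm_star]
  have h1 : ‖(L : ℂ)⁻¹‖ ≤ 1 := by
    rw [norm_inv, Complex.norm_natCast]
    exact inv_le_one_of_one_le₀ (by exact_mod_cast NeZero.pos L)
  exact mul_le_one₀ h1 (norm_nonneg _) (norm_planeWaves_le b x q)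

end Fourier

/-! ### Perfect matchings as families of edges -/

section Matchings

variable {L N : ℕ}

theorem two_ne_zero_of_two_le {n : ℕ} (hn : 2 ≤ n) : (2 : ZMod (2 * n)) ≠ 0 := by
  intro h
  have := (ZMod.natCast_eq_zero_iff 2 (2 * n)).1 (by exact_mod_cast h)
  have h2 := Nat.le_of_dvd (by norm_num) this
  omega

theorem isBlack_iff (p : Vertex L N) : IsBlack p ↔ par L p.1 + par N p.2 = 1 := by
  have h : ∀ (n : ℕ) (a : ZMod (2 * n)), par n a = (a.valMinAbs : ZMod 2) := by
    intro n a
    conv_lhs => rw [← ZMod.coe_valMinAbs a]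
    exact map_intCast (par n) _
  rw [h, h, IsBlack, ← Int.cast_add]
  exact ZMod.intCast_eq_one_iff_odd.symm

theorem edgeWeight_up (hN : 2 ≤ N) (w₁ w₂ : ℤ → ℝ) (H₁ H₂ : ℝ) (p : Vertex L N) :
    edgeWeight w₁ w₂ H₁ H₂ s(p, up p) = verticalWeight w₂ H₁ p := by
  have h1 := zmod_two_mul_one_ne_zero N
  have h1' := zmod_two_mul_one_ne_zero L
  have h2 := two_ne_zero_of_two_le hN
  have e1 : up p ≠ right p := fun h => h1' (by
    have := congrArg Prod.fst h; simp only [up, right] at this; linear_combination -this)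
  have e2 : p ≠ right (up p) := fun h => h1' (by
    have := congrArg Prod.fst h; simp only [up, right] at this; linear_combination -this)
  have e3 : p ≠ up (up p) := fun h => h2 (by
    have := congrArg Prod.snd h; simp only [up] at this; linear_combination -this)
  simp [edgeWeight, e1, e2, e3]

theorem edgeWeight_right (hL : 2 ≤ L) (w₁ w₂ : ℤ → ℝ) (H₁ H₂ : ℝ)
    (p : Vertex L N) : edgeWeight w₁ w₂ H₁ H₂ s(p, right p) = horizontalWeight w₁ H₂ p := by
  have h1 := zmod_two_mul_one_ne_zero N
  have h2 := two_ne_zero_of_two_le hL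
  have e1 : right p ≠ up p := fun h => h1 (by
    have := congrArg Prod.snd h; simp only [up, right] at this; linear_combination -this)
  have e2 : p ≠ up (right p) := fun h => h1 (by
    have := congrArg Prod.snd h; simp only [up, right] at this; linear_combination -this)
  have e3 : p ≠ right (right p) := fun h => h2 (by
    have := congrArg Prod.fst h; simp only [right] at this; linear_combination -this)
  simp [edgeWeight, e1, e2, e3]

open Classical in
/-- The weight of a matching as a product over the vertices, each edge being attributed to its lower
or left end. -/
theorem finprod_edgeWeight [NeZero L] [NeZero N] (hL : 2 ≤ L) (hN : 2 ≤ N) (w₁ w₂ : ℤ → ℝ)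
    (H₁ H₂ : ℝ) (D : (torusGraph L N).Subgraph) :
    ∏ᶠ e : D.edgeSet, edgeWeight w₁ w₂ H₁ H₂ e.1 =
      (∏ p : Vertex L N, if D.Adj p (up p) then verticalWeight w₂ H₁ p else 1) *
        ∏ p : Vertex L N, if D.Adj p (right p) then horizontalWeight w₁ H₂ p else 1 := by
  have h1 := zmod_two_mul_one_ne_zero N
  have h1' := zmod_two_mul_one_ne_zero L
  have h2 := two_ne_zero_of_two_le hN
  have h2' := two_ne_zero_of_two_le hL
  have hset : D.edgeSet =
      (((Finset.univ.filter fun p : Vertex L N => D.Adj p (up p)).image fun p => s(p, up p)) ∪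
      ((Finset.univ.filter fun p : Vertex L N => D.Adj p (right p)).image fun p => s(p, right p)) :
        Finset (Sym2 (Vertex L N))) := by
    ext e
    induction e with | _ p q => ?_
    simp only [SimpleGraph.Subgraph.mem_edgeSet, Finset.coe_union, Finset.coe_image,
      Finset.coe_filter, Finset.mem_univ, true_and, Set.mem_union, Set.mem_image,
      Set.mem_ofPred_eq]
    constructor
    · intro h
      rcases D.adj_sub h with rfl | rfl | rfl | rfl
      · exact Or.inr ⟨p, h, rfl⟩
      · exact Or.inr ⟨q, h.symm, Sym2.eq_swap⟩
      · exact Or.inl ⟨p, h, rfl⟩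
      · exact Or.inl ⟨q, h.symm, Sym2.eq_swap⟩
    · rintro (⟨a, ha, he⟩ | ⟨a, ha, he⟩) <;> rw [Sym2.eq_iff] at he <;>
        rcases he with ⟨rfl, rfl⟩ | ⟨rfl, rfl⟩
      · exact ha
      · exact ha.symm
      · exact ha
      · exact ha.symm
  rw [finprod_set_coe_eq_finprod_mem (f := edgeWeight w₁ w₂ H₁ H₂), hset,
    finprod_mem_coe_finset, Finset.prod_union, Finset.prod_image, Finset.prod_image,
    Finset.prod_filter, Finset.prod_filter]
  · simp only [edgeWeight_up hN, edgeWeight_right hL]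
  · intro p _ q _ h
    rcases Sym2.eq_iff.1 h with ⟨h, -⟩ | ⟨h, h'⟩
    · exact h
    · exfalso
      rw [h] at h'
      exact h2' (by
        have := congrArg Prod.fst h'; simp only [right] at this; linear_combination this)
  · intro p _ q _ h
    rcases Sym2.eq_iff.1 h with ⟨h, -⟩ | ⟨h, h'⟩
    · exact h
    · exfalso
      rw [h] at h'
      exact h2 (by have := congrArg Prod.snd h'; simp only [up] at this; linear_combination this)
  · rw [Finset.disjoint_left]
    simp only [Finset.mem_image, Finset.mem_filter, Finset.mem_univ, true_and, not_exists, not_and]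
    rintro e ⟨p, -, rfl⟩ q -  h
    rcases Sym2.eq_iff.1 h with ⟨h, h'⟩ | ⟨h, h'⟩
    · rw [h] at h'
      exact h1' (by
        have := congrArg Prod.fst h'; simp only [up, right] at this; linear_combination this)
    · rw [h] at h'
      exact h1' (by
        have := congrArg Prod.fst h'; simp only [up, right] at this; linear_combination this)

/-- The families `V`, `H` of vertical and horizontal edges, listed by rows and named by their lower
or left ends, form a perfect matching. -/
def TorusValid (V H : ZMod (2 * N) → Finset (ZMod (2 * L))) : Prop :=
  ∀ y x, (if x ∈ V y then 1 else 0) + (if x ∈ V (y - 1) then 1 else 0) +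
    (if x ∈ H y then 1 else 0) + (if x - 1 ∈ H y then 1 else 0) = (1 : ℕ)

/-- The matching with vertical edges `V` and horizontal edges `H`. -/
def matchingOf (V H : ZMod (2 * N) → Finset (ZMod (2 * L))) : (torusGraph L N).Subgraph where
  verts := Set.univ
  Adj p q := (q = right p ∧ p.1 ∈ H p.2) ∨ (p = right q ∧ q.1 ∈ H q.2) ∨
    (q = up p ∧ p.1 ∈ V p.2) ∨ (p = up q ∧ q.1 ∈ V q.2)
  adj_sub := by
    intro p q h
    change q = right p ∨ p = right q ∨ q = up p ∨ p = up q
    tauto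
  edge_vert := fun _ => trivial
  symm := ⟨fun p q h => by tauto⟩

theorem existsUnique_of_four {α : Type*} {P : α → Prop} {a b c d : α} (hab : a ≠ b) (hac : a ≠ c)
    (had : a ≠ d) (hbc : b ≠ c) (hbd : b ≠ d) (hcd : c ≠ d)
    (hP : ∀ w, P w → w = a ∨ w = b ∨ w = c ∨ w = d)
    [Decidable (P a)] [Decidable (P b)] [Decidable (P c)] [Decidable (P d)] :
    (∃! w, P w) ↔ (if P a then 1 else 0) + (if P b then 1 else 0) + (if P c then 1 else 0) +
      (if P d then 1 else 0) = (1 : ℕ) := by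
  constructor
  · rintro ⟨w, hw, hu⟩
    have hu' : ∀ y, y ≠ w → ¬ P y := fun y hy h => hy (hu y h)
    rcases hP w hw with rfl | rfl | rfl | rfl
    · rw [if_pos hw, if_neg (hu' _ hab.symm), if_neg (hu' _ hac.symm), if_neg (hu' _ had.symm)]
    · rw [if_pos hw, if_neg (hu' _ hab), if_neg (hu' _ hbc.symm), if_neg (hu' _ hbd.symm)]
    · rw [if_pos hw, if_neg (hu' _ hac), if_neg (hu' _ hbc), if_neg (hu' _ hcd.symm)]
    · rw [if_pos hw, if_neg (hu' _ had), if_neg (hu' _ hbd), if_neg (hu' _ hcd)]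
  · intro h
    have key : ∀ w, P w → (∀ y, P y → y = w) → ∃! w, P w := fun w h1 h2 => ⟨w, h1, h2⟩
    by_cases h1 : P a
    · refine key a h1 fun y hy => ?_
      rw [if_pos h1] at h
      rcases hP y hy with rfl | rfl | rfl | rfl
      · rfl
      all_goals (rw [if_pos hy] at h; omega)
    by_cases h2 : P b
    · refine key b h2 fun y hy => ?_
      rw [if_pos h2] at h
      rcases hP y hy with rfl | rfl | rfl | rfl
      · exact absurd hy h1
      · rfl
      all_goals (rw [if_pos hy] at h; omega)
    by_cases h3 : P c
    · refine key c h3 fun y hy => ?_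
      rw [if_pos h3] at h
      rcases hP y hy with rfl | rfl | rfl | rfl
      · exact absurd hy h1
      · exact absurd hy h2
      · rfl
      · rw [if_pos hy] at h; omega
    by_cases h4 : P d
    · refine key d h4 fun y hy => ?_
      rcases hP y hy with rfl | rfl | rfl | rfl
      · exact absurd hy h1
      · exact absurd hy h2
      · exact absurd hy h3
      · rfl
    · simp [h1, h2, h3, h4] at h

open Classical in
/-- A vertex is covered exactly once if exactly one of its four edges belongs to `D`. -/
theorem existsUnique_adj_iff (hL : 2 ≤ L) (hN : 2 ≤ N) (D : (torusGraph L N).Subgraph)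
    (x : ZMod (2 * L)) (y : ZMod (2 * N)) :
    (∃! q, D.Adj (x, y) q) ↔ (if D.Adj (x, y) (up (x, y)) then 1 else 0) +
      (if D.Adj (x, y - 1) (up (x, y - 1)) then 1 else 0) +
      (if D.Adj (x, y) (right (x, y)) then 1 else 0) +
      (if D.Adj (x - 1, y) (right (x - 1, y)) then 1 else 0) = (1 : ℕ) := by
  have h1 := zmod_two_mul_one_ne_zero N
  have h1' := zmod_two_mul_one_ne_zero L
  have h2 := two_ne_zero_of_two_le hN
  have h2' := two_ne_zero_of_two_le hL
  have e1 : up (x, y - 1) = (x, y) := by simp [up]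
  have e2 : right (x - 1, y) = (x, y) := by simp [right]
  rw [e1, e2, D.adj_comm (x, y - 1), D.adj_comm (x - 1, y)]
  apply existsUnique_of_four
  · intro h
    have := congrArg Prod.snd h; simp only [up] at this
    exact h2 (by linear_combination this)
  · intro h
    have := congrArg Prod.snd h; simp only [up, right] at this
    exact h1 (by linear_combination this)
  · intro h
    have := congrArg Prod.snd h; simp only [up] at this
    exact h1 (by linear_combination this)
  · intro h
    have := congrArg Prod.snd h; simp only [right] at this
    exact h1 (by linear_combination -this)
  · intro h
    have := congrArg Prod.snd h; simp only at this
    exact h1 (by linear_combination -this)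
  · intro h
    have := congrArg Prod.fst h; simp only [right] at this
    exact h2' (by linear_combination this)
  · intro q hq
    rcases D.adj_sub hq with h | h | h | h
    · right; right; left; exact h
    · right; right; right
      rw [Prod.ext_iff] at h ⊢
      simp only [right] at h ⊢
      exact ⟨by rw [h.1]; ring, h.2.symm⟩
    · left; exact h
    · right; left
      rw [Prod.ext_iff] at h ⊢
      simp only [up] at h ⊢
      exact ⟨h.1.symm, by rw [h.2]; ring⟩

theorem matchingOf_adj_up (hN : 2 ≤ N) (V H : ZMod (2 * N) → Finset (ZMod (2 * L)))
    (p : Vertex L N) : (matchingOf V H).Adj p (up p) ↔ p.1 ∈ V p.2 := by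
  have h1' := zmod_two_mul_one_ne_zero L
  have h2 := two_ne_zero_of_two_le hN
  have e1 : up p ≠ right p := fun h => h1' (by
    have := congrArg Prod.fst h; simp only [up, right] at this; linear_combination -this)
  have e2 : p ≠ right (up p) := fun h => h1' (by
    have := congrArg Prod.fst h; simp only [up, right] at this; linear_combination -this)
  have e3 : p ≠ up (up p) := fun h => h2 (by
    have := congrArg Prod.snd h; simp only [up] at this; linear_combination -this)
  simp only [matchingOf]
  tauto

theorem matchingOf_adj_right (hL : 2 ≤ L) (V H : ZMod (2 * N) → Finset (ZMod (2 * L)))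
    (p : Vertex L N) : (matchingOf V H).Adj p (right p) ↔ p.1 ∈ H p.2 := by
  have h1 := zmod_two_mul_one_ne_zero N
  have h2 := two_ne_zero_of_two_le hL
  have e1 : right p ≠ up p := fun h => h1 (by
    have := congrArg Prod.snd h; simp only [up, right] at this; linear_combination -this)
  have e2 : p ≠ up (right p) := fun h => h1 (by
    have := congrArg Prod.snd h; simp only [up, right] at this; linear_combination -this)
  have e3 : p ≠ right (right p) := fun h => h2 (by
    have := congrArg Prod.fst h; simp only [right] at this; linear_combination -this)
  simp only [matchingOf]
  tauto

open Classical in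
/-- The partition function as a sum over families of edges. The sides have length at least four, so
that the torus has no double edges. -/
theorem partitionFunction_eq_sum_edges [NeZero L] [NeZero N] (hL : 2 ≤ L) (hN : 2 ≤ N)
    (w₁ w₂ : ℤ → ℝ) (H₁ H₂ : ℝ) :
    partitionFunction L N w₁ w₂ H₁ H₂ =
      ∑ V : ZMod (2 * N) → Finset (ZMod (2 * L)),
        ∑ H ∈ Finset.univ.filter (fun H : ZMod (2 * N) → Finset (ZMod (2 * L)) => TorusValid V H),
        ∏ y, (∏ x, if x ∈ V y then verticalWeight w₂ H₁ ((x, y) : Vertex L N) else 1) *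
          ∏ x, if x ∈ H y then horizontalWeight w₁ H₂ ((x, y) : Vertex L N) else 1 := by
  have : Fintype {D : (torusGraph L N).Subgraph // D.IsPerfectMatching} := Fintype.ofFinite _
  rw [partitionFunction, finsum_eq_sum_of_fintype, Finset.sum_sigma']
  have hsurj : ∀ D : (torusGraph L N).Subgraph, D.IsPerfectMatching →
      TorusValid (fun y => Finset.univ.filter fun x => D.Adj (x, y) (up (x, y)))
        (fun y => Finset.univ.filter fun x => D.Adj (x, y) (right (x, y))) := by
    intro D hD y x
    simp only [Finset.mem_filter, Finset.mem_univ, true_and]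
    exact (existsUnique_adj_iff hL hN D x y).1 (hD.1 (hD.2 (x, y)))
  refine Finset.sum_bij' (fun D _ => ⟨fun y =>
    Finset.univ.filter fun x => D.1.Adj (x, y) (up (x, y)),
    fun y => Finset.univ.filter fun x => D.1.Adj (x, y) (right (x, y))⟩)
    (fun VH hVH => ⟨matchingOf VH.1 VH.2, ?_⟩) ?_ ?_ ?_ ?_ ?_
  · simp only [Finset.mem_sigma, Finset.mem_univ, Finset.mem_filter, true_and] at hVH
    refine ⟨?_, fun p => trivial⟩
    rintro ⟨x, y⟩ -
    rw [existsUnique_adj_iff hL hN]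
    simp only [matchingOf_adj_up hN, matchingOf_adj_right hL]
    exact hVH y x
  · intro D _
    simp only [Finset.mem_sigma, Finset.mem_univ, Finset.mem_filter, true_and]
    exact hsurj D.1 D.2
  · intro VH _
    exact Finset.mem_univ _
  · intro D _
    apply Subtype.ext
    refine SimpleGraph.Subgraph.ext ?_ ?_
    · exact (Set.eq_univ_of_forall D.2.2).symm
    · ext p q
      simp only [matchingOf, Finset.mem_filter, Finset.mem_univ, true_and]
      constructor
      · rintro (⟨rfl, h⟩ | ⟨rfl, h⟩ | ⟨rfl, h⟩ | ⟨rfl, h⟩)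
        · exact h
        · exact h.symm
        · exact h
        · exact h.symm
      · intro h
        rcases D.1.adj_sub h with rfl | rfl | rfl | rfl
        · exact Or.inl ⟨rfl, h⟩
        · exact Or.inr (Or.inl ⟨rfl, h.symm⟩)
        · exact Or.inr (Or.inr (Or.inl ⟨rfl, h⟩))
        · exact Or.inr (Or.inr (Or.inr ⟨rfl, h.symm⟩))
  · rintro ⟨V, H⟩ _
    simp only [matchingOf_adj_up hN, matchingOf_adj_right hL]
    congr 1 <;> funext y <;> ext x <;> simp
  · intro D _
    rw [finprod_edgeWeight hL hN, Fintype.prod_prod_type_right, Fintype.prod_prod_type_right,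
      ← Finset.prod_mul_distrib]
    simp

end Matchings

/-! ### The partition function as a trace -/

section RangeProd

/-- The ordered product `A 0 * A 1 * ⋯ * A (n - 1)`. -/
def rangeProd {M : Type*} [Monoid M] (A : ℕ → M) (n : ℕ) : M := ((List.range n).map A).prod

variable {M : Type*} [Monoid M]

@[simp] theorem rangeProd_zero (A : ℕ → M) : rangeProd A 0 = 1 := rfl

theorem rangeProd_succ (A : ℕ → M) (n : ℕ) : rangeProd A (n + 1) = rangeProd A n * A n := by
  simp [rangeProd, List.range_succ]

theorem rangeProd_add (A : ℕ → M) (n k : ℕ) :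
    rangeProd A (n + k) = rangeProd A n * rangeProd (fun i => A (n + i)) k := by
  induction k with
  | zero => simp
  | succ k ih => rw [← add_assoc, rangeProd_succ, ih, rangeProd_succ, mul_assoc]

theorem rangeProd_congr {A B : ℕ → M} {n : ℕ} (h : ∀ i < n, A i = B i) :
    rangeProd A n = rangeProd B n := by
  induction n with
  | zero => simp
  | succ n ih =>
    rw [rangeProd_succ, rangeProd_succ, ih fun i hi => h i (by omega), h n (by omega)]

/-- The expansion of a trace of a product over closed paths. -/
theorem trace_rangeProd {S : Type*} [Fintype S] [DecidableEq S] (A : ℕ → Matrix S S ℝ) (m : ℕ)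
    [NeZero m] : (rangeProd A m).trace = ∑ v : ZMod m → S, ∏ y, A y.val (v y) (v (y + 1)) := by
  have key : ∀ (k : ℕ) (F : S → S → ℝ), ∑ s, ∑ t, rangeProd A k s t * F s t =
      ∑ v : Fin (k + 1) → S, (∏ i : Fin k, A i (v i.castSucc) (v i.succ)) *
        F (v 0) (v (Fin.last k)) := by
    intro k
    induction k with
    | zero =>
      intro F
      rw [← Equiv.sum_comp (Equiv.funUnique (Fin 1) S).symm]
      refine Finset.sum_congr rfl fun s _ => ?_
      simp [Matrix.one_apply]
    | succ k ih =>
      intro F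
      have h1 : ∑ s, ∑ t, rangeProd A (k + 1) s t * F s t =
          ∑ s, ∑ t, rangeProd A k s t * ∑ t', A k t t' * F s t' := by
        refine Finset.sum_congr rfl fun s _ => ?_
        simp only [rangeProd_succ, Matrix.mul_apply, Finset.sum_mul, Finset.mul_sum]
        rw [Finset.sum_comm]
        refine Finset.sum_congr rfl fun t _ => Finset.sum_congr rfl fun t' _ => by ring
      rw [h1, ih, ← Equiv.sum_comp (Fin.snocEquiv fun _ : Fin (k + 1 + 1) => S),
        Fintype.sum_prod_type_right]
      refine Finset.sum_congr rfl fun v _ => ?_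
      rw [Finset.mul_sum]
      refine Finset.sum_congr rfl fun t _ => ?_
      rw [Fin.prod_univ_castSucc]
      have h2 : ∀ i : Fin (k + 1), (Fin.snocEquiv fun _ : Fin (k + 1 + 1) => S) (t, v) i.castSucc
          = v i := fun i => by simp [Fin.snocEquiv]
      have h3 : (Fin.snocEquiv fun _ : Fin (k + 1 + 1) => S) (t, v) (Fin.last (k + 1)) = t := by
        simp [Fin.snocEquiv]
      have h4 : (Fin.snocEquiv fun _ : Fin (k + 1 + 1) => S) (t, v) 0 = v 0 := h2 0
      rw [h3, h4]
      simp only [h2, Fin.succ_castSucc, Fin.succ_last, h3, Fin.val_last, Fin.val_castSucc]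
      ring
  obtain ⟨k, rfl⟩ : ∃ k, m = k + 1 := ⟨m - 1, by have := NeZero.pos m; omega⟩
  have h := key k fun s t => A k t s
  have h1 : (rangeProd A (k + 1)).trace = ∑ s, ∑ t, rangeProd A k s t * A k t s := by
    simp only [Matrix.trace, Matrix.diag_apply, rangeProd_succ, Matrix.mul_apply]
  rw [h1, h]
  refine Finset.sum_congr rfl fun v _ => ?_
  change _ = ∏ y : Fin (k + 1), A y.val (v y) (v (y + 1))
  rw [Fin.prod_univ_castSucc]
  simp only [Fin.val_castSucc, Fin.val_last, Fin.last_add_one, Fin.coeSucc_eq_succ]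

end RangeProd

section Rows

variable {L N : ℕ}

/-- The weight of a row of parity `b`, as a matrix on the sets of particles: the product of the
weights of the vertical edges above the row, times the sum over its horizontal edges. -/
noncomputable def rowWeight (L : ℕ) [NeZero L] (b : ZMod 2) (H₁ H₂ : ℝ) (w : ℝ × ℝ) :
    Matrix (Finset (ZMod (2 * L))) (Finset (ZMod (2 * L))) ℝ :=
  Matrix.of fun T T' => (∏ x, if (x ∈ T' ↔ RowBlack L b x) then
      (if RowBlack L b x then w.2 * Real.exp H₁ else w.2 * Real.exp (-H₁)) else 1) *
    hopKernel (RowBlack L b) (hopWeight L b H₂ w.1) T T'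

/-- Vertical edges above a row in terms of particles, and conversely. -/
def particles (L : ℕ) [NeZero L] (b : ZMod 2) (S : Finset (ZMod (2 * L))) :
    Finset (ZMod (2 * L)) :=
  Finset.univ.filter fun x => (x ∈ S ↔ RowBlack L b x)

theorem mem_particles [NeZero L] (b : ZMod 2) (S : Finset (ZMod (2 * L))) (x : ZMod (2 * L)) :
    x ∈ particles L b S ↔ (x ∈ S ↔ RowBlack L b x) := by
  simp [particles]

theorem particles_particles [NeZero L] (b : ZMod 2) (S : Finset (ZMod (2 * L))) :
    particles L b (particles L b S) = S := by
  ext x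
  rw [mem_particles, mem_particles]
  tauto

theorem rowBlack_sub_one_row (b : ZMod 2) (x : ZMod (2 * L)) :
    RowBlack L (b - 1) x ↔ ¬ RowBlack L b x := by
  unfold RowBlack
  generalize par L x = p
  revert p b
  decide

open Classical in
/-- In terms of particles the rows decouple: the constraint and the weight of a row involve only the
particles below and above it. -/
theorem partitionFunction_eq_sum_rows [NeZero L] [NeZero N] (hL : 2 ≤ L) (hN : 2 ≤ N)
    (w₁ w₂ : ℤ → ℝ) (H₁ H₂ : ℝ) :
    partitionFunction L N w₁ w₂ H₁ H₂ =
      ∑ T : ZMod (2 * N) → Finset (ZMod (2 * L)), ∏ y : ZMod (2 * N),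
        rowWeight L (par N y) H₁ H₂ (w₁ y.valMinAbs, w₂ y.valMinAbs) (T (y - 1)) (T y) := by
  rw [partitionFunction_eq_sum_edges hL hN]
  let e : (ZMod (2 * N) → Finset (ZMod (2 * L))) ≃ (ZMod (2 * N) → Finset (ZMod (2 * L))) :=
    { toFun := fun T y => particles L (par N y) (T y)
      invFun := fun T y => particles L (par N y) (T y)
      left_inv := fun T => by funext y; exact particles_particles _ _
      right_inv := fun T => by funext y; exact particles_particles _ _ }
  rw [← Equiv.sum_comp e]
  refine Finset.sum_congr rfl fun T _ => ?_
  have hb : ∀ (x : ZMod (2 * L)) (y : ZMod (2 * N)),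
      IsBlack ((x, y) : Vertex L N) ↔ RowBlack L (par N y) x := fun x y => isBlack_iff _
  have hvalid : (Finset.univ.filter fun H : ZMod (2 * N) → Finset (ZMod (2 * L)) =>
      TorusValid (e T) H) = Fintype.piFinset fun y => Finset.univ.filter fun H =>
        HopValid (RowBlack L (par N y)) (T (y - 1)) (T y) H := by
    ext H
    simp only [Finset.mem_filter, Finset.mem_univ, true_and, Fintype.mem_piFinset]
    refine forall_congr' fun y => forall_congr' fun x => ?_
    have h1 : x ∈ e T y ↔ (x ∈ T y ↔ RowBlack L (par N y) x) := mem_particles _ _ _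
    have h2 : x ∈ e T (y - 1) ↔ (x ∈ T (y - 1) ↔ ¬ RowBlack L (par N y) x) := by
      refine (mem_particles _ _ _).trans ?_
      rw [map_sub, map_one, rowBlack_sub_one_row]
    simp only [h1, h2]
  rw [hvalid, ← Finset.prod_univ_sum (t := fun y => Finset.univ.filter fun H =>
        HopValid (RowBlack L (par N y)) (T (y - 1)) (T y) H)
      (f := fun y H => (∏ x, if x ∈ e T y then verticalWeight w₂ H₁ ((x, y) : Vertex L N) else 1) *
          ∏ x, if x ∈ H then horizontalWeight w₁ H₂ ((x, y) : Vertex L N) else 1)]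
  refine Finset.prod_congr rfl fun y _ => ?_
  rw [← Finset.mul_sum, rowWeight, Matrix.of_apply, hopKernel]
  congr 1
  · refine Finset.prod_congr rfl fun x _ => ?_
    have h1 : x ∈ e T y ↔ (x ∈ T y ↔ RowBlack L (par N y) x) := mem_particles _ _ _
    simp only [h1, verticalWeight, hb, row]
  · refine Finset.sum_congr rfl fun H _ => ?_
    rw [Finset.prod_ite_mem, Finset.univ_inter]
    refine Finset.prod_congr rfl fun x _ => ?_
    simp only [horizontalWeight, hopWeight, hb, row]

/-- The row weights of an environment `w`, the rows being indexed by `ℤ`. -/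
noncomputable def envRow (L : ℕ) [NeZero L] (H₁ H₂ : ℝ) (w : ℤ → ℝ × ℝ) (y : ℤ) :
    Matrix (Finset (ZMod (2 * L))) (Finset (ZMod (2 * L))) ℝ :=
  rowWeight L (y : ZMod 2) H₁ H₂ (w y)

/-- The row with label `y` has parity `y`, and the labels run from `-N + 1` to `N`. -/
theorem partitionFunction_eq_trace [NeZero L] [NeZero N] (hL : 2 ≤ L) (hN : 2 ≤ N)
    (w₁ w₂ : ℤ → ℝ) (H₁ H₂ : ℝ) :
    partitionFunction L N w₁ w₂ H₁ H₂ =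
      (rangeProd (fun i : ℕ => envRow L H₁ H₂ (fun y => (w₁ y, w₂ y)) (-(N : ℤ) + 1 + i))
        (2 * N)).trace := by
  rw [partitionFunction_eq_sum_rows hL hN, trace_rangeProd]
  let c : ZMod (2 * N) := ((-(N : ℤ) + 1 : ℤ) : ZMod (2 * N))
  let e : (ZMod (2 * N) → Finset (ZMod (2 * L))) ≃ (ZMod (2 * N) → Finset (ZMod (2 * L))) :=
    Equiv.arrowCongr (Equiv.addRight (c - 1)) (Equiv.refl _)
  rw [← Equiv.sum_comp e]
  refine Finset.sum_congr rfl fun T _ => ?_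
  rw [← Equiv.prod_comp (Equiv.addRight c)]
  refine Finset.prod_congr rfl fun y _ => ?_
  have hv := ZMod.val_lt y
  have hN0 := NeZero.pos N
  have hy : ((-(N : ℤ) + 1 + (y.val : ℤ) : ℤ) : ZMod (2 * N)) = y + c := by
    push_cast
    rw [ZMod.natCast_zmod_val]
    simp only [c]
    push_cast
    ring
  have hrow : (y + c).valMinAbs = -(N : ℤ) + 1 + (y.val : ℤ) := by
    rw [ZMod.valMinAbs_spec]
    refine ⟨hy.symm, ?_⟩
    rw [Set.mem_Ioc]
    push_cast
    constructor <;> omega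
  have hpar : par N (y + c) = ((-(N : ℤ) + 1 + (y.val : ℤ) : ℤ) : ZMod 2) := by
    rw [← hy]; exact map_intCast (par N) _
  have e1 : e T (y + c - 1) = T y := by
    simp only [e, Equiv.arrowCongr_apply, Equiv.coe_refl, Function.comp, id,
      Equiv.addRight_symm, Equiv.coe_addRight]
    congr 1; ring
  have e2 : e T (y + c) = T (y + 1) := by
    simp only [e, Equiv.arrowCongr_apply, Equiv.coe_refl, Function.comp, id,
      Equiv.addRight_symm, Equiv.coe_addRight]
    congr 1; ring
  rw [Equiv.coe_addRight, e1, e2, envRow, hrow, hpar]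

end Rows

/-! ### Sectors of fixed particle number -/

section Sectors

variable {X : Type*}

/-- The block of a matrix on finite sets that corresponds to the sets of cardinality `n`. -/
def sector (n : ℕ) (A : Matrix (Finset X) (Finset X) ℝ) :
    Matrix (Set.powersetCard X n) (Set.powersetCard X n) ℝ :=
  A.submatrix Subtype.val Subtype.val

/-- The number of particles is conserved. -/
def CardPreserving (A : Matrix (Finset X) (Finset X) ℝ) : Prop :=
  ∀ T T', A T T' ≠ 0 → T.card = T'.card

theorem sector_one [DecidableEq X] (n : ℕ) : sector n (1 : Matrix (Finset X) (Finset X) ℝ) = 1 := by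
  ext s t
  simp [sector, Matrix.one_apply, Subtype.ext_iff]

variable [Fintype X]

theorem sector_mul (n : ℕ) {A B : Matrix (Finset X) (Finset X) ℝ} (hA : CardPreserving A) :
    sector n (A * B) = sector n A * sector n B := by
  ext s t
  simp only [sector, Matrix.submatrix_apply, Matrix.mul_apply]
  symm
  refine (Finset.sum_subtype (Finset.univ.filter fun T : Finset X => T.card = n)
    (p := fun T => T ∈ Set.powersetCard X n) (fun T => by simp [Set.powersetCard])
    (fun T => A s.1 T * B T t.1)).symm.trans ?_
  rw [Finset.sum_filter]
  refine Finset.sum_congr rfl fun T _ => ?_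
  split_ifs with h
  · rfl
  · have : A s.1 T = 0 := by
      by_contra h0
      exact h ((hA _ _ h0).symm.trans s.2)
    rw [this, zero_mul]

theorem trace_eq_sum_sector (A : Matrix (Finset X) (Finset X) ℝ) :
    A.trace = ∑ n ∈ Finset.range (Fintype.card X + 1), (sector n A).trace := by
  simp only [Matrix.trace, Matrix.diag_apply, sector, Matrix.submatrix_apply]
  rw [← Finset.sum_fiberwise_of_maps_to (s := Finset.univ)
    (t := Finset.range (Fintype.card X + 1)) (g := Finset.card) (fun T _ => by
      rw [Finset.mem_range]; exact Nat.lt_succ_of_le (Finset.card_le_univ T))]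
  refine Finset.sum_congr rfl fun n _ => ?_
  exact Finset.sum_subtype _ (p := fun T => T ∈ Set.powersetCard X n)
    (fun T => by simp [Set.powersetCard]) _

theorem sector_rangeProd [DecidableEq X] (n : ℕ) {A : ℕ → Matrix (Finset X) (Finset X) ℝ}
    (hA : ∀ i, CardPreserving (A i)) (m : ℕ) :
    sector n (rangeProd A m) = rangeProd (fun i => sector n (A i)) m := by
  -- the factors are split off from the left, where conservation is known
  induction m generalizing A with
  | zero => simp [sector_one]
  | succ m ih =>
    rw [add_comm m 1, rangeProd_add, rangeProd_add, rangeProd_succ, rangeProd_succ, rangeProd_zero,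
      rangeProd_zero, one_mul, one_mul, sector_mul n (hA 0), ih fun i => hA (1 + i)]

end Sectors

section RowSectors

theorem card_eq_of_hopValid {m : ℕ} [NeZero m] {blk : ZMod m → Prop} [DecidablePred blk]
    (hb : ∀ x, blk (x + 1) ↔ ¬ blk x) {T T' H : Finset (ZMod m)} (h : HopValid blk T T' H) :
    T.card = T'.card := by
  have key : ∀ x, (if x ∈ T then (1 : ℤ) else 0) - (if x ∈ T' then 1 else 0) =
      (if blk x then 1 else -1) * (if x ∈ H then 1 else 0) +
        (if blk x then 1 else -1) * (if x - 1 ∈ H then 1 else 0) := by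
    intro x
    have := h x
    by_cases h1 : blk x <;> by_cases h2 : x ∈ T <;> by_cases h3 : x ∈ T' <;>
      by_cases h4 : x ∈ H <;> by_cases h5 : x - 1 ∈ H <;> simp_all
  have hs := Finset.sum_congr (rfl : (Finset.univ : Finset (ZMod m)) = _) fun x _ => key x
  rw [Finset.sum_sub_distrib, Finset.sum_add_distrib] at hs
  have hshift : ∑ x : ZMod m, (if blk x then (1 : ℤ) else -1) * (if x - 1 ∈ H then 1 else 0) =
      ∑ x : ZMod m, (if blk (x + 1) then (1 : ℤ) else -1) * (if x ∈ H then 1 else 0) := by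
    rw [← Equiv.sum_comp (Equiv.addRight (1 : ZMod m))]
    simp only [Equiv.coe_addRight, add_sub_cancel_right]
    refine Finset.sum_congr rfl fun x _ => ?_
    congr
  have hzero : ∑ x : ZMod m, ((if blk x then (1 : ℤ) else -1) * (if x ∈ H then 1 else 0) +
      (if blk (x + 1) then (1 : ℤ) else -1) * (if x ∈ H then 1 else 0)) = 0 := by
    refine Finset.sum_eq_zero fun x _ => ?_
    simp only [hb x]
    by_cases h1 : blk x <;> by_cases h2 : x ∈ H <;> simp [h1, h2]
  rw [hshift, ← Finset.sum_add_distrib, hzero] at hs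
  simp only [Finset.sum_ite_mem, Finset.univ_inter, Finset.sum_const, nsmul_eq_mul, mul_one] at hs
  omega

variable {L : ℕ}

theorem hopWeight_nonneg {b : ZMod 2} {H₂ w : ℝ} (hw : 0 ≤ w) (x : ZMod (2 * L)) :
    0 ≤ hopWeight L b H₂ w x := by
  unfold hopWeight
  split_ifs <;> positivity

variable [NeZero L]

theorem rowWeight_nonneg {b : ZMod 2} {H₁ H₂ : ℝ} {w : ℝ × ℝ} (h1 : 0 ≤ w.1) (h2 : 0 ≤ w.2)
    (T T' : Finset (ZMod (2 * L))) : 0 ≤ rowWeight L b H₁ H₂ w T T' := by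
  rw [rowWeight, Matrix.of_apply]
  refine mul_nonneg (Finset.prod_nonneg fun x _ => ?_)
    (Finset.sum_nonneg fun H _ => Finset.prod_nonneg fun x _ => hopWeight_nonneg h1 x)
  split_ifs <;> positivity

theorem cardPreserving_rowWeight (b : ZMod 2) (H₁ H₂ : ℝ) (w : ℝ × ℝ) :
    CardPreserving (rowWeight L b H₁ H₂ w) := by
  intro T T' h
  rw [rowWeight, Matrix.of_apply] at h
  have h' := right_ne_zero_of_mul h
  obtain ⟨H, hH, -⟩ := Finset.exists_ne_zero_of_sum_ne_zero h'
  exact card_eq_of_hopValid (rowBlack_add_one L b) (by simpa using hH)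

/-- Half of the sites of a row are white. -/
theorem card_white (b : ZMod 2) :
    (Finset.univ.filter fun x : ZMod (2 * L) => ¬ RowBlack L b x).card = L := by
  have h := card_par_eq (L := L) (-b)
  rw [Finset.sum_ite, Finset.sum_const_zero, add_zero, Finset.sum_const, nsmul_eq_mul,
    mul_one] at h
  have h' : (Finset.univ.filter fun x : ZMod (2 * L) => par L x = -b).card = L := by
    exact_mod_cast h
  refine Eq.trans ?_ h'
  congr 1
  ext x
  rw [Finset.mem_filter, Finset.mem_filter]
  have : ∀ p b : ZMod 2, ¬ p + b = 1 ↔ p = -b := by decide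
  exact and_congr_right fun _ => this _ _

/-- The weights of the vertical edges, relative to the state where every white site is matched
upwards. -/
theorem prod_vertical (b : ZMod 2) (H₁ : ℝ) {w : ℝ} (hw : 0 < w) (T' : Finset (ZMod (2 * L))) :
    (∏ x, if (x ∈ T' ↔ RowBlack L b x) then
      (if RowBlack L b x then w * Real.exp H₁ else w * Real.exp (-H₁)) else 1) =
    (w * Real.exp (-H₁)) ^ L * ((w * Real.exp (-H₁))⁻¹ ^ T'.card *
      ∏ x ∈ T', if RowBlack L b x then w ^ 2 else 1) := by
  have hg : w * Real.exp (-H₁) ≠ 0 := by positivity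
  have h1 : (w * Real.exp (-H₁)) ^ L = ∏ x : ZMod (2 * L),
      if RowBlack L b x then 1 else w * Real.exp (-H₁) := by
    rw [Finset.prod_ite, Finset.prod_const_one, one_mul, Finset.prod_const, card_white]
  have h2 : (w * Real.exp (-H₁))⁻¹ ^ T'.card * ∏ x ∈ T', (if RowBlack L b x then w ^ 2 else 1) =
      ∏ x, if x ∈ T' then (w * Real.exp (-H₁))⁻¹ * (if RowBlack L b x then w ^ 2 else 1)
        else 1 := by
    rw [Finset.prod_ite_mem, Finset.univ_inter, Finset.prod_mul_distrib, Finset.prod_const]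
  have h3 : (w * Real.exp (-H₁))⁻¹ * w ^ 2 = w * Real.exp H₁ := by
    rw [Real.exp_neg]
    field_simp
  rw [h1, h2, ← Finset.prod_mul_distrib]
  refine Finset.prod_congr rfl fun x _ => ?_
  by_cases hb : RowBlack L b x <;> by_cases hx : x ∈ T' <;> simp [hb, hx]
  · rw [← h3, mul_inv, ← Real.exp_neg, neg_neg]
    ring
  · field_simp

variable (L) in
/-- The gauge that removes the phases from the minors of the one-particle matrices. -/
noncomputable def gauge (n : ℕ) (u : ℂ) :
    Matrix (Set.powersetCard (ZMod (2 * L)) n) (Set.powersetCard (ZMod (2 * L)) n) ℂ :=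
  Matrix.diagonal fun s => u ^ ∑ x ∈ s.1, x.val

theorem compound_rowMatrix_apply {n : ℕ} (b : ZMod 2) (H₂ : ℝ) (u : ℂ) (w : ℝ × ℝ) (g : ℂ)
    (s t : Set.powersetCard (ZMod (2 * L)) n) :
    compound n (g⁻¹ • rowMatrix L b H₂ u w) s t =
      g⁻¹ ^ n * (compound n (hopMatrix (RowBlack L b) (hopWeight L b H₂ w.1) u) s t *
        ∏ x ∈ t.1, if RowBlack L b x then (w.2 : ℂ) ^ 2 else 1) := by
  rw [compound_smul, rowMatrix, Matrix.smul_apply, compound_mul_diagonal_apply, smul_eq_mul]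

/-- The particles are free fermions: with the boundary phase adapted to the particle number, a row
restricted to `n` particles is gauge equivalent to a compound of its one-particle matrix. -/
theorem sector_rowWeight_mul_gauge (hL : 2 ≤ L) {n : ℕ} (b : ZMod 2) (H₁ H₂ : ℝ) {u : ℂ}
    (hu0 : u ≠ 0) (hu : u ^ (2 * L) = (-1) ^ (n + 1)) {w : ℝ × ℝ} (hw : 0 < w.2) :
    (sector n (rowWeight L b H₁ H₂ w)).map Complex.ofReal * gauge L n u =
      ((w.2 * Real.exp (-H₁) : ℝ) : ℂ) ^ L • (gauge L n u *
        compound n (((w.2 * Real.exp (-H₁) : ℝ) : ℂ)⁻¹ • rowMatrix L b H₂ u w)) := by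
  ext s t
  rw [gauge, Matrix.mul_diagonal, Matrix.smul_apply, Matrix.diagonal_mul,
    compound_rowMatrix_apply]
  have h := compound_hopMatrix (blk := RowBlack L b) (by omega) (rowBlack_add_one L b) s t
    (hopWeight L b H₂ w.1) hu0 hu
  have hc : t.1.card = n := t.2
  simp only [Matrix.map_apply, sector, Matrix.submatrix_apply, rowWeight, Matrix.of_apply,
    smul_eq_mul]
  rw [prod_vertical b H₁ hw, hc]
  have hp : ((∏ x ∈ t.1, (if RowBlack L b x then w.2 ^ 2 else 1 : ℝ) : ℝ) : ℂ) =
      ∏ x ∈ t.1, if RowBlack L b x then (w.2 : ℂ) ^ 2 else 1 := by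
    rw [Complex.ofReal_prod]
    refine Finset.prod_congr rfl fun x _ => ?_
    split_ifs <;> simp
  simp only [Complex.ofReal_mul, Complex.ofReal_pow, Complex.ofReal_inv]
  rw [hp]
  linear_combination -((w.2 : ℂ) * ((Real.exp (-H₁) : ℝ) : ℂ)) ^ L *
    ((w.2 : ℂ) * ((Real.exp (-H₁) : ℝ) : ℂ))⁻¹ ^ n *
    (∏ x ∈ t.1, if RowBlack L b x then (w.2 : ℂ) ^ 2 else 1) * h

/-- Without a condition on the boundary phase, the compounds are dominated by the row weights. -/
theorem norm_compound_rowMatrix_le (hL : 2 ≤ L) {n : ℕ} (b : ZMod 2) (H₁ H₂ : ℝ) {u : ℂ}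
    (hu : ‖u‖ = 1) {w : ℝ × ℝ} (hw1 : 0 ≤ w.1) (hw : 0 < w.2)
    (s t : Set.powersetCard (ZMod (2 * L)) n) :
    (w.2 * Real.exp (-H₁)) ^ L *
      ‖compound n (((w.2 * Real.exp (-H₁) : ℝ) : ℂ)⁻¹ • rowMatrix L b H₂ u w) s t‖ ≤
      sector n (rowWeight L b H₁ H₂ w) s t := by
  have h := norm_compound_hopMatrix_le (blk := RowBlack L b) (by omega) (rowBlack_add_one L b) s t
    (hopWeight L b H₂ w.1) (fun x => hopWeight_nonneg hw1 x) hu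
  have hc : t.1.card = n := t.2
  have hg : 0 < w.2 * Real.exp (-H₁) := by positivity
  have hp : ‖∏ x ∈ t.1, if RowBlack L b x then (w.2 : ℂ) ^ 2 else 1‖ =
      ∏ x ∈ t.1, if RowBlack L b x then w.2 ^ 2 else 1 := by
    rw [norm_prod]
    refine Finset.prod_congr rfl fun x _ => ?_
    split_ifs <;> simp
  have hp0 : 0 ≤ ∏ x ∈ t.1, if RowBlack L b x then w.2 ^ 2 else 1 := by
    rw [← hp]; exact norm_nonneg _
  simp only [sector, Matrix.submatrix_apply, rowWeight, Matrix.of_apply]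
  rw [compound_rowMatrix_apply, norm_mul, norm_mul, norm_pow, norm_inv, Complex.norm_real,
    Real.norm_of_nonneg hg.le, prod_vertical b H₁ hw, hc, hp]
  have : 0 ≤ (w.2 * Real.exp (-H₁)) ^ L * (w.2 * Real.exp (-H₁))⁻¹ ^ n *
    ∏ x ∈ t.1, (if RowBlack L b x then w.2 ^ 2 else 1) := by positivity
  have := mul_le_mul_of_nonneg_left h this
  calc _ = _ := by ring
    _ ≤ _ := this
    _ = _ := by ring

/-- The product of the normalizations of the rows. -/
noncomputable def gProd (H₁ : ℝ) (w : ℕ → ℝ × ℝ) (m : ℕ) : ℝ :=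
  rangeProd (fun i => (w i).2 * Real.exp (-H₁)) m

theorem gProd_pos (H₁ : ℝ) {w : ℕ → ℝ × ℝ} (hw : ∀ i, 0 < (w i).2) (m : ℕ) : 0 < gProd H₁ w m := by
  induction m with
  | zero => simp [gProd]
  | succ m ih =>
    rw [gProd, rangeProd_succ]
    exact mul_pos ih (mul_pos (hw m) (Real.exp_pos _))

theorem sector_rangeProd_mul_gauge (hL : 2 ≤ L) {n : ℕ} (b : ℕ → ZMod 2) (H₁ H₂ : ℝ) {u : ℂ}
    (hu0 : u ≠ 0) (hu : u ^ (2 * L) = (-1) ^ (n + 1)) {w : ℕ → ℝ × ℝ} (hw : ∀ i, 0 < (w i).2)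
    (m : ℕ) :
    (sector n (rangeProd (fun i => rowWeight L (b i) H₁ H₂ (w i)) m)).map Complex.ofReal *
      gauge L n u = (gProd H₁ w m : ℂ) ^ L • (gauge L n u * compound n ((gProd H₁ w m : ℂ)⁻¹ •
        rangeProd (fun i => rowMatrix L (b i) H₂ u (w i)) m)) := by
  rw [sector_rangeProd n fun i => cardPreserving_rowWeight _ _ _ _]
  induction m with
  | zero =>
    have h1 : (1 : Matrix (Set.powersetCard (ZMod (2 * L)) n) (Set.powersetCard (ZMod (2 * L)) n)
        ℝ).map Complex.ofReal = 1 := Matrix.map_one _ Complex.ofReal_zero Complex.ofReal_one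
    simp [gProd, compound_one, h1]
  | succ m ih =>
    have hmap : ∀ A B : Matrix (Set.powersetCard (ZMod (2 * L)) n)
        (Set.powersetCard (ZMod (2 * L)) n) ℝ,
        (A * B).map Complex.ofReal = A.map Complex.ofReal * B.map Complex.ofReal :=
      fun A B => Matrix.map_mul (f := Complex.ofRealHom)
    have hg : gProd H₁ w (m + 1) = gProd H₁ w m * ((w m).2 * Real.exp (-H₁)) := rangeProd_succ _ _
    rw [rangeProd_succ, rangeProd_succ, hmap, Matrix.mul_assoc,
      sector_rowWeight_mul_gauge hL (b m) H₁ H₂ hu0 hu (hw m), Matrix.mul_smul, ← Matrix.mul_assoc,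
      ih, Matrix.smul_mul, smul_smul, Matrix.mul_assoc, ← compound_mul, Matrix.smul_mul,
      Matrix.mul_smul, smul_smul, hg, Complex.ofReal_mul (gProd H₁ w m), mul_inv, mul_pow,
      mul_comm ((gProd H₁ w m : ℂ) ^ L)]

/-- The trace over `n` particles is a trace of a compound; the gauge drops out. -/
theorem trace_sector_eq (hL : 2 ≤ L) {n : ℕ} (b : ℕ → ZMod 2) (H₁ H₂ : ℝ) {u : ℂ}
    (hu0 : u ≠ 0) (hu : u ^ (2 * L) = (-1) ^ (n + 1)) {w : ℕ → ℝ × ℝ} (hw : ∀ i, 0 < (w i).2)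
    (m : ℕ) :
    (((sector n (rangeProd (fun i => rowWeight L (b i) H₁ H₂ (w i)) m)).trace : ℝ) : ℂ) =
      (gProd H₁ w m : ℂ) ^ L * (compound n ((gProd H₁ w m : ℂ)⁻¹ •
        rangeProd (fun i => rowMatrix L (b i) H₂ u (w i)) m)).trace := by
  have h := sector_rangeProd_mul_gauge hL b H₁ H₂ hu0 hu hw m
  simp only [Matrix.trace, Matrix.diag_apply, Complex.ofReal_sum, Finset.mul_sum]
  refine Finset.sum_congr rfl fun s _ => ?_
  have hs := congrFun (congrFun h s) s
  rw [gauge, Matrix.mul_diagonal, Matrix.smul_apply, Matrix.diagonal_mul, Matrix.map_apply,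
    smul_eq_mul] at hs
  have h0 : u ^ (∑ x ∈ s.1, x.val) ≠ 0 := pow_ne_zero _ hu0
  apply mul_right_cancel₀ h0
  rw [hs]
  ring

/-- By Cauchy–Binet, the domination of compounds by row weights passes to products of rows. -/
theorem norm_compound_rangeProd_le (hL : 2 ≤ L) {n : ℕ} (b : ℕ → ZMod 2) (H₁ H₂ : ℝ) {u : ℂ}
    (hu : ‖u‖ = 1) {w : ℕ → ℝ × ℝ} (hw1 : ∀ i, 0 ≤ (w i).1) (hw : ∀ i, 0 < (w i).2)
    (m : ℕ) (s t : Set.powersetCard (ZMod (2 * L)) n) :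
    gProd H₁ w m ^ L * ‖compound n ((gProd H₁ w m : ℂ)⁻¹ •
        rangeProd (fun i => rowMatrix L (b i) H₂ u (w i)) m) s t‖ ≤
      sector n (rangeProd (fun i => rowWeight L (b i) H₁ H₂ (w i)) m) s t := by
  rw [sector_rangeProd n fun i => cardPreserving_rowWeight _ _ _ _]
  induction m generalizing t with
  | zero =>
    simp only [gProd, rangeProd_zero, Complex.ofReal_one, inv_one, one_smul, compound_one, one_pow,
      one_mul, Matrix.one_apply]
    split_ifs <;> simp
  | succ m ih =>
    have hg : gProd H₁ w (m + 1) = gProd H₁ w m * ((w m).2 * Real.exp (-H₁)) := rangeProd_succ _ _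
    have hg0 := gProd_pos H₁ hw m
    have hg1 : 0 < (w m).2 * Real.exp (-H₁) := mul_pos (hw m) (Real.exp_pos _)
    have e : ((gProd H₁ w (m + 1) : ℝ) : ℂ)⁻¹ •
        rangeProd (fun i => rowMatrix L (b i) H₂ u (w i)) (m + 1) =
        ((gProd H₁ w m : ℂ)⁻¹ • rangeProd (fun i => rowMatrix L (b i) H₂ u (w i)) m) *
          ((((w m).2 * Real.exp (-H₁) : ℝ) : ℂ)⁻¹ • rowMatrix L (b m) H₂ u (w m)) := by
      rw [rangeProd_succ, hg, Complex.ofReal_mul (gProd H₁ w m), mul_inv, Matrix.smul_mul,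
        Matrix.mul_smul, smul_smul]
    rw [e, compound_mul, rangeProd_succ, Matrix.mul_apply, Matrix.mul_apply, hg]
    refine (mul_le_mul_of_nonneg_left (norm_sum_le _ _) (by positivity)).trans ?_
    rw [Finset.mul_sum]
    refine Finset.sum_le_sum fun r _ => ?_
    rw [norm_mul, mul_pow]
    have h1 := ih r
    have h2 := norm_compound_rowMatrix_le hL (b m) H₁ H₂ hu (hw1 m) (hw m) r t
    have := mul_le_mul h1 h2 (by positivity) ((by positivity : (0 : ℝ) ≤ _).trans h1)
    calc _ = _ := by ring
      _ ≤ _ := this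

end RowSectors

/-! ### Determinants of order two -/

section TwoByTwo

attribute [local instance] Matrix.linftyOpNormedAddCommGroup

theorem norm_entry_le (A : Matrix (Fin 2) (Fin 2) ℂ) (i j : Fin 2) : ‖A i j‖ ≤ ‖A‖ := by
  rw [Matrix.linfty_opNorm_def, ← coe_nnnorm, NNReal.coe_le_coe]
  exact (Finset.single_le_sum (f := fun j => ‖A i j‖₊) (fun _ _ => bot_le)
    (Finset.mem_univ j)).trans (Finset.le_sup (f := fun i => ∑ j, ‖A i j‖₊) (Finset.mem_univ i))

theorem norm_le_of_entries {A : Matrix (Fin 2) (Fin 2) ℂ} {c : ℝ}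
    (h : ∀ i, ‖A i 0‖ + ‖A i 1‖ ≤ c) : ‖A‖ ≤ c := by
  have hc : 0 ≤ c := le_trans (by positivity) (h 0)
  rw [Matrix.linfty_opNorm_def]
  lift c to NNReal using hc
  rw [NNReal.coe_le_coe]
  refine Finset.sup_le fun i _ => ?_
  rw [Fin.sum_univ_two]
  exact_mod_cast h i

/-- Comparison of the operator norm for the sup norm with the Hilbert–Schmidt norm. -/
theorem norm_sq_le (A : Matrix (Fin 2) (Fin 2) ℂ) :
    ‖A‖ ^ 2 ≤ 2 * (‖A 0 0‖ ^ 2 + ‖A 0 1‖ ^ 2 + ‖A 1 0‖ ^ 2 + ‖A 1 1‖ ^ 2) := by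
  have h : ‖A‖ ≤ Real.sqrt (2 * (‖A 0 0‖ ^ 2 + ‖A 0 1‖ ^ 2 + ‖A 1 0‖ ^ 2 + ‖A 1 1‖ ^ 2)) := by
    refine norm_le_of_entries fun i => Real.le_sqrt_of_sq_le ?_
    fin_cases i
    · simp only [Fin.zero_eta]
      nlinarith [sq_nonneg (‖A 0 0‖ - ‖A 0 1‖), sq_nonneg ‖A 1 0‖, sq_nonneg ‖A 1 1‖]
    · simp only [Fin.mk_one]
      nlinarith [sq_nonneg (‖A 1 0‖ - ‖A 1 1‖), sq_nonneg ‖A 0 0‖, sq_nonneg ‖A 0 1‖]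
  calc ‖A‖ ^ 2 ≤ _ := pow_le_pow_left₀ (norm_nonneg _) h 2
    _ = _ := Real.sq_sqrt (by positivity)

theorem norm_det_le (A : Matrix (Fin 2) (Fin 2) ℂ) : ‖A.det‖ ≤ 2 * ‖A‖ ^ 2 := by
  rw [Matrix.det_fin_two]
  have h := norm_nonneg A
  calc _ ≤ ‖A 0 0 * A 1 1‖ + ‖A 0 1 * A 1 0‖ := norm_sub_le _ _
    _ ≤ ‖A‖ * ‖A‖ + ‖A‖ * ‖A‖ := by
      rw [norm_mul, norm_mul]
      gcongr <;> exact norm_entry_le A _ _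
    _ = _ := by ring

theorem norm_det_one_add_smul_le {G : ℝ} (hG : 0 < G) (B : Matrix (Fin 2) (Fin 2) ℂ) {c : ℂ}
    (hc : ‖c‖ = 1) :
    G * ‖(1 + (c * (G : ℂ)⁻¹) • B).det‖ ≤ G + 2 * ‖B‖ + ‖B.det‖ / G := by
  have hG' : (G : ℂ) ≠ 0 := by exact_mod_cast hG.ne'
  have e : (1 + (c * (G : ℂ)⁻¹) • B).det =
      1 + c * (G : ℂ)⁻¹ * (B 0 0 + B 1 1) + c ^ 2 * (G : ℂ)⁻¹ ^ 2 * B.det := by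
    simp only [Matrix.det_fin_two, Matrix.add_apply, Matrix.smul_apply, Matrix.one_apply,
      smul_eq_mul]
    simp
    ring
  rw [e]
  have h1 : ‖1 + c * (G : ℂ)⁻¹ * (B 0 0 + B 1 1) + c ^ 2 * (G : ℂ)⁻¹ ^ 2 * B.det‖ ≤
      1 + G⁻¹ * (2 * ‖B‖) + G⁻¹ ^ 2 * ‖B.det‖ := by
    refine (norm_add₃_le).trans ?_
    simp only [norm_mul, norm_pow, norm_inv, hc, Complex.norm_real, Real.norm_of_nonneg hG.le,
      norm_one, one_pow, one_mul]
    gcongr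
    exact (norm_add_le _ _).trans (by linarith [norm_entry_le B 0 0, norm_entry_le B 1 1])
  calc _ ≤ G * (1 + G⁻¹ * (2 * ‖B‖) + G⁻¹ ^ 2 * ‖B.det‖) := by gcongr
    _ = _ := by field_simp

/-- A matrix `C` of bounded size for which all coefficients of `det (1 + s B C)` as a polynomial in
`s` are non-negative and of the largest possible order of magnitude. -/
noncomputable def aligned (B : Matrix (Fin 2) (Fin 2) ℂ) : Matrix (Fin 2) (Fin 2) ℂ :=
  ((‖B‖ : ℂ)⁻¹) • (B.conjTranspose + ((‖B.det‖ : ℂ) * B.det⁻¹) • B.adjugate)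

theorem norm_aligned_apply_le (B : Matrix (Fin 2) (Fin 2) ℂ) (i j : Fin 2) :
    ‖aligned B i j‖ ≤ 2 := by
  have h1 : ‖B.adjugate i j‖ ≤ ‖B‖ := by
    rw [Matrix.adjugate_fin_two]
    fin_cases i <;> fin_cases j <;> simp [norm_entry_le]
  have h2 : ‖(‖B.det‖ : ℂ) * B.det⁻¹‖ ≤ 1 := by
    rw [norm_mul, norm_inv, Complex.norm_real, norm_norm]
    exact mul_inv_le_one
  have h3 : ‖B.conjTranspose i j‖ ≤ ‖B‖ := by
    rw [Matrix.conjTranspose_apply, norm_star]; exact norm_entry_le _ _ _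
  rw [aligned, Matrix.smul_apply, Matrix.add_apply, Matrix.smul_apply, norm_smul, norm_inv,
    Complex.norm_real, norm_norm]
  have h4 : ‖B.conjTranspose i j + ((‖B.det‖ : ℂ) * B.det⁻¹) • B.adjugate i j‖ ≤ 2 * ‖B‖ := by
    refine (norm_add_le _ _).trans ?_
    rw [norm_smul]
    have := mul_le_mul h2 h1 (norm_nonneg _) zero_le_one
    linarith
  rcases eq_or_ne ‖B‖ 0 with h0 | h0
  · rw [h0]; simp
  · calc _ ≤ ‖B‖⁻¹ * (2 * ‖B‖) := by gcongr
      _ = 2 := by field_simp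

/-- The lower bound matching `norm_det_one_add_smul_le`, at the price of a bounded factor: the
choice of `aligned B` excludes cancellations between the three terms of the determinant. -/
theorem le_norm_det_one_add_aligned {G : ℝ} (hG : 0 < G) {B : Matrix (Fin 2) (Fin 2) ℂ}
    (hB : B.det ≠ 0) :
    (G + ‖B‖ + ‖B.det‖ / G) / 2 ≤ G * ‖(1 + (G : ℂ)⁻¹ • (B * aligned B)).det‖ := by
  have hn : 0 < ‖B‖ := by
    rw [norm_pos_iff]
    rintro rfl
    simp at hB
  set f : ℝ := ‖B 0 0‖ ^ 2 + ‖B 0 1‖ ^ 2 + ‖B 1 0‖ ^ 2 + ‖B 1 1‖ ^ 2 with hf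
  set d : ℝ := ‖B.det‖ with hd
  have hd0 : 0 < d := norm_pos_iff.2 hB
  set s : ℝ := (G * ‖B‖)⁻¹ with hs
  have hs0 : 0 < s := by positivity
  have hfB : ‖B‖ ^ 2 ≤ 2 * f := norm_sq_le B
  have e1 : (G : ℂ)⁻¹ • (B * aligned B) =
      (s : ℂ) • (B * B.conjTranspose + (d : ℂ) • (1 : Matrix (Fin 2) (Fin 2) ℂ)) := by
    rw [aligned, Matrix.mul_smul, smul_smul, Matrix.mul_add, Matrix.mul_smul, Matrix.mul_adjugate,
      smul_smul, mul_assoc, inv_mul_cancel₀ hB, mul_one, hs, Complex.ofReal_inv,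
      Complex.ofReal_mul, mul_inv]
  have e2 : (1 + (G : ℂ)⁻¹ • (B * aligned B)).det =
      (((1 + s * d) ^ 2 + (1 + s * d) * s * f + s ^ 2 * d ^ 2 : ℝ) : ℂ) := by
    have hdd : ((d ^ 2 : ℝ) : ℂ) = B.det * (starRingEnd ℂ) B.det := by
      rw [Complex.mul_conj, Complex.normSq_eq_norm_sq]
    have hff : (f : ℂ) = B 0 0 * (starRingEnd ℂ) (B 0 0) + B 0 1 * (starRingEnd ℂ) (B 0 1) +
        B 1 0 * (starRingEnd ℂ) (B 1 0) + B 1 1 * (starRingEnd ℂ) (B 1 1) := by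
      simp only [Complex.mul_conj, Complex.normSq_eq_norm_sq, hf]
      push_cast
      ring
    rw [e1]
    simp only [Complex.ofReal_add, Complex.ofReal_mul, Complex.ofReal_pow,
      Complex.ofReal_one] at hdd ⊢
    rw [hdd, hff]
    simp only [Matrix.det_fin_two, Matrix.add_apply, Matrix.smul_apply, Matrix.one_apply,
      smul_eq_mul, Matrix.mul_apply, Fin.sum_univ_two, Matrix.conjTranspose_apply, map_sub, map_mul,
      Complex.star_def]
    simp
    ring
  rw [e2, Complex.norm_real, Real.norm_of_nonneg (by positivity)]
  have e3 : s * ‖B‖ = G⁻¹ := by rw [hs]; field_simp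
  have h1 : G * (s * f) ≥ ‖B‖ / 2 := by
    have : G * s = ‖B‖⁻¹ := by rw [hs]; field_simp
    rw [← mul_assoc, this, inv_mul_eq_div, ge_iff_le, div_le_div_iff₀ (by norm_num) hn]
    nlinarith
  have h2 : G * (s * d * (s * f)) ≥ d / G / 2 := by
    have h3 : G * (s * d * (s * f)) = s * d * (G * (s * f)) := by ring
    rw [h3]
    calc d / G / 2 = s * d * (‖B‖ / 2) := by
          have : s * d * (‖B‖ / 2) = (s * ‖B‖) * d / 2 := by ring
          rw [this, e3]; ring
      _ ≤ _ := by gcongr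
  have h4 : 0 ≤ G * (2 * (s * d) + 2 * (s * d) ^ 2) := by positivity
  nlinarith

end TwoByTwo

/-! ### Factorization over the momenta -/

section Determinants

attribute [local instance] Matrix.linftyOpNormedAddCommGroup

/-- The product of the transfer matrices of `m` consecutive rows. -/
noncomputable def blockProd (θ H₂ : ℝ) (w : ℕ → ℝ × ℝ) (m : ℕ) : Matrix (Fin 2) (Fin 2) ℂ :=
  rangeProd (fun i => transferMatrix θ H₂ (w i).1 (w i).2) m

theorem gProd_succ (H₁ : ℝ) (w : ℕ → ℝ × ℝ) (m : ℕ) :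
    gProd H₁ w (m + 1) = gProd H₁ w m * ((w m).2 * Real.exp (-H₁)) := rangeProd_succ _ _

theorem norm_det_transferMatrix (θ H₂ w₁ w₂ : ℝ) : ‖(transferMatrix θ H₂ w₁ w₂).det‖ = w₂ ^ 2 := by
  rw [transferMatrix, Matrix.det_fin_two_of]
  simp

/-- The modulus of the determinant does not depend on the angle: it is the product of the
normalizations with the fields `H₁` and `-H₁`. -/
theorem norm_det_blockProd (θ H₁ H₂ : ℝ) (w : ℕ → ℝ × ℝ) (m : ℕ) :
    ‖(blockProd θ H₂ w m).det‖ = gProd H₁ w m * gProd (-H₁) w m := by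
  induction m with
  | zero => simp [blockProd, gProd]
  | succ m ih =>
    have h : blockProd θ H₂ w (m + 1) = blockProd θ H₂ w m * transferMatrix θ H₂ (w m).1 (w m).2 :=
      rangeProd_succ _ _
    rw [h, Matrix.det_mul, norm_mul, ih, norm_det_transferMatrix, gProd_succ, gProd_succ]
    have : Real.exp (-H₁) * Real.exp (- -H₁) = 1 := by rw [← Real.exp_add]; simp
    linear_combination -(gProd H₁ w m * gProd (-H₁) w m * (w m).2 ^ 2) * this

theorem det_blockProd_ne_zero (θ H₂ : ℝ) {w : ℕ → ℝ × ℝ} (hw : ∀ i, 0 < (w i).2) (m : ℕ) :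
    (blockProd θ H₂ w m).det ≠ 0 := by
  rw [← norm_ne_zero_iff, norm_det_blockProd θ 0]
  exact (mul_pos (gProd_pos _ hw m) (gProd_pos _ hw m)).ne'

/-- The order of magnitude of the contribution to the partition function of the two particle states
of a given momentum: the three terms stand for the occupation numbers `0`, `1` and `2`. -/
noncomputable def modeSize (θ H₁ H₂ : ℝ) (w : ℕ → ℝ × ℝ) (m : ℕ) : ℝ :=
  gProd H₁ w m + ‖blockProd θ H₂ w m‖ + gProd (-H₁) w m

theorem modeSize_pos (θ H₁ H₂ : ℝ) {w : ℕ → ℝ × ℝ} (hw : ∀ i, 0 < (w i).2) (m : ℕ) :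
    0 < modeSize θ H₁ H₂ w m := by
  have h1 := gProd_pos H₁ hw m
  have h2 := gProd_pos (-H₁) hw m
  unfold modeSize
  positivity

theorem det_div_gProd (θ H₁ H₂ : ℝ) {w : ℕ → ℝ × ℝ} (hw : ∀ i, 0 < (w i).2) (m : ℕ) :
    ‖(blockProd θ H₂ w m).det‖ / gProd H₁ w m = gProd (-H₁) w m := by
  rw [norm_det_blockProd θ H₁, mul_div_cancel_left₀ _ (gProd_pos H₁ hw m).ne']

variable {L : ℕ} [NeZero L]

/-- A product of rows is block diagonal in the basis of plane waves. -/
theorem rangeProd_rowMatrix_mul_planeWaves (hL : Even L) (H₂ κ : ℝ) (w : ℕ → ℝ × ℝ) (m : ℕ) :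
    rangeProd (fun i : ℕ => rowMatrix L (i : ZMod 2) H₂ (Complex.exp (Complex.I * κ)) (w i)) m *
      planeWaves L (m : ZMod 2) =
    planeWaves L 0 * Matrix.blockDiagonal fun j : Fin L =>
      blockProd (Real.pi * (j : ℕ) / L + κ) H₂ w m := by
  induction m with
  | zero =>
    have : (fun j : Fin L => blockProd (Real.pi * (j : ℕ) / L + κ) H₂ w 0) =
      (1 : Fin L → Matrix (Fin 2) (Fin 2) ℂ) := rfl
    rw [this, Matrix.blockDiagonal_one]
    simp
  | succ m ih =>
    rw [rangeProd_succ, Matrix.mul_assoc, Nat.cast_succ, rowMatrix_mul_planeWaves hL,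
      ← Matrix.mul_assoc, ih, Matrix.mul_assoc, ← Matrix.blockDiagonal_mul]
    congr 2
    funext j
    exact (rangeProd_succ _ _).symm

/-- Determinants factor over the momenta, also after multiplication by a matrix that preserves the
momentum. An even number of rows is needed to return to the same plane waves. -/
theorem det_one_add_smul_rangeProd (hL : Even L) (H₂ κ : ℝ) (w : ℕ → ℝ × ℝ) {m : ℕ} (hm : Even m)
    (z : ℂ) (Y : Fin L → Matrix (Fin 2) (Fin 2) ℂ) :
    (1 + (z • rangeProd (fun i : ℕ => rowMatrix L (i : ZMod 2) H₂
        (Complex.exp (Complex.I * κ)) (w i)) m) *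
      (planeWaves L 0 * Matrix.blockDiagonal Y * planeWavesInv L 0)).det =
    ∏ j : Fin L, (1 + z • (blockProd (Real.pi * (j : ℕ) / L + κ) H₂ w m * Y j)).det := by
  have h := rangeProd_rowMatrix_mul_planeWaves (L := L) hL H₂ κ w m
  rw [hm.natCast_zmod_two] at h
  have h1 := planeWaves_mul_inv (L := L) hL 0
  have h2 := planeWavesInv_mul (L := L) hL 0
  have e : 1 + (z • rangeProd (fun i : ℕ => rowMatrix L (i : ZMod 2) H₂
        (Complex.exp (Complex.I * κ)) (w i)) m) *
      (planeWaves L 0 * Matrix.blockDiagonal Y * planeWavesInv L 0) =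
      planeWaves L 0 * (Matrix.blockDiagonal fun j : Fin L =>
        (1 + z • (blockProd (Real.pi * (j : ℕ) / L + κ) H₂ w m * Y j))) * planeWavesInv L 0 := by
    have e1 : (Matrix.blockDiagonal fun j : Fin L =>
        (1 + z • (blockProd (Real.pi * (j : ℕ) / L + κ) H₂ w m * Y j))) =
        1 + z • ((Matrix.blockDiagonal fun j : Fin L =>
          blockProd (Real.pi * (j : ℕ) / L + κ) H₂ w m) * Matrix.blockDiagonal Y) := by
      rw [← Matrix.blockDiagonal_mul, ← Matrix.blockDiagonal_smul, ← Matrix.blockDiagonal_one,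
        ← Matrix.blockDiagonal_add]
      rfl
    rw [e1, Matrix.mul_add, Matrix.mul_one, Matrix.add_mul, h1, Matrix.smul_mul, Matrix.mul_smul,
      Matrix.smul_mul, ← Matrix.mul_assoc, ← Matrix.mul_assoc, h, Matrix.mul_assoc (planeWaves L 0)]
  rw [e, Matrix.det_conj_of_mul_eq_one h1 h2, Matrix.det_blockDiagonal]

/-- The determinant `det (1 + c A)`, `|c| = 1`, is at most of the order of the product of the sizes
of the modes. -/
theorem prod_norm_det_le (hL : Even L) (H₁ H₂ κ : ℝ) {w : ℕ → ℝ × ℝ} (hw : ∀ i, 0 < (w i).2)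
    {m : ℕ} (hm : Even m) {c : ℂ} (hc : ‖c‖ = 1) :
    gProd H₁ w m ^ L * ‖(1 + c • ((gProd H₁ w m : ℂ)⁻¹ • rangeProd (fun i : ℕ => rowMatrix L
        (i : ZMod 2) H₂ (Complex.exp (Complex.I * κ)) (w i)) m)).det‖ ≤
      2 ^ L * ∏ j : Fin L, modeSize (Real.pi * (j : ℕ) / L + κ) H₁ H₂ w m := by
  have hG := gProd_pos H₁ hw m
  have h := det_one_add_smul_rangeProd hL H₂ κ w hm (c * (gProd H₁ w m : ℂ)⁻¹) 1
  rw [Matrix.blockDiagonal_one, Matrix.mul_one, planeWaves_mul_inv hL, Matrix.mul_one] at h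
  -- `G ^ L` has one factor `G` for each of the `L` momenta
  rw [smul_smul, h, norm_prod]
  have hL' : ∀ a : ℝ, a ^ L = ∏ _j : Fin L, a := fun a => by simp
  rw [hL', hL', ← Finset.prod_mul_distrib, ← Finset.prod_mul_distrib]
  refine Finset.prod_le_prod (fun j _ => by positivity) fun j _ => ?_
  have h1 := norm_det_one_add_smul_le hG (blockProd (Real.pi * (j : ℕ) / L + κ) H₂ w m) hc
  rw [det_div_gProd _ _ _ hw] at h1
  have h2 := gProd_pos (-H₁) hw m
  rw [Pi.one_apply, Matrix.mul_one]
  refine h1.trans ?_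
  unfold modeSize
  linarith

/-- The sums over even and over odd particle numbers are half the sum and half the difference of
`det (1 + C)` and `det (1 - C)`. -/
theorem sum_trace_compound_le {X : Type*} [LinearOrder X] [Fintype X] (C : Matrix X X ℂ) (p : ℕ) :
    ‖∑ n ∈ (Finset.range (Fintype.card X + 1)).filter (fun n => n % 2 = p % 2),
      (compound n C).trace‖ ≤ (‖(1 + (1 : ℂ) • C).det‖ + ‖(1 + (-1 : ℂ) • C).det‖) / 2 := by
  have h : ∑ n ∈ (Finset.range (Fintype.card X + 1)).filter (fun n => n % 2 = p % 2),
      (compound n C).trace = ((1 + (1 : ℂ) • C).det + (-1) ^ p * (1 + (-1 : ℂ) • C).det) / 2 := by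
    rw [det_one_add_eq_sum_trace_compound, det_one_add_eq_sum_trace_compound, Finset.mul_sum,
      ← Finset.sum_add_distrib, Finset.sum_div, Finset.sum_filter]
    refine Finset.sum_congr rfl fun n _ => ?_
    rw [compound_smul, compound_smul, Matrix.trace_smul, Matrix.trace_smul, one_pow, one_smul,
      smul_eq_mul, ← mul_assoc, ← pow_add]
    split_ifs with h
    · rw [Even.neg_one_pow (Nat.even_iff.2 (by omega))]
      ring
    · rw [Odd.neg_one_pow (Nat.odd_iff.2 (by omega))]
      ring
  rw [h, norm_div, Complex.norm_ofNat]
  gcongr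
  refine (norm_add_le _ _).trans ?_
  rw [norm_mul, norm_pow, norm_neg, norm_one, one_pow, one_mul]

/-- The part of the partition function with particle numbers of the parity of `p`, for which one
boundary phase serves all sectors. -/
theorem sum_trace_sector_le (hL2 : 2 ≤ L) (hL : Even L) (H₁ H₂ κ : ℝ) {w : ℕ → ℝ × ℝ}
    (hw : ∀ i, 0 < (w i).2) {m : ℕ} (hm : Even m) (p : ℕ)
    (hu : Complex.exp (Complex.I * κ) ^ (2 * L) = (-1) ^ (p + 1)) :
    ∑ n ∈ (Finset.range (2 * L + 1)).filter (fun n => n % 2 = p % 2),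
      (sector n (rangeProd (fun i : ℕ => rowWeight L (i : ZMod 2) H₁ H₂ (w i)) m)).trace ≤
    2 ^ L * ∏ j : Fin L, modeSize (Real.pi * (j : ℕ) / L + κ) H₁ H₂ w m := by
  have hG := gProd_pos H₁ hw m
  set C := (gProd H₁ w m : ℂ)⁻¹ • rangeProd (fun i : ℕ => rowMatrix L
        (i : ZMod 2) H₂ (Complex.exp (Complex.I * κ)) (w i)) m with hC
  have h1 : ((∑ n ∈ (Finset.range (2 * L + 1)).filter (fun n => n % 2 = p % 2),
      (sector n (rangeProd (fun i : ℕ => rowWeight L (i : ZMod 2) H₁ H₂ (w i)) m)).trace : ℝ) : ℂ)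
      = (gProd H₁ w m : ℂ) ^ L *
        ∑ n ∈ (Finset.range (2 * L + 1)).filter (fun n => n % 2 = p % 2),
          (compound n C).trace := by
    rw [Complex.ofReal_sum, Finset.mul_sum]
    refine Finset.sum_congr rfl fun n hn => ?_
    have hn' := (Finset.mem_filter.1 hn).2
    refine trace_sector_eq hL2 _ H₁ H₂ (Complex.exp_ne_zero _) ?_ hw m
    rw [hu, neg_one_pow_eq_pow_mod_two (p + 1), neg_one_pow_eq_pow_mod_two (n + 1)]
    congr 1
    omega
  refine (le_abs_self _).trans ?_
  rw [← Real.norm_eq_abs, ← Complex.norm_real, h1, norm_mul, norm_pow, Complex.norm_real,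
    Real.norm_of_nonneg hG.le]
  have h2 := sum_trace_compound_le C p
  rw [ZMod.card] at h2
  have h3 := prod_norm_det_le hL H₁ H₂ κ hw hm (c := 1) (by simp)
  have h4 := prod_norm_det_le hL H₁ H₂ κ hw hm (c := -1) (by simp)
  refine (mul_le_mul_of_nonneg_left h2 (by positivity)).trans ?_
  rw [← hC] at h3 h4
  linarith

/-- The partition function is at most of the order of the product over the momenta of the sizes of
the modes. Odd and even particle numbers need different boundary conditions, hence two sets of
momenta. -/
theorem trace_rowWeight_le (hL2 : 2 ≤ L) (hL : Even L) (H₁ H₂ : ℝ) {w : ℕ → ℝ × ℝ}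
    (hw : ∀ i, 0 < (w i).2) {m : ℕ} (hm : Even m) :
    (rangeProd (fun i : ℕ => rowWeight L (i : ZMod 2) H₁ H₂ (w i)) m).trace ≤
      2 ^ L * ∏ j : Fin L, modeSize (Real.pi * (j : ℕ) / L + 0) H₁ H₂ w m +
      2 ^ L * ∏ j : Fin L, modeSize (Real.pi * (j : ℕ) / L + Real.pi / (2 * L)) H₁ H₂ w m := by
  rw [trace_eq_sum_sector, ZMod.card, ← Finset.sum_filter_add_sum_filter_not _
    (fun n => n % 2 = 1 % 2)]
  refine add_le_add (sum_trace_sector_le hL2 hL H₁ H₂ 0 hw hm 1 (by simp)) ?_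
  have h := sum_trace_sector_le hL2 hL H₁ H₂ (Real.pi / (2 * L)) hw hm 0 (by
    have hL0 : (L : ℂ) ≠ 0 := Nat.cast_ne_zero.2 (NeZero.ne L)
    rw [← Complex.exp_nat_mul, zero_add, pow_one, ← Complex.exp_pi_mul_I]
    congr 1
    push_cast
    field_simp)
  refine le_trans (le_of_eq (Finset.sum_congr ?_ fun _ _ => rfl)) h
  ext n
  simp only [Finset.mem_filter]
  refine and_congr_right fun _ => ?_
  omega

theorem norm_conj_blockDiagonal_apply_le {Y : Fin L → Matrix (Fin 2) (Fin 2) ℂ} {a : ℝ}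
    (hY : ∀ j c d, ‖Y j c d‖ ≤ a) (x x' : ZMod (2 * L)) :
    ‖(planeWaves L 0 * Matrix.blockDiagonal Y * planeWavesInv L 0) x x'‖ ≤ (2 * L) ^ 2 * a := by
  have ha : 0 ≤ a := (norm_nonneg _).trans (hY 0 0 0)
  have h1 : ∀ q q', ‖Matrix.blockDiagonal Y q q'‖ ≤ a := by
    rintro ⟨c, j⟩ ⟨c', j'⟩
    rw [Matrix.blockDiagonal_apply]
    split_ifs
    · exact hY _ _ _
    · simpa using ha
  have hc : Fintype.card (Fin 2 × Fin L) = 2 * L := by simp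
  have h2 : ∀ q, ‖(planeWaves L 0 * Matrix.blockDiagonal Y) x q‖ ≤ 2 * L * a := by
    intro q
    rw [Matrix.mul_apply]
    refine (norm_sum_le _ _).trans ?_
    refine (Finset.sum_le_card_nsmul _ _ a fun q' _ => ?_).trans ?_
    · rw [norm_mul]
      exact (mul_le_mul (norm_planeWaves_le _ _ _) (h1 _ _) (norm_nonneg _) zero_le_one).trans
        (one_mul _).le
    · rw [Finset.card_univ, hc, nsmul_eq_mul]
      push_cast
      rfl
  rw [Matrix.mul_apply]
  refine (norm_sum_le _ _).trans ?_
  refine (Finset.sum_le_card_nsmul _ _ (2 * L * a) fun q' _ => ?_).trans ?_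
  · rw [norm_mul]
    exact (mul_le_mul (h2 _) (norm_planeWavesInv_le _ _ _) (norm_nonneg _) (by positivity)).trans
        (mul_one _).le
  · rw [Finset.card_univ, hc, nsmul_eq_mul]
    push_cast
    exact le_of_eq (by ring)

theorem norm_compound_le {X : Type*} [LinearOrder X] [Fintype X] {M : Matrix X X ℂ} {a : ℝ}
    (ha : 1 ≤ a) (hM : ∀ x y, ‖M x y‖ ≤ a) {n : ℕ} (hn : n ≤ Fintype.card X)
    (s t : Set.powersetCard X n) :
    ‖compound n M s t‖ ≤ (Fintype.card X).factorial * a ^ Fintype.card X := by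
  have h := Matrix.det_le (A := M.submatrix (Set.powersetCard.ofFinEmbEquiv.symm s)
    (Set.powersetCard.ofFinEmbEquiv.symm t)) (abv := IsAbsoluteValue.toAbsoluteValue (norm : ℂ → ℝ))
    (x := a) fun i j => hM _ _
  rw [Fintype.card_fin, nsmul_eq_mul] at h
  refine h.trans ?_
  gcongr

/-- The weights of all paths with free ends dominate the product of the sizes of the modes. -/
theorem prod_modeSize_le (hL2 : 2 ≤ L) (hL : Even L) : ∃ K : ℝ, 0 < K ∧
    ∀ (H₁ H₂ κ : ℝ) {w : ℕ → ℝ × ℝ} (_ : ∀ i, 0 ≤ (w i).1) (_ : ∀ i, 0 < (w i).2) {m : ℕ}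
      (_ : Even m),
    ∏ j : Fin L, modeSize (Real.pi * (j : ℕ) / L + κ) H₁ H₂ w m ≤
      K * ∑ n ∈ Finset.range (2 * L + 1), ∑ s, ∑ t,
        sector n (rangeProd (fun i : ℕ => rowWeight L (i : ZMod 2) H₁ H₂ (w i)) m) s t := by
  have hL1 : (1 : ℝ) ≤ L := by exact_mod_cast NeZero.pos L
  set a : ℝ := (2 * L) ^ 2 * 2 with ha_def
  have ha : 1 ≤ a := by nlinarith
  set K : ℝ := (2 * L).factorial * a ^ (2 * L) with hK
  have hK0 : 0 < K := by positivity
  refine ⟨2 ^ L * K, by positivity, ?_⟩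
  intro H₁ H₂ κ w hw1 hw m hm
  have hG := gProd_pos H₁ hw m
  set Y : Fin L → Matrix (Fin 2) (Fin 2) ℂ := fun j =>
    aligned (blockProd (Real.pi * (j : ℕ) / L + κ) H₂ w m) with hY
  set D := planeWaves L 0 * Matrix.blockDiagonal Y * planeWavesInv L 0 with hD
  set C := (gProd H₁ w m : ℂ)⁻¹ • rangeProd (fun i : ℕ => rowMatrix L
        (i : ZMod 2) H₂ (Complex.exp (Complex.I * κ)) (w i)) m with hC
  have hDle : ∀ x x', ‖D x x'‖ ≤ a := norm_conj_blockDiagonal_apply_le fun j c d =>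
    norm_aligned_apply_le _ _ _
  have h1 : ∏ j : Fin L, modeSize (Real.pi * (j : ℕ) / L + κ) H₁ H₂ w m ≤
      2 ^ L * (gProd H₁ w m ^ L * ‖(1 + C * D).det‖) := by
    rw [hC, hD, det_one_add_smul_rangeProd hL H₂ κ w hm, norm_prod]
    have hL' : ∀ a : ℝ, a ^ L = ∏ _j : Fin L, a := fun a => by simp
    rw [hL', hL', ← Finset.prod_mul_distrib, ← Finset.prod_mul_distrib]
    refine Finset.prod_le_prod (fun j _ => (modeSize_pos _ _ _ hw m).le) fun j _ => ?_
    have h2 := le_norm_det_one_add_aligned hG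
      (det_blockProd_ne_zero (Real.pi * (j : ℕ) / L + κ) H₂ hw m)
    rw [det_div_gProd _ _ _ hw] at h2
    unfold modeSize
    linarith
  -- expand in minors, and bound the minors of `D` by a constant and those of `C` by path weights
  refine h1.trans ?_
  rw [mul_assoc]
  refine mul_le_mul_of_nonneg_left ?_ (by positivity)
  rw [det_one_add_eq_sum_trace_compound, ZMod.card]
  refine (mul_le_mul_of_nonneg_left (norm_sum_le _ _) (by positivity)).trans ?_
  rw [Finset.mul_sum, Finset.mul_sum]
  refine Finset.sum_le_sum fun n hn => ?_
  rw [compound_mul, Matrix.trace]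
  simp only [Matrix.diag_apply, Matrix.mul_apply]
  refine (mul_le_mul_of_nonneg_left (norm_sum_le _ _) (by positivity)).trans ?_
  rw [Finset.mul_sum, Finset.mul_sum]
  refine Finset.sum_le_sum fun s _ => ?_
  refine (mul_le_mul_of_nonneg_left (norm_sum_le _ _) (by positivity)).trans ?_
  rw [Finset.mul_sum, Finset.mul_sum]
  refine Finset.sum_le_sum fun t _ => ?_
  rw [norm_mul]
  have h3 := norm_compound_rangeProd_le hL2 (fun i => (i : ZMod 2)) H₁ H₂
    (u := Complex.exp (Complex.I * κ)) (by rw [mul_comm]; exact Complex.norm_exp_ofReal_mul_I κ)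
    hw1 hw m s t
  have h4 : ‖compound n D t s‖ ≤ K := by
    have := norm_compound_le ha hDle (n := n) (by
      rw [ZMod.card]; have := Finset.mem_range.1 hn; omega) t s
    rwa [ZMod.card] at this
  have h5 := mul_le_mul h3 h4 (norm_nonneg _) ((by positivity : (0 : ℝ) ≤ _).trans h3)
  calc _ = _ := by ring
    _ ≤ _ := h5
    _ = _ := by ring

end Determinants

/-! ### Products of non-negative matrices -/

section NonnegativeProducts

variable {ι : Type*} [Fintype ι]

/-- The sum of the entries of a matrix. -/
def entrySum (A : Matrix ι ι ℝ) : ℝ := ∑ s, ∑ t, A s t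

/-- The sum of the entries is submultiplicative on non-negative matrices. -/
theorem entrySum_mul_le {P Q : Matrix ι ι ℝ} (hP : ∀ s t, 0 ≤ P s t) (hQ : ∀ s t, 0 ≤ Q s t) :
    entrySum (P * Q) ≤ entrySum P * entrySum Q := by
  have h : entrySum (P * Q) = ∑ s, ∑ a, P s a * ∑ t, Q a t := by
    simp only [entrySum, Matrix.mul_apply, Finset.mul_sum]
    exact Finset.sum_congr rfl fun s _ => Finset.sum_comm
  rw [h]
  unfold entrySum
  simp only [Finset.sum_mul]
  refine Finset.sum_le_sum fun s _ => Finset.sum_le_sum fun a _ => ?_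
  exact mul_le_mul_of_nonneg_left (Finset.single_le_sum (f := fun a => ∑ t, Q a t)
    (fun b _ => Finset.sum_nonneg fun t _ => hQ b t) (Finset.mem_univ a)) (hP s a)

/-- The sum of the entries is supermultiplicative up to the smallest entry of an intermediate
factor. -/
theorem le_entrySum_mul_mul {P R Q : Matrix ι ι ℝ} {ε : ℝ} (hP : ∀ s t, 0 ≤ P s t)
    (hQ : ∀ s t, 0 ≤ Q s t) (hR : ∀ s t, ε ≤ R s t) :
    ε * (entrySum P * entrySum Q) ≤ entrySum (P * (R * Q)) := by
  have h : entrySum (P * (R * Q)) = ∑ s, ∑ a, ∑ b, ∑ t, P s a * (R a b * Q b t) := by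
    simp only [entrySum, Matrix.mul_apply, Finset.mul_sum]
    refine Finset.sum_congr rfl fun s _ => ?_
    rw [Finset.sum_comm]
    exact Finset.sum_congr rfl fun a _ => Finset.sum_comm
  rw [h]
  unfold entrySum
  rw [Finset.sum_mul, Finset.mul_sum]
  refine Finset.sum_le_sum fun s _ => ?_
  rw [Finset.sum_mul, Finset.mul_sum]
  refine Finset.sum_le_sum fun a _ => ?_
  simp only [Finset.mul_sum]
  refine Finset.sum_le_sum fun b _ => Finset.sum_le_sum fun t _ => ?_
  have := mul_le_mul_of_nonneg_left (mul_le_mul_of_nonneg_right (hR a b) (hQ b t)) (hP s a)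
  linarith

theorem mul_apply_nonneg {P Q : Matrix ι ι ℝ} (hP : ∀ s t, 0 ≤ P s t) (hQ : ∀ s t, 0 ≤ Q s t)
    (s t : ι) : 0 ≤ (P * Q) s t := by
  rw [Matrix.mul_apply]
  exact Finset.sum_nonneg fun a _ => mul_nonneg (hP s a) (hQ a t)

theorem mul_le_mul_apply {P Q : Matrix ι ι ℝ} (hP : ∀ s t, 0 ≤ P s t) (hQ : ∀ s t, 0 ≤ Q s t)
    (s a t : ι) : P s a * Q a t ≤ (P * Q) s t := by
  rw [Matrix.mul_apply]
  exact Finset.single_le_sum (f := fun a => P s a * Q a t)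
    (fun a _ => mul_nonneg (hP s a) (hQ a t)) (Finset.mem_univ a)

theorem trace_le_entrySum {P : Matrix ι ι ℝ} (hP : ∀ s t, 0 ≤ P s t) : P.trace ≤ entrySum P :=
  Finset.sum_le_sum fun s _ =>
    Finset.single_le_sum (f := fun t => P s t) (fun t _ => hP s t) (Finset.mem_univ s)

variable [DecidableEq ι]

theorem rangeProd_apply_nonneg {A : ℕ → Matrix ι ι ℝ} (hA : ∀ i s t, 0 ≤ A i s t) (p : ℕ)
    (s t : ι) : 0 ≤ rangeProd A p s t := by
  induction p generalizing s t with
  | zero =>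
    rw [rangeProd_zero, Matrix.one_apply]
    split_ifs <;> simp
  | succ p ih =>
    rw [rangeProd_succ]
    exact mul_apply_nonneg ih (hA p) s t

/-- The matrices of a sequence have non-negative entries bounded by `C`, diagonal entries bounded
below by `c`, and the products of `r` consecutive ones have entries bounded below by `ε`. -/
structure Mixing (c C ε : ℝ) (r : ℕ) (A : ℕ → Matrix ι ι ℝ) : Prop where
  nonneg : ∀ i s t, 0 ≤ A i s t
  le : ∀ i s t, A i s t ≤ C
  diag : ∀ i s, c ≤ A i s s
  mixing : ∀ i s t, ε ≤ rangeProd (fun k => A (i + k)) r s t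

theorem Mixing.shift {c C ε : ℝ} {r : ℕ} {A : ℕ → Matrix ι ι ℝ} (h : Mixing c C ε r A) (p : ℕ) :
    Mixing c C ε r fun k => A (p + k) where
  nonneg i := h.nonneg _
  le i := h.le _
  diag i := h.diag _
  mixing i s t := by
    have := h.mixing (p + i) s t
    simpa only [add_assoc] using this

theorem Mixing.pow_le_diag {c C ε : ℝ} {r : ℕ} {A : ℕ → Matrix ι ι ℝ} (h : Mixing c C ε r A)
    (hc : 0 ≤ c) (p : ℕ) (s : ι) : c ^ p ≤ rangeProd A p s s := by
  induction p with
  | zero => simp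
  | succ p ih =>
    rw [pow_succ, rangeProd_succ]
    exact (mul_le_mul ih (h.diag p s) hc (rangeProd_apply_nonneg h.nonneg _ _ _)).trans
      (mul_le_mul_apply (rangeProd_apply_nonneg h.nonneg _) (h.nonneg p) s s s)

theorem Mixing.entrySum_le {c C ε : ℝ} {r : ℕ} {A : ℕ → Matrix ι ι ℝ} (h : Mixing c C ε r A)
    {K : ℝ} (hK1 : (Fintype.card ι : ℝ) ≤ K) (hK2 : (Fintype.card ι : ℝ) ^ 2 * C ≤ K) (p : ℕ) :
    entrySum (rangeProd A p) ≤ K ^ (p + 1) := by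
  have hK0 : 0 ≤ K := (Nat.cast_nonneg _).trans hK1
  induction p with
  | zero => simpa [entrySum, Matrix.one_apply] using hK1
  | succ p ih =>
    have hA : entrySum (A p) ≤ K := by
      refine le_trans ?_ hK2
      unfold entrySum
      refine (Finset.sum_le_card_nsmul _ _ (Fintype.card ι * C) fun s _ => ?_).trans ?_
      · refine (Finset.sum_le_card_nsmul _ _ C fun t _ => h.le p s t).trans ?_
        simp
      · simp only [Finset.card_univ, nsmul_eq_mul]
        exact le_of_eq (by ring)
    have hA0 : 0 ≤ entrySum (A p) := Finset.sum_nonneg fun s _ => Finset.sum_nonneg fun t _ =>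
      h.nonneg p s t
    rw [rangeProd_succ, pow_succ]
    exact (entrySum_mul_le (rangeProd_apply_nonneg h.nonneg _) (h.nonneg p)).trans
      (mul_le_mul ih hA hA0 (by positivity))

/-- The logarithm of the sum of the entries of the product is almost additive, and comparable with
the logarithm of the trace. -/
theorem Mixing.exists_log_bounds [Nonempty ι] {c C ε : ℝ} (hc : 0 < c) (hε : 0 < ε) (r : ℕ) :
    ∃ K : ℝ, 0 < K ∧ ∀ A : ℕ → Matrix ι ι ℝ, Mixing c C ε r A → ∀ p q : ℕ,
      |Real.log (entrySum (rangeProd A (p + q))) - Real.log (entrySum (rangeProd A p)) -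
        Real.log (entrySum (rangeProd (fun k => A (p + k)) q))| ≤ K ∧
      |Real.log (entrySum (rangeProd A p))| ≤ K * (p + 1) ∧
      0 < (rangeProd A p).trace ∧ 0 < entrySum (rangeProd A p) ∧
      Real.log (entrySum (rangeProd A p)) - K ≤ Real.log (rangeProd A p).trace := by
  set M : ℝ := max (Fintype.card ι : ℝ) ((Fintype.card ι : ℝ) ^ 2 * C) with hM
  have hcard : (1 : ℝ) ≤ Fintype.card ι := by exact_mod_cast Fintype.card_pos
  have hM1 : 1 ≤ M := hcard.trans (le_max_left _ _)
  set c' : ℝ := min c 1 with hc'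
  have hc'0 : 0 < c' := lt_min hc one_pos
  have hc'1 : c' ≤ 1 := min_le_right _ _
  -- `M ^ (r + 1)` bounds the sum of the entries of a product of at most `r` matrices
  set κ : ℝ := min ε (c' ^ r) / M ^ (r + 1) with hκ
  have hκ0 : 0 < κ := by positivity
  have hκ1 : κ ≤ 1 := by
    rw [hκ, div_le_one (by positivity)]
    exact (min_le_right _ _).trans ((pow_le_one₀ hc'0.le hc'1).trans (one_le_pow₀ hM1))
  have hlogM : 0 ≤ Real.log M := Real.log_nonneg hM1
  have hlogc : Real.log c' ≤ 0 := Real.log_nonpos hc'0.le hc'1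
  have hlogκ : Real.log κ ≤ 0 := Real.log_nonpos hκ0.le hκ1
  set K : ℝ := 1 + Real.log M - Real.log c' - Real.log κ with hKdef
  refine ⟨K, by linarith, ?_⟩
  intro A h0
  have hA : Mixing c' C ε r A := ⟨h0.nonneg, h0.le, fun i s => (min_le_left _ _).trans (h0.diag i s),
    h0.mixing⟩
  have hle : ∀ {A : ℕ → Matrix ι ι ℝ}, Mixing c' C ε r A → ∀ p, entrySum (rangeProd A p) ≤
      M ^ (p + 1) := fun hA p => hA.entrySum_le (le_max_left _ _) (le_max_right _ _) p
  have hge : ∀ {A : ℕ → Matrix ι ι ℝ}, Mixing c' C ε r A → ∀ p, c' ^ p ≤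
      (rangeProd A p).trace := by
    intro A hA p
    obtain ⟨s⟩ := ‹Nonempty ι›
    refine (hA.pow_le_diag hc'0.le p s).trans ?_
    exact Finset.single_le_sum (f := fun s => rangeProd A p s s)
      (fun s _ => rangeProd_apply_nonneg hA.nonneg p s s) (Finset.mem_univ s)
  have htr : ∀ {A : ℕ → Matrix ι ι ℝ}, Mixing c' C ε r A → ∀ p, (rangeProd A p).trace ≤
      entrySum (rangeProd A p) := fun hA p => trace_le_entrySum (rangeProd_apply_nonneg hA.nonneg p)
  -- a product of `q` matrices is either short, or starts or ends with a factor with positive entries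
  have hshort : ∀ {A : ℕ → Matrix ι ι ℝ}, Mixing c' C ε r A → ∀ q < r,
      κ * entrySum (rangeProd A q) ≤ c' ^ q := by
    intro A hA q hq
    have h1 : κ * entrySum (rangeProd A q) ≤ κ * M ^ (r + 1) := by
      refine mul_le_mul_of_nonneg_left ((hle hA q).trans ?_) hκ0.le
      exact pow_le_pow_right₀ hM1 (by omega)
    refine h1.trans ?_
    rw [hκ, div_mul_cancel₀ _ (by positivity)]
    exact (min_le_right _ _).trans (pow_le_pow_of_le_one hc'0.le hc'1 hq.le)
  have hκM : ∀ {x y : ℝ}, 0 ≤ y → x ≤ M ^ (r + 1) → κ * (x * y) ≤ ε * y := by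
    intro x y hy hx
    rw [← mul_assoc]
    refine mul_le_mul_of_nonneg_right ?_ hy
    calc κ * x ≤ κ * M ^ (r + 1) := by gcongr
      _ = min ε (c' ^ r) := by rw [hκ, div_mul_cancel₀ _ (by positivity)]
      _ ≤ ε := min_le_left _ _
  have hsup : ∀ p q, κ * (entrySum (rangeProd A p) * entrySum (rangeProd (fun k => A (p + k)) q)) ≤
      entrySum (rangeProd A (p + q)) := by
    intro p q
    have hP0 : 0 ≤ entrySum (rangeProd A p) := ((pow_pos hc'0 p).le.trans (hge hA p)).trans (htr hA p)
    have hAs := hA.shift p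
    rw [rangeProd_add]
    rcases lt_or_ge q r with hq | hq
    · have h1 := hshort hAs q hq
      have h2 : entrySum (rangeProd A p) * c' ^ q ≤
          entrySum (rangeProd A p * rangeProd (fun k => A (p + k)) q) := by
        unfold entrySum
        rw [Finset.sum_mul]
        refine Finset.sum_le_sum fun s _ => ?_
        rw [Finset.sum_mul]
        refine Finset.sum_le_sum fun t _ => ?_
        exact (mul_le_mul_of_nonneg_left (hAs.pow_le_diag hc'0.le q t)
          (rangeProd_apply_nonneg hA.nonneg p s t)).trans
          (mul_le_mul_apply (rangeProd_apply_nonneg hA.nonneg p)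
            (rangeProd_apply_nonneg hAs.nonneg q) s t t)
      calc _ = entrySum (rangeProd A p) * (κ * entrySum (rangeProd (fun k => A (p + k)) q)) := by ring
        _ ≤ entrySum (rangeProd A p) * c' ^ q := by gcongr
        _ ≤ _ := h2
    · obtain ⟨q', rfl⟩ := Nat.exists_eq_add_of_le hq
      rw [rangeProd_add]
      have hAs' := hAs.shift r
      have hQ0 : 0 ≤ entrySum (rangeProd (fun k => A (p + (r + k))) q') :=
        ((pow_pos hc'0 _).le.trans (hge hAs' _)).trans (htr hAs' _)
      have h1 := le_entrySum_mul_mul (rangeProd_apply_nonneg hA.nonneg p)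
        (rangeProd_apply_nonneg hAs'.nonneg q') (hA.mixing p)
      refine le_trans ?_ h1
      have h2 := entrySum_mul_le (rangeProd_apply_nonneg hAs.nonneg r)
        (rangeProd_apply_nonneg hAs'.nonneg q')
      have h3 := hκM (mul_nonneg hP0 hQ0) (hle hAs r)
      calc _ ≤ κ * (entrySum (rangeProd A p) * (entrySum (rangeProd (fun k => A (p + k)) r) *
            entrySum (rangeProd (fun k => A (p + (r + k))) q'))) := by gcongr
        _ = κ * (entrySum (rangeProd (fun k => A (p + k)) r) * (entrySum (rangeProd A p) *
            entrySum (rangeProd (fun k => A (p + (r + k))) q'))) := by ring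
        _ ≤ _ := h3
  have htrace : ∀ p, κ * entrySum (rangeProd A p) ≤ (rangeProd A p).trace := by
    intro p
    rcases lt_or_ge p r with hp | hp
    · exact (hshort hA p hp).trans (hge hA p)
    · obtain ⟨p', rfl⟩ := Nat.exists_eq_add_of_le' hp
      rw [rangeProd_add]
      have hAs := hA.shift p'
      have hP0 : 0 ≤ entrySum (rangeProd A p') :=
        ((pow_pos hc'0 _).le.trans (hge hA _)).trans (htr hA _)
      have h2 := entrySum_mul_le (rangeProd_apply_nonneg hA.nonneg p')
        (rangeProd_apply_nonneg hAs.nonneg r)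
      have h3 := hκM hP0 (hle hAs r)
      have h4 : ε * entrySum (rangeProd A p') ≤
          (rangeProd A p' * rangeProd (fun k => A (p' + k)) r).trace := by
        simp only [Matrix.trace, Matrix.diag_apply, Matrix.mul_apply, entrySum, Finset.mul_sum]
        refine Finset.sum_le_sum fun s _ => Finset.sum_le_sum fun a _ => ?_
        rw [mul_comm ε]
        exact mul_le_mul_of_nonneg_left (hA.mixing p' a s)
          (rangeProd_apply_nonneg hA.nonneg p' s a)
      calc _ ≤ κ * (entrySum (rangeProd A p') *
            entrySum (rangeProd (fun k => A (p' + k)) r)) := by gcongr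
        _ = κ * (entrySum (rangeProd (fun k => A (p' + k)) r) * entrySum (rangeProd A p')) := by ring
        _ ≤ _ := h3.trans h4
  have hpos : ∀ {A : ℕ → Matrix ι ι ℝ}, Mixing c' C ε r A → ∀ p, 0 < (rangeProd A p).trace :=
    fun hA p => (pow_pos hc'0 p).trans_le (hge hA p)
  have hpos' : ∀ {A : ℕ → Matrix ι ι ℝ}, Mixing c' C ε r A → ∀ p, 0 < entrySum (rangeProd A p) :=
    fun hA p => (hpos hA p).trans_le (htr hA p)
  intro p q
  have hs := hpos' (hA.shift p) q
  refine ⟨?_, ?_, hpos hA p, hpos' hA p, ?_⟩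
  · have h1 : Real.log (entrySum (rangeProd A (p + q))) ≤ Real.log (entrySum (rangeProd A p)) +
        Real.log (entrySum (rangeProd (fun k => A (p + k)) q)) := by
      rw [← Real.log_mul (hpos' hA p).ne' hs.ne']
      refine Real.log_le_log (hpos' hA _) ?_
      rw [rangeProd_add]
      exact entrySum_mul_le (rangeProd_apply_nonneg hA.nonneg p)
        (rangeProd_apply_nonneg (hA.shift p).nonneg q)
    have h2 : Real.log κ + (Real.log (entrySum (rangeProd A p)) +
        Real.log (entrySum (rangeProd (fun k => A (p + k)) q))) ≤
        Real.log (entrySum (rangeProd A (p + q))) := by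
      rw [← Real.log_mul (hpos' hA p).ne' hs.ne', ← Real.log_mul hκ0.ne'
        (mul_pos (hpos' hA p) hs).ne']
      exact Real.log_le_log (mul_pos hκ0 (mul_pos (hpos' hA p) hs)) (hsup p q)
    rw [abs_le]
    constructor <;> linarith
  · have h1 : Real.log (entrySum (rangeProd A p)) ≤ (p + 1) * Real.log M := by
      refine (Real.log_le_log (hpos' hA p) (hle hA p)).trans ?_
      rw [Real.log_pow]
      push_cast
      rfl
    have h2 : p * Real.log c' ≤ Real.log (entrySum (rangeProd A p)) := by
      rw [← Real.log_pow]
      exact Real.log_le_log (pow_pos hc'0 p) ((hge hA p).trans (htr hA p))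
    have hp : (0 : ℝ) ≤ p := Nat.cast_nonneg p
    rw [abs_le]
    constructor <;> nlinarith
  · have h1 := Real.log_le_log (mul_pos hκ0 (hpos' hA p)) (htrace p)
    rw [Real.log_mul hκ0.ne' (hpos' hA p).ne'] at h1
    linarith

end NonnegativeProducts

/-! ### Irreducibility of the sectors -/

section Irreducibility

/-- Positivity of long products: it is enough that any two states are joined by a chain of moves,
each of which is possible in one of any two consecutive steps. -/
theorem exists_pow_le_rangeProd {ι : Type*} [Fintype ι] [DecidableEq ι] {R : ι → ι → Prop}
    (hR : ∀ s t, Relation.ReflTransGen R s t) {c : ℝ} (hc : 0 < c) :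
    ∃ r : ℕ, ∀ A : ℕ → Matrix ι ι ℝ, (∀ i s t, 0 ≤ A i s t) → (∀ i s, c ≤ A i s s) →
      (∀ i s t, R s t → c ≤ A i s t ∨ c ≤ A (i + 1) s t) →
      ∀ s t, c ^ r ≤ rangeProd A r s t := by
  set Good : (ℕ → Matrix ι ι ℝ) → Prop := fun A => (∀ i s t, 0 ≤ A i s t) ∧ (∀ i s, c ≤ A i s s) ∧
      (∀ i s t, R s t → c ≤ A i s t ∨ c ≤ A (i + 1) s t) with hGood
  have hshift : ∀ A p, Good A → Good fun k => A (p + k) :=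
    fun A p h => ⟨fun i => h.1 _, fun i => h.2.1 _, fun i => h.2.2 _⟩
  have hdiag : ∀ A, Good A → ∀ j s, c ^ j ≤ rangeProd A j s s := by
    intro A h j s
    induction j with
    | zero => simp
    | succ p ih =>
      rw [pow_succ, rangeProd_succ]
      exact (mul_le_mul ih (h.2.1 p s) hc.le (rangeProd_apply_nonneg h.1 _ _ _)).trans
        (mul_le_mul_apply (rangeProd_apply_nonneg h.1 _) (h.1 p) s s s)
  have htwo : ∀ A, Good A → ∀ s t, R s t → c ^ 2 ≤ rangeProd A 2 s t := by
    intro A h s t hst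
    have e : rangeProd A 2 = A 0 * A 1 := by
      rw [rangeProd_succ, rangeProd_succ, rangeProd_zero, one_mul]
    rw [e, pow_two]
    rcases h.2.2 0 s t hst with h1 | h1
    · exact (mul_le_mul h1 (h.2.1 1 t) hc.le (h.1 0 s t)).trans
        (mul_le_mul_apply (h.1 0) (h.1 1) s t t)
    · exact (mul_le_mul (h.2.1 0 s) h1 hc.le (h.1 0 s s)).trans
        (mul_le_mul_apply (h.1 0) (h.1 1) s s t)
  have hmul : ∀ A, Good A → ∀ p q s a t, c ^ p ≤ rangeProd A p s a →
      c ^ q ≤ rangeProd (fun k => A (p + k)) q a t → c ^ (p + q) ≤ rangeProd A (p + q) s t := by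
    intro A h p q s a t h1 h2
    rw [pow_add, rangeProd_add]
    exact (mul_le_mul h1 h2 (by positivity) (rangeProd_apply_nonneg h.1 _ _ _)).trans
      (mul_le_mul_apply (rangeProd_apply_nonneg h.1 _)
        (rangeProd_apply_nonneg (hshift A p h).1 _) s a t)
  have hex : ∀ s t, ∃ k, ∀ A, Good A → c ^ k ≤ rangeProd A k s t := by
    intro s t
    induction hR s t with
    | refl => exact ⟨0, fun A h => hdiag A h 0 s⟩
    | tail _ hbt ih =>
      obtain ⟨k, hk⟩ := ih
      exact ⟨k + 2, fun A h => hmul A h k 2 _ _ _ (hk A h) (htwo _ (hshift A k h) _ _ hbt)⟩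
  choose k hk using hex
  refine ⟨∑ s, ∑ t, k s t, fun A h1 h2 h3 s t => ?_⟩
  have hle : k s t ≤ ∑ s, ∑ t, k s t :=
    (Finset.single_le_sum (f := fun t => k s t) (fun _ _ => bot_le) (Finset.mem_univ t)).trans
      (Finset.single_le_sum (f := fun s => ∑ t, k s t) (fun _ _ => bot_le) (Finset.mem_univ s))
  obtain ⟨j, hj⟩ := Nat.exists_eq_add_of_le hle
  rw [hj]
  have h : Good A := ⟨h1, h2, h3⟩
  exact hmul A h _ _ _ _ _ (hk s t A h) (hdiag _ (hshift A _ h) _ _)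

variable {m : ℕ}

/-- One particle hops to an empty neighbouring site. -/
def Hop (T T' : Finset (ZMod m)) : Prop :=
  ∃ x ∈ T, ∃ x' ∉ T, (x' = x + 1 ∨ x' = x - 1) ∧ T' = insert x' (T.erase x)

theorem Hop.symm {T T' : Finset (ZMod m)} (h : Hop T T') : Hop T' T := by
  obtain ⟨x, hx, x', hx', h1, rfl⟩ := h
  have hne : x ≠ x' := fun h => hx' (h ▸ hx)
  refine ⟨x', by simp, x, by simp [hne], ?_, ?_⟩
  · rcases h1 with rfl | rfl
    · right; ring
    · left; ring
  · rw [Finset.erase_insert (by simp [hx']), Finset.insert_erase hx]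

theorem Hop.card_eq {T T' : Finset (ZMod m)} (h : Hop T T') : T'.card = T.card := by
  obtain ⟨x, hx, x', hx', h1, rfl⟩ := h
  rw [Finset.card_insert_of_notMem (by simp [hx']), Finset.card_erase_add_one hx]

variable [NeZero m]

theorem card_filter_val_lt {j : ℕ} (hj : j ≤ m) :
    (Finset.univ.filter fun y : ZMod m => y.val < j).card = j := by
  have h : (Finset.univ.filter fun y : ZMod m => y.val < j).image ZMod.val = Finset.range j := by
    ext i
    simp only [Finset.mem_image, Finset.mem_filter, Finset.mem_univ, true_and, Finset.mem_range]
    constructor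
    · rintro ⟨y, hy, rfl⟩; exact hy
    · intro hi
      exact ⟨i, by rwa [ZMod.val_natCast_of_lt (by omega)], ZMod.val_natCast_of_lt (by omega)⟩
  rw [← Finset.card_image_of_injective _ (ZMod.val_injective m), h, Finset.card_range]

theorem zmod_val_sub_one (hm : 1 < m) {x : ZMod m} (hx : 0 < x.val) : (x - 1).val + 1 = x.val := by
  have h := zmod_val_add_one hm (x - 1)
  rw [sub_add_cancel] at h
  split_ifs at h with h1
  · omega
  · exact h.symm

/-- A set that cannot be pushed to the left is an initial segment. -/
theorem eq_filter_of_forall_sub_one_mem (hm : 1 < m) {T : Finset (ZMod m)}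
    (h : ∀ x ∈ T, 0 < x.val → x - 1 ∈ T) :
    T = Finset.univ.filter fun y : ZMod m => y.val < T.card := by
  have hdown : ∀ d : ℕ, ∀ x ∈ T, ∀ y : ZMod m, y.val + d = x.val → y ∈ T := by
    intro d
    induction d with
    | zero =>
      intro x hx y hy
      rwa [ZMod.val_injective m (show y.val = x.val by omega)]
    | succ d ih =>
      intro x hx y hy
      have h1 := zmod_val_sub_one hm (show 0 < x.val by omega)
      exact ih (x - 1) (h x hx (by omega)) y (by omega)
  ext x
  have hxm := ZMod.val_lt x
  simp only [Finset.mem_filter, Finset.mem_univ, true_and]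
  constructor
  · intro hx
    have h1 : (Finset.univ.filter fun y : ZMod m => y.val < x.val + 1) ⊆ T := by
      intro y hy
      have hy' := (Finset.mem_filter.1 hy).2
      exact hdown (x.val - y.val) x hx y (by omega)
    have h2 := Finset.card_le_card h1
    rw [card_filter_val_lt (by omega)] at h2
    omega
  · intro hx
    by_contra hxT
    have h1 : T ⊆ Finset.univ.filter fun y : ZMod m => y.val < x.val := by
      intro y hy
      rw [Finset.mem_filter]
      refine ⟨Finset.mem_univ _, ?_⟩
      by_contra hlt
      exact hxT (hdown (y.val - x.val) y hy x (by omega))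
    have h2 := Finset.card_le_card h1
    rw [card_filter_val_lt (by omega)] at h2
    omega

/-- Particles can be pushed one by one to the initial segment. -/
theorem reflTransGen_hop_filter (hm : 1 < m) (T : Finset (ZMod m)) :
    Relation.ReflTransGen Hop T (Finset.univ.filter fun y : ZMod m => y.val < T.card) := by
  induction hs : ∑ x ∈ T, x.val using Nat.strong_induction_on generalizing T with
  | _ k ih =>
    by_cases h : ∀ x ∈ T, 0 < x.val → x - 1 ∈ T
    · rw [← eq_filter_of_forall_sub_one_mem hm h]
    · push Not at h
      obtain ⟨x, hx, h0, hx'⟩ := h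
      have hop : Hop T (insert (x - 1) (T.erase x)) := ⟨x, hx, x - 1, hx', Or.inr rfl, rfl⟩
      have h1 := zmod_val_sub_one hm h0
      have hsum : ∑ y ∈ insert (x - 1) (T.erase x), y.val < k := by
        rw [Finset.sum_insert (by simp [hx']), ← hs, ← Finset.add_sum_erase T ZMod.val hx]
        omega
      have h2 := ih _ hsum _ rfl
      rw [hop.card_eq] at h2
      exact Relation.ReflTransGen.head hop h2

/-- Any two configurations with the same number of particles are connected by hops. -/
theorem reflTransGen_hop (hm : 1 < m) {n : ℕ} (s t : Set.powersetCard (ZMod m) n) :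
    Relation.ReflTransGen (fun s t : Set.powersetCard (ZMod m) n => Hop s.1 t.1) s t := by
  have hlift : ∀ T T' : Finset (ZMod m), Relation.ReflTransGen Hop T T' → ∀ hT : T.card = n,
      ∃ hT' : T'.card = n, Relation.ReflTransGen
        (fun s t : Set.powersetCard (ZMod m) n => Hop s.1 t.1) ⟨T, hT⟩ ⟨T', hT'⟩ := by
    intro T T' h hT
    induction h with
    | refl => exact ⟨hT, Relation.ReflTransGen.refl⟩
    | tail _ hbc ih =>
      obtain ⟨hb, ih⟩ := ih
      exact ⟨hbc.card_eq.trans hb, ih.tail hbc⟩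
  have hsymm : ∀ T T' : Finset (ZMod m), Relation.ReflTransGen Hop T T' →
      Relation.ReflTransGen Hop T' T := by
    intro T T' h
    induction h with
    | refl => exact Relation.ReflTransGen.refl
    | tail _ hbc ih => exact Relation.ReflTransGen.head hbc.symm ih
  have h1 := reflTransGen_hop_filter hm s.1
  have h2 := reflTransGen_hop_filter hm t.1
  have hc : s.1.card = t.1.card := s.2.trans t.2.symm
  rw [hc] at h1
  exact (hlift _ _ (h1.trans (hsymm _ _ h2)) s.2).2

end Irreducibility

section RowBounds

variable {m : ℕ} {blk : ZMod m → Prop} [DecidablePred blk]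

theorem prod_le_hopKernel [NeZero m] {h : ZMod m → ℝ} (h0 : ∀ x, 0 ≤ h x) {T T' H : Finset (ZMod m)}
    (hH : HopValid blk T T' H) : ∏ x ∈ H, h x ≤ hopKernel blk h T T' := by
  classical
  exact Finset.single_le_sum (f := fun H => ∏ x ∈ H, h x)
    (fun H _ => Finset.prod_nonneg fun x _ => h0 x) (by simpa using hH)

theorem hopValid_self (T : Finset (ZMod m)) : HopValid blk T T ∅ := by
  intro x
  by_cases h1 : x ∈ T <;> by_cases h2 : blk x <;> simp [h1, h2]

theorem hopValid_hop (hm : (2 : ZMod m) ≠ 0) (hb : ∀ x, blk (x + 1) ↔ ¬ blk x)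
    {T : Finset (ZMod m)} {x x' : ZMod m} (hx : x ∈ T) (hx' : x' ∉ T) (hblk : blk x)
    (h : x' = x + 1 ∨ x' = x - 1) :
    ∃ z, HopValid blk T (insert x' (T.erase x)) {z} := by
  have h1 : (1 : ZMod m) ≠ 0 := fun h => hm (by linear_combination 2 * h)
  have e1 : ∀ a : ZMod m, a + 1 ≠ a := fun a h => h1 (by linear_combination h)
  have e2 : ∀ a : ZMod m, a - 1 ≠ a := fun a h => h1 (by linear_combination -h)
  have hne : x ≠ x' := fun h => hx' (h ▸ hx)
  have hblk' : ¬ blk x' := by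
    rcases h with rfl | rfl
    · rw [hb]; simpa using hblk
    · intro hc
      have := (hb (x - 1)).1 (by simpa using hblk)
      exact this hc
  refine ⟨if x' = x + 1 then x else x', ?_⟩
  intro y
  by_cases hyx : y = x
  · subst hyx
    rcases h with rfl | rfl
    · simp [hx, hblk, e2, hne]
    · by_cases hc : y - 1 = y + 1
      · exact absurd hc fun h => hm (by linear_combination -h)
      · simp [hx, hblk, hc, hne]
  · by_cases hyx' : y = x'
    · subst hyx'
      rcases h with rfl | rfl
      · simp [hx', hblk', e1]
      · have hc : x - 1 ≠ x + 1 := fun h => hm (by linear_combination -h)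
        have hc' : x - 1 - 1 ≠ x - 1 := e2 _
        simp [hx', hblk', hc, e2]
    · have h3 : y ∈ insert x' (T.erase x) ↔ y ∈ T := by simp [hyx, hyx']
      have h4 : y ∉ ({if x' = x + 1 then x else x'} : Finset (ZMod m)) := by
        rw [Finset.mem_singleton]; split_ifs <;> assumption
      have h5 : y - 1 ∉ ({if x' = x + 1 then x else x'} : Finset (ZMod m)) := by
        rw [Finset.mem_singleton]
        split_ifs with hc
        · intro h; exact hyx' (by rw [hc, ← h]; ring)
        · have h6 : x' = x - 1 := h.resolve_left hc
          intro h
          exact hyx (by linear_combination h + h6)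
      rw [if_neg h4, if_neg h5]
      by_cases h6 : y ∈ T <;> by_cases h7 : blk y <;> simp [h3, h6, h7]

/-- Both weights of a row lie in `[c, C]`. -/
def InBox (c C : ℝ) (w : ℝ × ℝ) : Prop := w.1 ∈ Set.Icc c C ∧ w.2 ∈ Set.Icc c C

variable {L : ℕ} [NeZero L]

/-- The weights of the vertical edges of a row are bounded from both sides in a bounded environment.
-/
theorem exists_vertical_bounds (L : ℕ) [NeZero L] (H₁ : ℝ) {c C : ℝ} (hc : 0 < c) :
    ∃ a b : ℝ, 0 < a ∧ 0 < b ∧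
    ∀ (p : ZMod 2) (w : ℝ), w ∈ Set.Icc c C → ∀ T' : Finset (ZMod (2 * L)),
      (∏ x, if (x ∈ T' ↔ RowBlack L p x) then
        (if RowBlack L p x then w * Real.exp H₁ else w * Real.exp (-H₁)) else 1) ∈ Set.Icc a b := by
  set E := Real.exp |H₁| with hE
  have hE1 : 1 ≤ E := Real.one_le_exp (abs_nonneg _)
  set a := min (c * E⁻¹) 1
  set b := max (C * E) 1
  have ha : 0 < a := lt_min (by positivity) one_pos
  have hb : 1 ≤ b := le_max_right _ _
  refine ⟨a ^ (2 * L), b ^ (2 * L), by positivity, by positivity, ?_⟩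
  intro p w hw T'
  have hw0 : 0 < w := hc.trans_le hw.1
  have h1 : ∀ h : ℝ, |h| = |H₁| → w * Real.exp h ∈ Set.Icc a b := by
    intro h hh
    have h1 : E⁻¹ ≤ Real.exp h := by
      rw [hE, ← Real.exp_neg, Real.exp_le_exp, ← hh]; exact neg_abs_le h
    have h2 : Real.exp h ≤ E := by rw [hE, Real.exp_le_exp, ← hh]; exact le_abs_self h
    refine ⟨(min_le_left _ _).trans ?_, le_trans ?_ (le_max_left _ _)⟩
    · exact mul_le_mul hw.1 h1 (by positivity) hw0.le
    · exact mul_le_mul hw.2 h2 (by positivity) (hw0.le.trans hw.2)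
  have h2 : ∀ x, (if (x ∈ T' ↔ RowBlack L p x) then
        (if RowBlack L p x then w * Real.exp H₁ else w * Real.exp (-H₁)) else 1) ∈ Set.Icc a b := by
    intro x
    split_ifs
    · exact h1 _ rfl
    · exact h1 _ (abs_neg _)
    · exact ⟨min_le_right _ _, hb⟩
  have hpow : ∀ y : ℝ, y ^ (2 * L) = ∏ _x : ZMod (2 * L), y := fun y => by
    rw [Finset.prod_const, Finset.card_univ, ZMod.card]
  constructor
  · rw [hpow]
    exact Finset.prod_le_prod (fun _ _ => ha.le) fun x _ => (h2 x).1
  · rw [hpow]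
    exact Finset.prod_le_prod (fun x _ => ha.le.trans (h2 x).1) fun x _ => (h2 x).2

theorem exists_hopWeight_bounds (H₂ : ℝ) {c C : ℝ} (hc : 0 < c) :
    ∃ a b : ℝ, 0 < a ∧ a ≤ 1 ∧ 1 ≤ b ∧
    ∀ (L : ℕ) (p : ZMod 2) (w : ℝ), w ∈ Set.Icc c C → ∀ x : ZMod (2 * L),
      hopWeight L p H₂ w x ∈ Set.Icc a b := by
  set E := Real.exp |H₂| with hE
  refine ⟨min (c * E⁻¹) 1, max (C * E) 1, lt_min (by positivity) one_pos, min_le_right _ _,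
    le_max_right _ _, ?_⟩
  intro L p w hw x
  have hw0 : 0 < w := hc.trans_le hw.1
  have h1 : ∀ h : ℝ, |h| = |H₂| → w * Real.exp h ∈ Set.Icc (min (c * E⁻¹) 1) (max (C * E) 1) := by
    intro h hh
    have h1 : E⁻¹ ≤ Real.exp h := by
      rw [hE, ← Real.exp_neg, Real.exp_le_exp, ← hh]; exact neg_abs_le h
    have h2 : Real.exp h ≤ E := by rw [hE, Real.exp_le_exp, ← hh]; exact le_abs_self h
    refine ⟨(min_le_left _ _).trans ?_, le_trans ?_ (le_max_left _ _)⟩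
    · exact mul_le_mul hw.1 h1 (by positivity) hw0.le
    · exact mul_le_mul hw.2 h2 (by positivity) (hw0.le.trans hw.2)
  unfold hopWeight
  split_ifs
  · exact h1 _ (abs_neg _)
  · exact h1 _ rfl

/-- In a bounded environment, the rows restricted to a fixed number of particles are uniformly
mixing. -/
theorem exists_mixing_sector (hL : 2 ≤ L) (H₁ H₂ : ℝ) {c C : ℝ} (hc : 0 < c) (n : ℕ) :
    ∃ (c' C' ε : ℝ) (r : ℕ), 0 < c' ∧ 0 < ε ∧ ∀ w : ℕ → ℝ × ℝ, (∀ i, InBox c C (w i)) →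
      Mixing c' C' ε r fun i : ℕ => sector n (rowWeight L (i : ZMod 2) H₁ H₂ (w i)) := by
  obtain ⟨a₁, b₁, ha₁, hb₁, hv⟩ := exists_vertical_bounds L H₁ (c := c) (C := C) hc
  obtain ⟨a₂, b₂, ha₂, ha₂', hb₂, hh⟩ := exists_hopWeight_bounds H₂ (c := c) (C := C) hc
  have h1 : ∀ (p : ZMod 2) {w : ℝ × ℝ}, InBox c C w → ∀ T T' H : Finset (ZMod (2 * L)),
      HopValid (RowBlack L p) T T' H → a₂ ≤ ∏ x ∈ H, hopWeight L p H₂ w.1 x →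
      a₁ * a₂ ≤ rowWeight L p H₁ H₂ w T T' := by
    intro p w hw T T' H hH hle
    rw [rowWeight, Matrix.of_apply]
    exact mul_le_mul (hv p w.2 hw.2 T').1 (hle.trans (prod_le_hopKernel
      (fun x => ha₂.le.trans (hh L p w.1 hw.1 x).1) hH)) ha₂.le (ha₁.le.trans (hv p w.2 hw.2 T').1)
  have h2 : ∀ (p : ZMod 2) {w : ℝ × ℝ}, InBox c C w → ∀ T : Finset (ZMod (2 * L)),
      a₁ * a₂ ≤ rowWeight L p H₁ H₂ w T T := fun p w hw T =>
    h1 p hw T T ∅ (hopValid_self T) (by simpa using ha₂')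
  have h3 : ∀ (p : ZMod 2) {w w' : ℝ × ℝ}, InBox c C w → InBox c C w' →
      ∀ T T' : Finset (ZMod (2 * L)), Hop T T' →
      a₁ * a₂ ≤ rowWeight L p H₁ H₂ w T T' ∨ a₁ * a₂ ≤ rowWeight L (p + 1) H₁ H₂ w' T T' := by
    intro p w w' hw hw' T T' hT
    obtain ⟨x, hx, x', hx', hxx, rfl⟩ := hT
    have hd : ∀ q p : ZMod 2, q + p = 1 ∨ q + (p + 1) = 1 := by decide
    have hblk : RowBlack L p x ∨ RowBlack L (p + 1) x := hd _ _
    have h20 := two_ne_zero_of_two_le hL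
    rcases hblk with hblk | hblk
    · left
      obtain ⟨z, hz⟩ := hopValid_hop h20 (rowBlack_add_one L p) hx hx' hblk hxx
      exact h1 p hw _ _ _ hz (by simpa using (hh L p w.1 hw.1 z).1)
    · right
      obtain ⟨z, hz⟩ := hopValid_hop h20 (rowBlack_add_one L (p + 1)) hx hx' hblk hxx
      exact h1 _ hw' _ _ _ hz (by simpa using (hh L (p + 1) w'.1 hw'.1 z).1)
  have h4 : ∀ (p : ZMod 2) {w : ℝ × ℝ}, InBox c C w → ∀ T T' : Finset (ZMod (2 * L)),
      rowWeight L p H₁ H₂ w T T' ≤ b₁ * (Fintype.card (Finset (ZMod (2 * L))) • b₂ ^ (2 * L)) := by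
    intro p w hw T T'
    classical
    rw [rowWeight, Matrix.of_apply]
    refine mul_le_mul (hv p w.2 hw.2 T').2 ?_ (Finset.sum_nonneg fun H _ =>
      Finset.prod_nonneg fun x _ => ha₂.le.trans (hh L p w.1 hw.1 x).1) hb₁.le
    unfold hopKernel
    refine (Finset.sum_le_card_nsmul _ _ (b₂ ^ (2 * L)) fun H _ => ?_).trans ?_
    · refine (Finset.prod_le_prod (fun x _ => ha₂.le.trans (hh L p w.1 hw.1 x).1)
        fun x _ => (hh L p w.1 hw.1 x).2).trans ?_
      rw [Finset.prod_const]
      refine pow_le_pow_right₀ hb₂ ((Finset.card_le_univ H).trans ?_)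
      rw [ZMod.card]
    · exact nsmul_le_nsmul_left (by positivity) (Finset.card_le_univ _)
  have hpos : 0 < a₁ * a₂ := by positivity
  obtain ⟨r, hr⟩ := exists_pow_le_rangeProd
    (R := fun s t : Set.powersetCard (ZMod (2 * L)) n => Hop s.1 t.1)
    (reflTransGen_hop (by omega)) hpos
  refine ⟨a₁ * a₂, b₁ * (Fintype.card (Finset (ZMod (2 * L))) • b₂ ^ (2 * L)), (a₁ * a₂) ^ r, r,
    hpos, by positivity, fun w hw => ⟨?_, ?_, ?_, ?_⟩⟩
  · exact fun i s t => rowWeight_nonneg (hc.le.trans (hw i).1.1) (hc.le.trans (hw i).2.1) _ _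
  · exact fun i s t => h4 _ (hw i) _ _
  · exact fun i s => h2 _ (hw i) _
  · intro i s t
    refine hr _ ?_ ?_ ?_ s t
    · exact fun k s t => rowWeight_nonneg (hc.le.trans (hw _).1.1) (hc.le.trans (hw _).2.1) _ _
    · exact fun k s => h2 _ (hw _) _
    · intro k s t hst
      have := h3 ((i + k : ℕ) : ZMod 2) (hw (i + k)) (hw (i + (k + 1))) _ _ hst
      rwa [← Nat.cast_succ] at this

end RowBounds

/-! ### A law of large numbers for almost additive functionals -/

section Subadditive

/-- If `u` is bounded by the sums over consecutive blocks of length `q`, up to an error `K` per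
block, then `u r / r` is asymptotically at most `(μ + K) / q`, where `μ` is the average over the
blocks. -/
theorem eventually_le_of_block_sums {u X : ℕ → ℝ} {K K' μ : ℝ} {q : ℕ} (hq : 0 < q)
    (hX : Tendsto (fun k : ℕ => (∑ i ∈ Finset.range k, X i) / k) atTop (𝓝 μ))
    (hu : ∀ k s, s < q → u (k * q + s) ≤ ∑ i ∈ Finset.range k, X i + k * K + K')
    {ε : ℝ} (hε : 0 < ε) : ∀ᶠ r : ℕ in atTop, u r ≤ r * ((μ + K) / q + ε) := by
  have hq' : (0 : ℝ) < q := by exact_mod_cast hq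
  set δ := q * ε / 2 with hδ
  have hδ0 : 0 < δ := by positivity
  have h1 : ∀ᶠ k : ℕ in atTop, ∑ i ∈ Finset.range k, X i ≤ k * (μ + δ) := by
    filter_upwards [hX.eventually (gt_mem_nhds (show μ < μ + δ by linarith)), eventually_gt_atTop 0]
      with k hk hk0
    have : (0 : ℝ) < k := by exact_mod_cast hk0
    rw [div_lt_iff₀ this] at hk
    linarith
  set a := μ + K + δ with ha
  have h2 : ∀ᶠ r : ℕ in atTop, |a| + K' ≤ r * (ε / 2) := by
    have : Tendsto (fun r : ℕ => (r : ℝ) * (ε / 2)) atTop atTop :=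
      tendsto_natCast_atTop_atTop.atTop_mul_const (by positivity)
    exact this.eventually_ge_atTop _
  have h3 : Tendsto (fun r : ℕ => r / q) atTop atTop := Nat.tendsto_div_const_atTop hq.ne'
  filter_upwards [h3.eventually h1, h2] with r hr1 hr2
  have hmod : r / q * q + r % q = r := Nat.div_add_mod' r q
  have hs : r % q < q := Nat.mod_lt r hq
  have h4 := hu (r / q) (r % q) hs
  rw [hmod] at h4
  have h5 : ((r / q : ℕ) : ℝ) = r / q - ((r % q : ℕ) : ℝ) / q := by
    have : ((r / q : ℕ) : ℝ) * q + ((r % q : ℕ) : ℝ) = r := by exact_mod_cast hmod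
    field_simp
    linarith
  have h6 : ((r / q : ℕ) : ℝ) * a ≤ r / q * a + |a| := by
    rw [h5, sub_mul]
    have h7 : ((r % q : ℕ) : ℝ) / q ≤ 1 := by
      rw [div_le_one hq']; exact_mod_cast hs.le
    have h8 : 0 ≤ ((r % q : ℕ) : ℝ) / q := by positivity
    have h9 : |((r % q : ℕ) : ℝ) / q * a| ≤ |a| := by
      rw [abs_mul, abs_of_nonneg h8]
      exact mul_le_of_le_one_left (abs_nonneg _) h7
    linarith [neg_abs_le (((r % q : ℕ) : ℝ) / q * a)]
  have h7 : (r : ℝ) / q * a = r * ((μ + K) / q + ε / 2) := by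
    rw [ha, hδ]; field_simp
  nlinarith

end Subadditive

section Blocks

variable {Ω E : Type*} [MeasurableSpace Ω] [MeasurableSpace E] {P : Measure Ω}
  {ξ : ℤ → Ω → E}

/-- The sequence `ξ i, ξ (i + 1), …`. -/
def tailFrom (ξ : ℤ → Ω → E) (i : ℤ) (ω : Ω) : ℕ → E := fun k => ξ (i + k) ω

theorem measurable_tailFrom (hm : ∀ y, Measurable (ξ y)) (i : ℤ) : Measurable (tailFrom ξ i) :=
  measurable_pi_lambda _ fun _ => hm _

theorem identDistrib_tailFrom (hm : ∀ y, Measurable (ξ y)) (hind : iIndepFun ξ P)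
    (hid : ∀ y, IdentDistrib (ξ y) (ξ 0) P P) (i j : ℤ) :
    IdentDistrib (tailFrom ξ i) (tailFrom ξ j) P P := by
  refine ⟨(measurable_tailFrom hm i).aemeasurable, (measurable_tailFrom hm j).aemeasurable, ?_⟩
  have h : ∀ i : ℤ, P.map (tailFrom ξ i) = Measure.infinitePi fun _ : ℕ => P.map (ξ 0) := by
    intro i
    have hinj : Function.Injective fun k : ℕ => i + (k : ℤ) := fun a b hab => by simpa using hab
    have h1 := (hind.precomp hinj).map_fun_eq_infinitePi_map fun k => hm _
    refine h1.trans ?_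
    congr 1
    funext k
    exact (hid _).map_eq
  rw [h, h]

/-- Functionals of disjoint segments are independent. -/
theorem indepFun_tailFrom [Nonempty E] (hm : ∀ y, Measurable (ξ y)) (hind : iIndepFun ξ P)
    {m : ℕ} {f : (ℕ → E) → ℝ} (hf : Measurable f)
    (hloc : ∀ v v', (∀ k < m, v k = v' k) → f v = f v') {i j : ℤ} (hij : i + m ≤ j ∨ j + m ≤ i) :
    IndepFun (fun ω => f (tailFrom ξ i ω)) (fun ω => f (tailFrom ξ j ω)) P := by
  obtain ⟨e⟩ := ‹Nonempty E›
  have hdisj : Disjoint (Finset.Ico i (i + m)) (Finset.Ico j (j + m)) := by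
    rw [Finset.disjoint_left]
    intro y hy hy'
    rw [Finset.mem_Ico] at hy hy'
    omega
  have h := hind.indepFun_finset _ _ hdisj hm
  let φ : ∀ i : ℤ, (Finset.Ico i (i + m) → E) → ℝ := fun i v =>
    f fun k => if hk : i + (k : ℤ) ∈ Finset.Ico i (i + m) then v ⟨i + k, hk⟩ else e
  have hφ : ∀ i, Measurable (φ i) := by
    intro i
    refine hf.comp (measurable_pi_lambda _ fun k => ?_)
    by_cases hk : i + (k : ℤ) ∈ Finset.Ico i (i + m)
    · simp only [hk, dif_pos]
      exact measurable_pi_apply _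
    · simp only [hk, dif_neg, not_false_eq_true]
      exact measurable_const
  have h2 := h.comp (hφ i) (hφ j)
  have h3 : ∀ i, (fun ω => f (tailFrom ξ i ω)) =
      φ i ∘ fun ω (y : Finset.Ico i (i + m)) => ξ y ω := by
    intro i
    funext ω
    refine hloc _ _ fun k hk => ?_
    have : i + (k : ℤ) ∈ Finset.Ico i (i + m) := by
      rw [Finset.mem_Ico]; omega
    rw [dif_pos this]
    rfl
  rw [h3 i, h3 j]
  exact h2

/-- The law of large numbers over disjoint blocks. -/
theorem tendsto_block_average [Nonempty E] (hm : ∀ y, Measurable (ξ y)) (hind : iIndepFun ξ P)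
    (hid : ∀ y, IdentDistrib (ξ y) (ξ 0) P P) {m : ℕ} {f : (ℕ → E) → ℝ} (hf : Measurable f)
    (hloc : ∀ v v', (∀ k < m, v k = v' k) → f v = f v')
    (hint : Integrable (fun ω => f (tailFrom ξ 0 ω)) P) {a : ℕ → ℤ}
    (ha : ∀ i j, i < j → a i + m ≤ a j ∨ a j + m ≤ a i) :
    ∀ᵐ ω ∂P, Tendsto (fun k : ℕ => (∑ i ∈ Finset.range k, f (tailFrom ξ (a i) ω)) / k) atTop
      (𝓝 (∫ ω, f (tailFrom ξ 0 ω) ∂P)) := by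
  have hid' : ∀ i j, IdentDistrib (fun ω => f (tailFrom ξ i ω)) (fun ω => f (tailFrom ξ j ω)) P P :=
    fun i j => (identDistrib_tailFrom hm hind hid i j).comp hf
  rw [(hid' 0 (a 0)).integral_eq]
  refine strong_law_ae_real (fun i ω => f (tailFrom ξ (a i) ω)) ((hid' _ _).integrable_iff.1 hint)
    ?_ fun i => hid' _ _
  intro i j hij
  refine indepFun_tailFrom hm hind hf hloc ?_
  rcases lt_or_gt_of_ne hij with h | h
  · exact ha i j h
  · exact (ha j i h).symm

variable [IsProbabilityMeasure P]

/-- An upper bound for subadditive functionals of the segment `[-2M, 2M + 2)` of an i.i.d.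
sequence. Both halves of the segment are cut into blocks of length `2q`. -/
theorem ae_eventually_le [Nonempty E] (hm : ∀ y, Measurable (ξ y)) (hind : iIndepFun ξ P)
    (hid : ∀ y, IdentDistrib (ξ y) (ξ 0) P P) {f : ℕ → (ℕ → E) → ℝ} (hf : ∀ m, Measurable (f m))
    (hloc : ∀ m v v', (∀ k < m, v k = v' k) → f m v = f m v') {K : ℝ}
    (hbd : ∀ ω i m, |f m (tailFrom ξ i ω)| ≤ K * (m + 1))
    (hsub : ∀ ω i p q, f (2 * p + 2 * q) (tailFrom ξ (2 * i) ω) ≤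
      f (2 * p) (tailFrom ξ (2 * i) ω) + f (2 * q) (tailFrom ξ (2 * i + 2 * p) ω) + K)
    {q : ℕ} (hq : 0 < q) :
    ∀ᵐ ω ∂P, ∀ ε > 0, ∀ᶠ M : ℕ in atTop, f (2 * (2 * M + 1)) (tailFrom ξ (2 * -(M : ℤ)) ω) ≤
      (2 * M + 1 : ℕ) * ((∫ ω, f (2 * q) (tailFrom ξ 0 ω) ∂P + K) / q + ε) := by
  have hK : 0 ≤ K := by
    obtain ⟨ω⟩ := P.nonempty_of_neZero
    have := (abs_nonneg _).trans (hbd ω 0 0)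
    simpa using this
  set μ := ∫ ω, f (2 * q) (tailFrom ξ 0 ω) ∂P with hμ
  have hint : Integrable (fun ω => f (2 * q) (tailFrom ξ 0 ω)) P :=
    Integrable.of_bound ((hf _).comp (measurable_tailFrom hm 0)).aestronglyMeasurable
      (K * ((2 * q : ℕ) + 1)) (ae_of_all _ fun ω => hbd ω 0 _)
  -- the half line `[0, ∞)` is filled from left to right, the half line `(-∞, 0)` from right to left
  have hfwd := tendsto_block_average hm hind hid (hf (2 * q)) (hloc (2 * q)) hint
    (a := fun i => 2 * ((i * q : ℕ) : ℤ)) (fun i j hij => by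
      left
      have : i * q + q ≤ j * q := by nlinarith
      push_cast
      exact_mod_cast (by omega : 2 * (i * q) + 2 * q ≤ 2 * (j * q)))
  have hbwd := tendsto_block_average hm hind hid (hf (2 * q)) (hloc (2 * q)) hint
    (a := fun i => 2 * -(((i + 1) * q : ℕ) : ℤ)) (fun i j hij => by
      right
      have : (i + 1) * q + q ≤ (j + 1) * q := by nlinarith
      have h2 : (((i + 1) * q + q : ℕ) : ℤ) ≤ (((j + 1) * q : ℕ) : ℤ) := by exact_mod_cast this
      push_cast at h2 ⊢
      linarith)
  filter_upwards [hfwd, hbwd] with ω h1 h2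
  intro ε hε
  set g : ℤ → ℕ → ℝ := fun i r => f (2 * r) (tailFrom ξ (2 * i) ω) with hg
  have hgsub : ∀ i p q, g i (p + q) ≤ g i p + g (i + p) q + K := by
    intro i p q
    have h := hsub ω i p q
    simp only [hg]
    rw [mul_add, mul_add]
    exact h
  have hgbd : ∀ i s, s < q → g i s ≤ K * (2 * q + 1) := by
    intro i s hs
    refine (le_abs_self _).trans ((hbd ω _ _).trans ?_)
    have : ((2 * s : ℕ) : ℝ) ≤ 2 * q := by exact_mod_cast (by omega : 2 * s ≤ 2 * q)
    gcongr
  have hblocks : ∀ k s i, g i (k * q + s) ≤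
      ∑ j ∈ Finset.range k, g (i + (j * q : ℕ)) q + g (i + (k * q : ℕ)) s + k * K := by
    intro k s
    induction k with
    | zero => intro i; simp
    | succ k ih =>
      intro i
      have h3 := hgsub i q (k * q + s)
      have h4 := ih (i + q)
      have e1 : (k + 1) * q + s = q + (k * q + s) := by ring
      have e2 : ∀ j : ℕ, i + q + ((j * q : ℕ) : ℤ) = i + (((j + 1) * q : ℕ) : ℤ) := by
        intro j; push_cast; ring
      simp only [e2] at h4
      rw [e1, Finset.sum_range_succ']
      simp only [zero_mul, Nat.cast_zero, add_zero]
      push_cast at h3 h4 ⊢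
      linarith
  have hF : ∀ᶠ r : ℕ in atTop, g 0 r ≤ r * ((μ + K) / q + ε / 2) := by
    refine eventually_le_of_block_sums (K' := K * (2 * q + 1)) hq h1 ?_ (half_pos hε)
    intro k s hs
    have h3 := hblocks k s 0
    have h4 := hgbd (0 + (k * q : ℕ)) s hs
    simp only [zero_add] at h3 h4
    linarith
  have hB : ∀ᶠ r : ℕ in atTop, g (-(r : ℤ)) r ≤ r * ((μ + K) / q + ε / 2) := by
    refine eventually_le_of_block_sums (u := fun r => g (-(r : ℤ)) r)
      (K' := 2 * (K * (2 * q + 1)) + K) hq h2 ?_ (half_pos hε)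
    intro k s hs
    -- the incomplete block is cut off at the far left end
    have h3 := hgsub (-((k * q + s : ℕ) : ℤ)) s (k * q)
    have e1 : -((k * q + s : ℕ) : ℤ) + s = -((k * q : ℕ) : ℤ) := by push_cast; ring
    rw [e1, add_comm s] at h3
    have h4 := hblocks k 0 (-((k * q : ℕ) : ℤ))
    have h5 := hgbd (-((k * q : ℕ) : ℤ) + (k * q : ℕ)) 0 hq
    have h6 := hgbd (-((k * q + s : ℕ) : ℤ)) s hs
    have h7 : ∑ j ∈ Finset.range k, g (-((k * q : ℕ) : ℤ) + (j * q : ℕ)) q =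
        ∑ i ∈ Finset.range k, f (2 * q) (tailFrom ξ (2 * -(((i + 1) * q : ℕ) : ℤ)) ω) := by
      rw [← Finset.sum_range_reflect]
      refine Finset.sum_congr rfl fun j hj => ?_
      have hj' := Finset.mem_range.1 hj
      have e2 : k - 1 - j = k - (j + 1) := by omega
      have e3 : -((k * q : ℕ) : ℤ) + (((k - (j + 1)) * q : ℕ) : ℤ) = -(((j + 1) * q : ℕ) : ℤ) := by
        rw [Nat.cast_mul, Nat.cast_mul, Nat.cast_mul, Nat.cast_sub (by omega)]
        ring
      rw [e2, e3]
    rw [h7] at h4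
    rw [add_zero] at h4
    linarith
  have hK' : ∀ᶠ M : ℕ in atTop, K + |(μ + K) / q + ε / 2| ≤ M * (ε / 2) := by
    have : Tendsto (fun r : ℕ => (r : ℝ) * (ε / 2)) atTop atTop :=
      tendsto_natCast_atTop_atTop.atTop_mul_const (by positivity)
    exact this.eventually_ge_atTop _
  -- the segment consists of `2M` rows to the left and `2M + 2` rows to the right of the origin
  filter_upwards [hB, (tendsto_add_atTop_nat 1).eventually hF, hK'] with M hM1 hM2 hM3
  have h3 := hgsub (-(M : ℤ)) M (M + 1)
  have e1 : -(M : ℤ) + M = 0 := by ring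
  rw [e1] at h3
  have e2 : 2 * M + 1 = M + (M + 1) := by ring
  have e3 : f (2 * (2 * M + 1)) (tailFrom ξ (2 * -(M : ℤ)) ω) = g (-(M : ℤ)) (M + (M + 1)) := by
    simp only [hg]; rw [e2]
  rw [e3]
  have hM0 : (0 : ℝ) ≤ M := Nat.cast_nonneg M
  have h4 := abs_nonneg ((μ + K) / q + ε / 2)
  push_cast at hM2 ⊢
  nlinarith

/-- The odd numbers `2M + 1`, `M → ∞`. -/
theorem atTop_inf_odd_le_map : atTop ⊓ 𝓟 {N : ℕ | Odd N} ≤ map (fun M : ℕ => 2 * M + 1) atTop := by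
  intro s hs
  rw [mem_map, mem_atTop_sets] at hs
  obtain ⟨M₀, hM₀⟩ := hs
  rw [mem_inf_principal, mem_atTop_sets]
  refine ⟨2 * M₀ + 1, fun N hN hodd => ?_⟩
  obtain ⟨M, rfl⟩ := hodd
  exact hM₀ M (by omega)

theorem tendsto_of_tendsto_odd {α : Type*} {u : ℕ → α} {l : Filter α}
    (h : Tendsto (fun M : ℕ => u (2 * M + 1)) atTop l) : Tendsto u (atTop ⊓ 𝓟 {N : ℕ | Odd N}) l :=
  (Tendsto.mono_left (tendsto_map'_iff.2 h) atTop_inf_odd_le_map)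

/-- Almost additive functionals of the segment `[-2M, 2M + 2)` of an i.i.d. sequence satisfy a law
of large numbers. -/
theorem exists_ae_tendsto_of_almost_additive [Nonempty E] (hm : ∀ y, Measurable (ξ y))
    (hind : iIndepFun ξ P) (hid : ∀ y, IdentDistrib (ξ y) (ξ 0) P P) {f : ℕ → (ℕ → E) → ℝ}
    (hf : ∀ m, Measurable (f m)) (hloc : ∀ m v v', (∀ k < m, v k = v' k) → f m v = f m v') {K : ℝ}
    (hbd : ∀ ω i m, |f m (tailFrom ξ i ω)| ≤ K * (m + 1))
    (hadd : ∀ ω i p q, |f (2 * p + 2 * q) (tailFrom ξ (2 * i) ω) -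
      f (2 * p) (tailFrom ξ (2 * i) ω) - f (2 * q) (tailFrom ξ (2 * i + 2 * p) ω)| ≤ K) :
    ∃ g : ℝ, ∀ᵐ ω ∂P, Tendsto (fun M : ℕ => f (2 * (2 * M + 1)) (tailFrom ξ (2 * -(M : ℤ)) ω) /
      (2 * M + 1 : ℕ)) atTop (𝓝 g) := by
  have hK : 0 ≤ K := by
    obtain ⟨ω⟩ := P.nonempty_of_neZero
    have := (abs_nonneg _).trans (hbd ω 0 0)
    simpa using this
  set μ : ℕ → ℝ := fun q => ∫ ω, f (2 * q) (tailFrom ξ 0 ω) ∂P with hμ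
  set T : ℕ → Ω → ℝ := fun M ω => f (2 * (2 * M + 1)) (tailFrom ξ (2 * -(M : ℤ)) ω) /
      (2 * M + 1 : ℕ) with hT
  have key : ∀ᵐ ω ∂P, ∀ q : ℕ, ∀ ε > 0, ∀ᶠ M : ℕ in atTop,
      |T M ω - μ (q + 1) / (q + 1 : ℕ)| ≤ K / (q + 1 : ℕ) + ε := by
    rw [ae_all_iff]
    intro q
    have hup := ae_eventually_le hm hind hid hf hloc hbd (fun ω i p q => by
      have := (abs_le.1 (hadd ω i p q)).2; linarith) (Nat.succ_pos q)
    have hlo := ae_eventually_le (f := fun m v => -f m v) hm hind hid (fun m => (hf m).neg)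
      (fun m v v' h => by rw [hloc m v v' h]) (K := K)
      (fun ω i m => by rw [abs_neg]; exact hbd ω i m)
      (fun ω i p q => by have := (abs_le.1 (hadd ω i p q)).1; linarith) (Nat.succ_pos q)
    filter_upwards [hup, hlo] with ω h1 h2 ε hε
    filter_upwards [h1 ε hε, h2 ε hε] with M h3 h4
    have hM : (0 : ℝ) < (2 * M + 1 : ℕ) := by positivity
    rw [integral_neg] at h4
    rw [← div_le_iff₀' hM] at h3 h4
    rw [add_div] at h3 h4
    rw [neg_div] at h4
    rw [neg_div] at h4
    rw [abs_le]
    simp only [hT, hμ]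
    simp only [Nat.succ_eq_add_one] at h3 h4
    constructor <;> linarith
  -- the deterministic limit is found along one typical sample
  have hsmall : ∀ ε > 0, ∃ q : ℕ, K / (q + 1 : ℕ) ≤ ε := by
    intro ε hε
    obtain ⟨q, hq⟩ := exists_nat_gt (K / ε)
    refine ⟨q, ?_⟩
    rw [div_lt_iff₀ hε] at hq
    rw [div_le_iff₀ (by positivity)]
    push_cast
    nlinarith
  obtain ⟨ω₀, h₀⟩ := key.exists
  have hcauchy : CauchySeq fun M => T M ω₀ := by
    rw [Metric.cauchySeq_iff]
    intro ε hε
    obtain ⟨q, hq⟩ := hsmall (ε / 8) (by positivity)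
    obtain ⟨M₀, hM₀⟩ := eventually_atTop.1 (h₀ q (ε / 8) (by positivity))
    refine ⟨M₀, fun M hM M' hM' => ?_⟩
    have h1 := abs_le.1 (hM₀ M hM)
    have h2 := abs_le.1 (hM₀ M' hM')
    rw [Real.dist_eq, abs_lt]
    constructor <;> linarith [h1.1, h1.2, h2.1, h2.2]
  obtain ⟨g, hg⟩ := cauchySeq_tendsto_of_complete hcauchy
  refine ⟨g, ?_⟩
  filter_upwards [key] with ω hω
  rw [Metric.tendsto_atTop']
  intro ε hε
  obtain ⟨q, hq⟩ := hsmall (ε / 8) (by positivity)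
  have h2 : ∀ᶠ M in atTop, dist (T M ω₀) g < ε / 8 := hg.eventually (Metric.ball_mem_nhds _
    (by positivity))
  obtain ⟨M₀, hM₀⟩ := eventually_atTop.1 ((hω q (ε / 8) (by positivity)).and
    ((h₀ q (ε / 8) (by positivity)).and h2))
  refine ⟨M₀, fun M hM => ?_⟩
  obtain ⟨h3, h4, h5⟩ := hM₀ M hM.le
  have h3 := abs_le.1 h3
  have h4 := abs_le.1 h4
  rw [Real.dist_eq] at h5 ⊢
  have h5 := abs_lt.1 h5
  change |T M ω - g| < ε
  rw [abs_lt]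
  constructor <;> linarith [h3.1, h3.2, h4.1, h4.2, h5.1, h5.2]

end Blocks

/-! ### The limit at fixed circumference -/

section Measurability

theorem measurable_rangeProd_apply {α S R : Type*} [MeasurableSpace α] [Fintype S] [DecidableEq S]
    [Semiring R] [MeasurableSpace R] [MeasurableMul₂ R] [MeasurableAdd₂ R]
    {A : ℕ → α → Matrix S S R} (hA : ∀ i s t, Measurable fun a => A i a s t) (m : ℕ) (s t : S) :
    Measurable fun a => rangeProd (fun i => A i a) m s t := by
  induction m generalizing t with
  | zero => simp only [rangeProd_zero]; exact measurable_const
  | succ m ih =>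
    simp only [rangeProd_succ, Matrix.mul_apply]
    exact Finset.measurable_sum _ fun r _ => (ih r).mul (hA m r t)

variable {L : ℕ} [NeZero L]

theorem measurable_rowWeight_apply (b : ZMod 2) (H₁ H₂ : ℝ) (T T' : Finset (ZMod (2 * L))) :
    Measurable fun w : ℝ × ℝ => rowWeight L b H₁ H₂ w T T' := by
  simp only [rowWeight, Matrix.of_apply, hopKernel, hopWeight]
  refine Measurable.mul (Finset.measurable_prod _ fun x _ => ?_)
    (Finset.measurable_sum _ fun H _ => Finset.measurable_prod _ fun x _ => ?_)
  · split_ifs <;> fun_prop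
  · split_ifs <;> fun_prop

end Measurability

section SectorLimits

variable {L : ℕ} [NeZero L]

/-- The product of the weights of `m` consecutive rows, the first of which has even index. -/
noncomputable def rowsProd (L : ℕ) [NeZero L] (H₁ H₂ : ℝ) (m : ℕ) (v : ℕ → ℝ × ℝ) :
    Matrix (Finset (ZMod (2 * L))) (Finset (ZMod (2 * L))) ℝ :=
  rangeProd (fun i : ℕ => rowWeight L (i : ZMod 2) H₁ H₂ (v i)) m

theorem measurable_rowsProd_apply (H₁ H₂ : ℝ) (m : ℕ) (T T' : Finset (ZMod (2 * L))) :
    Measurable fun v => rowsProd L H₁ H₂ m v T T' :=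
  measurable_rangeProd_apply (A := fun (i : ℕ) (v : ℕ → ℝ × ℝ) =>
    rowWeight L (i : ZMod 2) H₁ H₂ (v i))
    (fun i s t => (measurable_rowWeight_apply _ H₁ H₂ s t).comp (measurable_pi_apply i)) m T T'

theorem rowsProd_congr (H₁ H₂ : ℝ) (m : ℕ) {v v' : ℕ → ℝ × ℝ} (h : ∀ k < m, v k = v' k) :
    rowsProd L H₁ H₂ m v = rowsProd L H₁ H₂ m v' :=
  rangeProd_congr fun i hi => by rw [h i hi]

/-- The total weight of the paths of `n` particles with free ends. -/
noncomputable def sectorSum (L : ℕ) [NeZero L] (n : ℕ) (H₁ H₂ : ℝ) (m : ℕ) (v : ℕ → ℝ × ℝ) : ℝ :=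
  entrySum (sector n (rowsProd L H₁ H₂ m v))

theorem measurable_sectorSum (n : ℕ) (H₁ H₂ : ℝ) (m : ℕ) : Measurable (sectorSum L n H₁ H₂ m) :=
  Finset.measurable_sum _ fun _ _ => Finset.measurable_sum _ fun _ _ =>
    measurable_rowsProd_apply H₁ H₂ m _ _

/-- The logarithms of the weights of a sector are almost additive along the rows. An even number of
rows is split off, so that the remaining rows start again at an even index. -/
theorem exists_sector_log_bounds (hL : 2 ≤ L) (H₁ H₂ : ℝ) {c C : ℝ} (hc : 0 < c) {n : ℕ}
    (hn : n ≤ 2 * L) : ∃ K : ℝ, 0 < K ∧ ∀ v : ℕ → ℝ × ℝ, (∀ i, InBox c C (v i)) → ∀ p q : ℕ,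
      |Real.log (sectorSum L n H₁ H₂ (2 * p + 2 * q) v) -
        Real.log (sectorSum L n H₁ H₂ (2 * p) v) -
        Real.log (sectorSum L n H₁ H₂ (2 * q) fun k => v (2 * p + k))| ≤ K ∧
      |Real.log (sectorSum L n H₁ H₂ p v)| ≤ K * (p + 1) ∧
      0 < sectorSum L n H₁ H₂ p v ∧
      sectorSum L n H₁ H₂ p v ≤ Real.exp K * (sector n (rowsProd L H₁ H₂ p v)).trace := by
  have hne : Nonempty (Set.powersetCard (ZMod (2 * L)) n) := by
    obtain ⟨s, -, hs⟩ := Finset.exists_subset_card_eq (s := (Finset.univ : Finset (ZMod (2 * L))))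
      (n := n) (by rw [Finset.card_univ, ZMod.card]; exact hn)
    exact ⟨⟨s, hs⟩⟩
  obtain ⟨c', C', ε, r, hc', hε, hmix⟩ := exists_mixing_sector hL H₁ H₂ (C := C) hc n
  obtain ⟨K, hK, h⟩ := Mixing.exists_log_bounds
    (ι := Set.powersetCard (ZMod (2 * L)) n) (C := C') hc' hε r
  refine ⟨K, hK, fun v hv p q => ?_⟩
  have e : ∀ v : ℕ → ℝ × ℝ, ∀ m, sector n (rowsProd L H₁ H₂ m v) =
      rangeProd (fun i : ℕ => sector n (rowWeight L (i : ZMod 2) H₁ H₂ (v i))) m := fun v m =>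
    sector_rangeProd n (fun i => cardPreserving_rowWeight _ _ _ _) m
  simp only [sectorSum, e]
  obtain ⟨-, h2, h3, h4, h5⟩ := h _ (hmix v hv) p q
  obtain ⟨h1, -⟩ := h _ (hmix v hv) (2 * p) (2 * q)
  refine ⟨?_, h2, h4, ?_⟩
  · have hpar : ∀ k : ℕ, ((2 * p + k : ℕ) : ZMod 2) = k := by
      intro k
      have h2 : (2 : ZMod 2) = 0 := by decide
      push_cast
      rw [h2]
      ring
    simp only [hpar] at h1
    exact h1
  · rw [← Real.log_le_log_iff h4 (mul_pos (Real.exp_pos _) h3),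
      Real.log_mul (Real.exp_pos _).ne' h3.ne', Real.log_exp]
    linarith

/-- The total weight of the paths with free ends. -/
noncomputable def rowsSum (L : ℕ) [NeZero L] (H₁ H₂ : ℝ) (m : ℕ) (v : ℕ → ℝ × ℝ) : ℝ :=
  ∑ n ∈ Finset.range (2 * L + 1), sectorSum L n H₁ H₂ m v

theorem measurable_rowsSum (H₁ H₂ : ℝ) (m : ℕ) : Measurable (rowsSum L H₁ H₂ m) :=
  Finset.measurable_sum _ fun _ _ => measurable_sectorSum _ _ _ _

/-- Free and periodic ends are equivalent up to a constant factor. -/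
theorem exists_log_rowsSum_bounds (hL : 2 ≤ L) (H₁ H₂ : ℝ) {c C : ℝ} (hc : 0 < c) :
    ∃ K : ℝ, 0 < K ∧ ∀ v : ℕ → ℝ × ℝ, (∀ i, InBox c C (v i)) → ∀ p : ℕ,
      |Real.log (rowsSum L H₁ H₂ p v)| ≤ K * (p + 1) ∧
      |Real.log (rowsProd L H₁ H₂ p v).trace| ≤ K * (p + 1) ∧
      |Real.log (rowsProd L H₁ H₂ p v).trace - Real.log (rowsSum L H₁ H₂ p v)| ≤ K ∧
      0 < (rowsProd L H₁ H₂ p v).trace ∧ 0 < rowsSum L H₁ H₂ p v := by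
  have hex : ∀ n ∈ Finset.range (2 * L + 1), _ := fun n hn =>
    exists_sector_log_bounds hL H₁ H₂ (C := C) hc (Nat.lt_succ_iff.1 (Finset.mem_range.1 hn))
  choose! k hk0 hk using hex
  set K := ∑ n ∈ Finset.range (2 * L + 1), k n with hK
  have hkK : ∀ n ∈ Finset.range (2 * L + 1), k n ≤ K := fun n hn =>
    Finset.single_le_sum (fun n hn => (hk0 n hn).le) hn
  have h0 : (0 : ℕ) ∈ Finset.range (2 * L + 1) := by simp
  have hK0 : 0 < K := (hk0 0 h0).trans_le (hkK 0 h0)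
  set l := Real.log (2 * L + 1) with hl
  have hl0 : 0 ≤ l := Real.log_nonneg (by have : (0 : ℝ) ≤ L := Nat.cast_nonneg L; linarith)
  refine ⟨2 * K + l, by linarith, fun v hv p => ?_⟩
  have hp : (1 : ℝ) ≤ p + 1 := by have : (0 : ℝ) ≤ p := Nat.cast_nonneg p; linarith
  have hS0 : ∀ n ∈ Finset.range (2 * L + 1), 0 < sectorSum L n H₁ H₂ p v := fun n hn =>
    (hk n hn v hv p 0).2.2.1
  have hsum0 : 0 < rowsSum L H₁ H₂ p v := Finset.sum_pos hS0 ⟨0, h0⟩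
  have hup : Real.log (rowsSum L H₁ H₂ p v) ≤ l + K * (p + 1) := by
    have : rowsSum L H₁ H₂ p v ≤ (2 * L + 1) * Real.exp (K * (p + 1)) := by
      refine (Finset.sum_le_card_nsmul _ _ (Real.exp (K * (p + 1))) fun n hn => ?_).trans ?_
      · rw [← Real.log_le_iff_le_exp (hS0 n hn)]
        refine (le_abs_self _).trans ((hk n hn v hv p 0).2.1.trans ?_)
        have := hkK n hn
        gcongr
      · rw [Finset.card_range, nsmul_eq_mul]
        push_cast
        rfl
    refine (Real.log_le_log hsum0 this).trans ?_
    rw [Real.log_mul (by positivity) (Real.exp_pos _).ne', Real.log_exp]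
  have hlo : -(K * (p + 1)) ≤ Real.log (rowsSum L H₁ H₂ p v) := by
    have h1 : sectorSum L 0 H₁ H₂ p v ≤ rowsSum L H₁ H₂ p v :=
      Finset.single_le_sum (f := fun n => sectorSum L n H₁ H₂ p v) (fun n hn => (hS0 n hn).le) h0
    refine le_trans ?_ (Real.log_le_log (hS0 0 h0) h1)
    have h2 := (abs_le.1 (hk 0 h0 v hv p 0).2.1).1
    have h3 : k 0 * (p + 1) ≤ K * (p + 1) := by have := hkK 0 h0; gcongr
    linarith
  have hnn : ∀ T T', 0 ≤ rowsProd L H₁ H₂ p v T T' := rangeProd_apply_nonneg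
    (fun i => rowWeight_nonneg (hc.le.trans (hv i).1.1) (hc.le.trans (hv i).2.1)) p
  have htr := trace_eq_sum_sector (rowsProd L H₁ H₂ p v)
  rw [ZMod.card] at htr
  have hle : (rowsProd L H₁ H₂ p v).trace ≤ rowsSum L H₁ H₂ p v := by
    rw [htr]
    exact Finset.sum_le_sum fun n _ => trace_le_entrySum fun s t => hnn _ _
  have hge : rowsSum L H₁ H₂ p v ≤ Real.exp K * (rowsProd L H₁ H₂ p v).trace := by
    rw [htr, Finset.mul_sum]
    refine Finset.sum_le_sum fun n hn => ((hk n hn v hv p 0).2.2.2).trans ?_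
    have h1 : 0 ≤ (sector n (rowsProd L H₁ H₂ p v)).trace :=
      Finset.sum_nonneg fun s _ => hnn _ _
    have h2 : Real.exp (k n) ≤ Real.exp K := Real.exp_le_exp.2 (hkK n hn)
    gcongr
  have htr0 : 0 < (rowsProd L H₁ H₂ p v).trace := by
    by_contra hneg
    have := mul_nonpos_of_nonneg_of_nonpos (Real.exp_pos K).le (not_lt.1 hneg)
    linarith
  have hd : |Real.log (rowsProd L H₁ H₂ p v).trace - Real.log (rowsSum L H₁ H₂ p v)| ≤ K := by
    have h1 := Real.log_le_log htr0 hle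
    have h2 := Real.log_le_log hsum0 hge
    rw [Real.log_mul (Real.exp_pos _).ne' htr0.ne', Real.log_exp] at h2
    rw [abs_le]
    constructor <;> linarith
  have hd' := abs_le.1 hd
  refine ⟨?_, ?_, by linarith, htr0, hsum0⟩
  · rw [abs_le]
    constructor <;> nlinarith
  · rw [abs_le]
    constructor <;> nlinarith

end SectorLimits

section InnerLimit

variable {L : ℕ} [NeZero L] {Ω : Type*} [MeasurableSpace Ω] {P : Measure Ω}
  [IsProbabilityMeasure P] {ξ : ℤ → Ω → ℝ × ℝ}

theorem tendsto_log_div_of_abs_sub_le {u v : ℕ → ℝ} {K g : ℝ} (h : ∀ M, |u M - v M| ≤ K)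
    (hv : Tendsto (fun M : ℕ => v M / (2 * M + 1 : ℕ)) atTop (𝓝 g)) :
    Tendsto (fun M : ℕ => u M / (2 * M + 1 : ℕ)) atTop (𝓝 g) := by
  have h1 : Tendsto (fun M : ℕ => K / ((2 * M + 1 : ℕ) : ℝ)) atTop (𝓝 0) := by
    have : Tendsto (fun M : ℕ => 2 * M + 1) atTop atTop :=
      tendsto_atTop_mono (fun M => by simp only [id]; omega) tendsto_id
    exact (tendsto_const_div_atTop_nhds_zero_nat K).comp this
  have h2 : Tendsto (fun M : ℕ => u M / (2 * M + 1 : ℕ) - v M / (2 * M + 1 : ℕ)) atTop (𝓝 0) := by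
    refine squeeze_zero_norm (fun M => ?_) h1
    rw [← sub_div, norm_div, Real.norm_eq_abs, Real.norm_of_nonneg (by positivity)]
    gcongr
    exact h M
  simpa using h2.add hv

/-- For fixed `L`, the free energy has an almost sure and deterministic limit. It is the maximum of
the free energies of the sectors. -/
theorem exists_ae_tendsto_log_rowsSum (hL : 2 ≤ L) (H₁ H₂ : ℝ) {c C : ℝ} (hc : 0 < c)
    (hm : ∀ y, Measurable (ξ y)) (hind : iIndepFun ξ P)
    (hid : ∀ y, IdentDistrib (ξ y) (ξ 0) P P) (hbox : ∀ y ω, InBox c C (ξ y ω)) :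
    ∃ G : ℝ, ∀ᵐ ω ∂P, Tendsto (fun M : ℕ =>
      Real.log (rowsSum L H₁ H₂ (2 * (2 * M + 1)) (tailFrom ξ (2 * -(M : ℤ)) ω)) /
        (2 * M + 1 : ℕ)) atTop (𝓝 G) := by
  have hv : ∀ i ω k, InBox c C (tailFrom ξ i ω k) := fun i ω k => hbox _ _
  have hex : ∀ n ∈ Finset.range (2 * L + 1), ∃ g : ℝ, ∀ᵐ ω ∂P, Tendsto (fun M : ℕ =>
      Real.log (sectorSum L n H₁ H₂ (2 * (2 * M + 1)) (tailFrom ξ (2 * -(M : ℤ)) ω)) /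
        (2 * M + 1 : ℕ)) atTop (𝓝 g) := by
    intro n hn
    obtain ⟨K, hK, h⟩ := exists_sector_log_bounds hL H₁ H₂ (C := C) hc
      (Nat.lt_succ_iff.1 (Finset.mem_range.1 hn))
    refine exists_ae_tendsto_of_almost_additive (f := fun m v =>
      Real.log (sectorSum L n H₁ H₂ m v)) (K := K) hm hind hid
      (fun m => (measurable_sectorSum n H₁ H₂ m).log) ?_ ?_ ?_
    · intro m v v' hvv
      simp only [sectorSum, rowsProd_congr H₁ H₂ m hvv]
    · exact fun ω i m => (h _ (hv i ω) m 0).2.1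
    · intro ω i p q
      have h1 := (h _ (hv (2 * i) ω) p q).1
      have e : (fun k => tailFrom ξ (2 * i) ω (2 * p + k)) = tailFrom ξ (2 * i + 2 * p) ω := by
        funext k
        simp only [tailFrom]
        push_cast
        rw [add_assoc]
      rw [e] at h1
      exact h1
  choose! g hg using hex
  have hne : (Finset.range (2 * L + 1)).Nonempty := ⟨0, by simp⟩
  refine ⟨(Finset.range (2 * L + 1)).sup' hne g, ?_⟩
  have hall : ∀ᵐ ω ∂P, ∀ n ∈ Finset.range (2 * L + 1), Tendsto (fun M : ℕ =>
      Real.log (sectorSum L n H₁ H₂ (2 * (2 * M + 1)) (tailFrom ξ (2 * -(M : ℤ)) ω)) /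
        (2 * M + 1 : ℕ)) atTop (𝓝 (g n)) := by
    exact (ae_ball_iff (Finset.countable_toSet (Finset.range (2 * L + 1)))).2 hg
  filter_upwards [hall] with ω hω
  have hmax := Filter.Tendsto.finset_sup'_nhds hne hω
  have hS0 : ∀ M : ℕ, ∀ n ∈ Finset.range (2 * L + 1),
      0 < sectorSum L n H₁ H₂ (2 * (2 * M + 1)) (tailFrom ξ (2 * -(M : ℤ)) ω) := by
    intro M n hn
    obtain ⟨K, hK, h⟩ := exists_sector_log_bounds hL H₁ H₂ (C := C) hc
      (Nat.lt_succ_iff.1 (Finset.mem_range.1 hn))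
    exact (h _ (hv _ ω) _ 0).2.2.1
  refine tendsto_log_div_of_abs_sub_le (K := Real.log (2 * L + 1)) (v := fun M : ℕ =>
    (2 * M + 1 : ℕ) * (Finset.range (2 * L + 1)).sup' hne fun n =>
      Real.log (sectorSum L n H₁ H₂ (2 * (2 * M + 1)) (tailFrom ξ (2 * -(M : ℤ)) ω)) /
        (2 * M + 1 : ℕ)) ?_ ?_
  · intro M
    have hM : (0 : ℝ) < (2 * M + 1 : ℕ) := by positivity
    have hl : 0 ≤ Real.log (2 * L + 1) :=
      Real.log_nonneg (by have : (0 : ℝ) ≤ L := Nat.cast_nonneg L; linarith)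
    set S := fun n => sectorSum L n H₁ H₂ (2 * (2 * M + 1)) (tailFrom ξ (2 * -(M : ℤ)) ω) with hS
    have hS0 := hS0 M
    have hsum0 : 0 < rowsSum L H₁ H₂ (2 * (2 * M + 1)) (tailFrom ξ (2 * -(M : ℤ)) ω) :=
      Finset.sum_pos hS0 hne
    obtain ⟨n, hn, hmaxn⟩ := Finset.exists_mem_eq_sup' hne fun n =>
      Real.log (S n) / (2 * M + 1 : ℕ)
    have hle : ∀ n' ∈ Finset.range (2 * L + 1), Real.log (S n') ≤ Real.log (S n) := by
      intro n' hn'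
      have := Finset.le_sup' (fun n => Real.log (S n) / (2 * M + 1 : ℕ)) hn'
      rw [hmaxn] at this
      exact (div_le_div_iff_of_pos_right hM).1 this
    change |_ - (2 * M + 1 : ℕ) * (Finset.range (2 * L + 1)).sup' hne fun n =>
      Real.log (S n) / (2 * M + 1 : ℕ)| ≤ _
    rw [hmaxn, mul_div_cancel₀ _ hM.ne']
    have h1 : Real.log (S n) ≤
        Real.log (rowsSum L H₁ H₂ (2 * (2 * M + 1)) (tailFrom ξ (2 * -(M : ℤ)) ω)) :=
      Real.log_le_log (hS0 n hn) (Finset.single_le_sum (f := S) (fun n hn => (hS0 n hn).le) hn)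
    have h2 : Real.log (rowsSum L H₁ H₂ (2 * (2 * M + 1)) (tailFrom ξ (2 * -(M : ℤ)) ω)) ≤
        Real.log (2 * L + 1) + Real.log (S n) := by
      rw [← Real.log_mul (by positivity) (hS0 n hn).ne']
      refine Real.log_le_log hsum0 ((Finset.sum_le_card_nsmul _ _ (S n) fun n' hn' => ?_).trans ?_)
      · exact (Real.log_le_log_iff (hS0 n' hn') (hS0 n hn)).1 (hle n' hn')
      · rw [Finset.card_range, nsmul_eq_mul]
        push_cast
        rfl
    rw [abs_le]
    constructor <;> linarith
  · refine hmax.congr fun M => ?_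
    have hM : ((2 * M + 1 : ℕ) : ℝ) ≠ 0 := by positivity
    rw [mul_div_cancel_left₀ _ hM, Finset.sup'_apply]

end InnerLimit

/-! ### The Lyapunov exponent -/

section NormProducts

attribute [local instance] Matrix.linftyOpNormedAddCommGroup

theorem norm_fin_two_eq (A : Matrix (Fin 2) (Fin 2) ℂ) :
    ‖A‖ = max (‖A 0 0‖ + ‖A 0 1‖) (‖A 1 0‖ + ‖A 1 1‖) := by
  apply le_antisymm
  · refine norm_le_of_entries fun i => ?_
    fin_cases i
    · exact le_max_left _ _
    · exact le_max_right _ _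
  · rw [Matrix.linfty_opNorm_def]
    have h : ∀ i, ‖A i 0‖ + ‖A i 1‖ ≤
        ((Finset.univ.sup fun i => ∑ j, ‖A i j‖₊ : NNReal) : ℝ) := by
      intro i
      have := Finset.le_sup (f := fun i => ∑ j, ‖A i j‖₊) (Finset.mem_univ i)
      rw [← NNReal.coe_le_coe, NNReal.coe_sum] at this
      simpa [Fin.sum_univ_two] using this
    exact max_le (h 0) (h 1)

theorem blockProd_succ (θ H₂ : ℝ) (v : ℕ → ℝ × ℝ) (m : ℕ) :
    blockProd θ H₂ v (m + 1) = blockProd θ H₂ v m * transferMatrix θ H₂ (v m).1 (v m).2 :=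
  rangeProd_succ _ _

theorem blockProd_add (θ H₂ : ℝ) (v : ℕ → ℝ × ℝ) (p q : ℕ) :
    blockProd θ H₂ v (p + q) = blockProd θ H₂ v p * blockProd θ H₂ (fun k => v (p + k)) q :=
  rangeProd_add _ _ _

theorem blockProd_congr (θ H₂ : ℝ) (m : ℕ) {v v' : ℕ → ℝ × ℝ} (h : ∀ k < m, v k = v' k) :
    blockProd θ H₂ v m = blockProd θ H₂ v' m :=
  rangeProd_congr fun i hi => by rw [h i hi]

theorem gProd_congr (H₁ : ℝ) (m : ℕ) {v v' : ℕ → ℝ × ℝ} (h : ∀ k < m, v k = v' k) :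
    gProd H₁ v m = gProd H₁ v' m :=
  rangeProd_congr fun i hi => by rw [h i hi]

theorem norm_blockProd_pos (θ H₂ : ℝ) {v : ℕ → ℝ × ℝ} (hv : ∀ i, 0 < (v i).2) (m : ℕ) :
    0 < ‖blockProd θ H₂ v m‖ := by
  rw [norm_pos_iff]
  intro h
  apply det_blockProd_ne_zero θ H₂ hv m
  rw [h]
  simp

/-- The logarithms of the norms are subadditive. -/
theorem log_norm_blockProd_add_le (θ H₂ : ℝ) {v : ℕ → ℝ × ℝ} (hv : ∀ i, 0 < (v i).2) (p q : ℕ) :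
    Real.log ‖blockProd θ H₂ v (p + q)‖ ≤
      Real.log ‖blockProd θ H₂ v p‖ + Real.log ‖blockProd θ H₂ (fun k => v (p + k)) q‖ := by
  have h1 := norm_blockProd_pos θ H₂ hv p
  have h2 := norm_blockProd_pos θ H₂ (v := fun k => v (p + k)) (fun i => hv _) q
  rw [← Real.log_mul h1.ne' h2.ne']
  refine Real.log_le_log (norm_blockProd_pos θ H₂ hv _) ?_
  rw [blockProd_add]
  exact Matrix.linfty_opNorm_mul _ _

theorem log_gProd (H₁ : ℝ) {v : ℕ → ℝ × ℝ} (hv : ∀ i, 0 < (v i).2) (m : ℕ) :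
    Real.log (gProd H₁ v m) = ∑ i ∈ Finset.range m, Real.log (v i).2 - m * H₁ := by
  induction m with
  | zero => simp [gProd]
  | succ m ih =>
    rw [gProd_succ, Real.log_mul (gProd_pos H₁ hv m).ne' (by have := hv m; positivity), ih,
      Real.log_mul (hv m).ne' (Real.exp_pos _).ne', Real.log_exp, Finset.sum_range_succ]
    push_cast
    ring

/-- The determinant bounds the norm from below. -/
theorem sum_log_le_log_norm_blockProd (θ H₂ : ℝ) {v : ℕ → ℝ × ℝ} (hv : ∀ i, 0 < (v i).2) (m : ℕ) :
    ∑ i ∈ Finset.range m, Real.log (v i).2 - Real.log 2 / 2 ≤ Real.log ‖blockProd θ H₂ v m‖ := by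
  have h1 := norm_det_le (blockProd θ H₂ v m)
  rw [norm_det_blockProd θ 0, neg_zero] at h1
  have h2 := gProd_pos 0 hv m
  have h3 := norm_blockProd_pos θ H₂ hv m
  have h4 := Real.log_le_log (mul_pos h2 h2) h1
  rw [Real.log_mul h2.ne' h2.ne', Real.log_mul two_ne_zero (pow_pos h3 2).ne', Real.log_pow,
    log_gProd 0 hv] at h4
  push_cast at h4
  linarith

theorem norm_sin_le (θ H₂ : ℝ) :
    ‖Complex.sin ((θ : ℂ) + Complex.I * (H₂ : ℂ))‖ ≤ Real.exp |H₂| := by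
  rw [Complex.sin, norm_div, norm_mul, Complex.norm_I, mul_one, Complex.norm_ofNat,
    div_le_iff₀ (by norm_num)]
  refine (norm_sub_le _ _).trans ?_
  rw [Complex.norm_exp, Complex.norm_exp]
  have h1 : (-((θ : ℂ) + Complex.I * (H₂ : ℂ)) * Complex.I).re = H₂ := by simp
  have h2 : (((θ : ℂ) + Complex.I * (H₂ : ℂ)) * Complex.I).re = -H₂ := by simp
  rw [h1, h2]
  have h3 := Real.exp_le_exp.2 (le_abs_self H₂)
  have h4 := Real.exp_le_exp.2 (neg_le_abs H₂)
  linarith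

/-- Uniform bounds for the logarithms of the norms in a bounded environment. -/
theorem exists_log_norm_blockProd_bound (H₂ : ℝ) {c C : ℝ} (hc : 0 < c) :
    ∃ K : ℝ, 0 < K ∧ ∀ v : ℕ → ℝ × ℝ, (∀ i, InBox c C (v i)) → ∀ (θ : ℝ) (m : ℕ),
      |Real.log ‖blockProd θ H₂ v m‖| ≤ K * (m + 1) := by
  set D : ℝ := max (2 * C * Real.exp |H₂| + C ^ 2) 1 with hD
  have hD1 : 1 ≤ D := le_max_right _ _
  have hl : 0 ≤ Real.log D := Real.log_nonneg hD1
  have hl2 : 0 < Real.log 2 := Real.log_pos (by norm_num)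
  set K := Real.log D + |Real.log c| + Real.log 2 with hK
  have hK0 : 0 < K := by positivity
  refine ⟨K, hK0, fun v hv θ m => ?_⟩
  have hv2 : ∀ i, 0 < (v i).2 := fun i => hc.trans_le (hv i).2.1
  have hM : ∀ i, ‖transferMatrix θ H₂ (v i).1 (v i).2‖ ≤ D := by
    intro i
    have hv1 : 0 < (v i).1 := hc.trans_le (hv i).1.1
    rw [norm_fin_two_eq]
    refine max_le_max ?_ ?_
    · simp only [transferMatrix, Matrix.of_apply, Matrix.cons_val', Matrix.cons_val_zero,
        Matrix.cons_val_one, Matrix.cons_val_fin_one, norm_mul, norm_pow, Complex.norm_real,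
        Complex.norm_ofNat, Real.norm_of_nonneg hv1.le, Real.norm_of_nonneg (hv2 i).le]
      have h1 := norm_sin_le θ H₂
      have h2 := (hv i).1.2
      have h3 := (hv i).2.2
      have h4 := hv2 i
      have h5 : 0 ≤ 2 * C := by linarith
      gcongr
    · simp [transferMatrix]
  have hup : Real.log ‖blockProd θ H₂ v m‖ ≤ m * Real.log D := by
    rw [← Real.log_pow]
    refine Real.log_le_log (norm_blockProd_pos θ H₂ hv2 m) ?_
    induction m with
    | zero =>
      rw [norm_fin_two_eq]
      simp [blockProd]
    | succ m ih =>
      rw [blockProd_succ, pow_succ]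
      exact (Matrix.linfty_opNorm_mul _ _).trans
        (mul_le_mul ih (hM m) (norm_nonneg _) (by positivity))
  have hlo := sum_log_le_log_norm_blockProd θ H₂ hv2 m
  have hsum : -(m * |Real.log c|) ≤ ∑ i ∈ Finset.range m, Real.log (v i).2 := by
    have h1 : ∀ i ∈ Finset.range m, -|Real.log c| ≤ Real.log (v i).2 := fun i _ =>
      (neg_abs_le _).trans (Real.log_le_log hc (hv i).2.1)
    have h2 := Finset.card_nsmul_le_sum _ _ _ h1
    rw [Finset.card_range, nsmul_eq_mul] at h2
    linarith
  have hm0 : (0 : ℝ) ≤ m := Nat.cast_nonneg m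
  have := abs_nonneg (Real.log c)
  rw [abs_le]
  constructor <;> nlinarith

theorem measurable_transferMatrix_apply (θ H₂ : ℝ) (i j : Fin 2) :
    Measurable fun w : ℝ × ℝ => transferMatrix θ H₂ w.1 w.2 i j := by
  fin_cases i <;> fin_cases j <;> simp [transferMatrix] <;> fun_prop

theorem measurable_norm_blockProd (θ H₂ : ℝ) (m : ℕ) :
    Measurable fun v => ‖blockProd θ H₂ v m‖ := by
  have h : ∀ i j, Measurable fun v => blockProd θ H₂ v m i j := fun i j =>
    measurable_rangeProd_apply (A := fun (i : ℕ) (v : ℕ → ℝ × ℝ) =>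
      transferMatrix θ H₂ (v i).1 (v i).2)
      (fun k i j => (measurable_transferMatrix_apply θ H₂ i j).comp (measurable_pi_apply k)) m i j
  simp only [norm_fin_two_eq]
  exact (((h 0 0).norm.add (h 0 1).norm).max ((h 1 0).norm.add (h 1 1).norm))

theorem continuous_norm_blockProd (H₂ : ℝ) (v : ℕ → ℝ × ℝ) (m : ℕ) :
    Continuous fun θ => ‖blockProd θ H₂ v m‖ := by
  have h : ∀ i j, Continuous fun θ => blockProd θ H₂ v m i j := by
    induction m with
    | zero => intro i j; simp only [blockProd, rangeProd_zero]; exact continuous_const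
    | succ m ih =>
      intro i j
      simp only [blockProd_succ, Matrix.mul_apply]
      refine continuous_finsetSum _ fun k _ => (ih i k).mul ?_
      fin_cases k <;> fin_cases j <;> simp [transferMatrix] <;> fun_prop
  simp only [norm_fin_two_eq]
  exact (((h 0 0).norm.add (h 0 1).norm).max ((h 1 0).norm.add (h 1 1).norm))

/-- Complex conjugation of the matrices is the reflection `θ ↦ π - θ`. -/
theorem norm_blockProd_pi_sub (θ H₂ : ℝ) (v : ℕ → ℝ × ℝ) (m : ℕ) :
    ‖blockProd (Real.pi - θ) H₂ v m‖ = ‖blockProd θ H₂ v m‖ := by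
  have h : ∀ i j, blockProd (Real.pi - θ) H₂ v m i j =
      (starRingEnd ℂ) (blockProd θ H₂ v m i j) := by
    induction m with
    | zero =>
      intro i j
      simp only [blockProd, rangeProd_zero, Matrix.one_apply]
      split_ifs <;> simp
    | succ m ih =>
      intro i j
      simp only [blockProd_succ, Matrix.mul_apply, map_sum, map_mul, ih]
      refine Finset.sum_congr rfl fun k _ => ?_
      congr 1
      have hs : Complex.sin ((Real.pi : ℂ) - θ + Complex.I * (H₂ : ℂ)) =
          (starRingEnd ℂ) (Complex.sin ((θ : ℂ) + Complex.I * (H₂ : ℂ))) := by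
        rw [← Complex.sin_conj, ← Complex.sin_pi_sub]
        congr 1
        simp only [map_add, map_mul, Complex.conj_I, Complex.conj_ofReal]
        ring
      have h2 : (starRingEnd ℂ) 2 = 2 := Complex.conj_ofNat 2
      fin_cases k <;> fin_cases j <;> simp [transferMatrix, hs, h2]
  simp only [norm_fin_two_eq, h, RCLike.norm_conj]

end NormProducts

section LyapunovExponent

attribute [local instance] Matrix.linftyOpNormedAddCommGroup

variable {Ω : Type*} {ξ : ℤ → Ω → ℝ × ℝ}

theorem logNormProd_eq (θ H₂ : ℝ) (m : ℕ) :
    logNormProd (randomTransferMatrix (fun y ω => (ξ y ω).1) (fun y ω => (ξ y ω).2) θ H₂) m =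
      fun ω => Real.log ‖blockProd θ H₂ (tailFrom ξ 0 ω) m‖ := by
  funext ω
  simp only [logNormProd, blockProd, rangeProd, tailFrom, randomTransferMatrix, zero_add]

variable [MeasurableSpace Ω] {P : Measure Ω}

/-- The expectation of the logarithm of the norm of the product of `m` transfer matrices. -/
noncomputable def meanLogNorm (P : Measure Ω) (ξ : ℤ → Ω → ℝ × ℝ) (H₂ : ℝ) (m : ℕ) (θ : ℝ) : ℝ :=
  ∫ ω, Real.log ‖blockProd θ H₂ (tailFrom ξ 0 ω) m‖ ∂P

theorem meanLogNorm_pi_sub (H₂ : ℝ) (m : ℕ) (θ : ℝ) :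
    meanLogNorm P ξ H₂ m (Real.pi - θ) = meanLogNorm P ξ H₂ m θ := by
  simp only [meanLogNorm, norm_blockProd_pi_sub]

/-- The sequence `ξ` of pairs of weights is i.i.d. with values in `[c, C]`, where `c > 0`, and the
logarithm of the second weight is centred. -/
structure IsEnvironment (P : Measure Ω) (ξ : ℤ → Ω → ℝ × ℝ) (c C : ℝ) : Prop where
  pos : 0 < c
  meas : ∀ y, Measurable (ξ y)
  indep : iIndepFun ξ P
  ident : ∀ y, IdentDistrib (ξ y) (ξ 0) P P
  box : ∀ y ω, InBox c C (ξ y ω)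
  log_centred : ∫ ω, Real.log (ξ 0 ω).2 ∂P = 0

variable {c C : ℝ}

theorem integral_log_norm_tailFrom (he : IsEnvironment P ξ c C) (θ H₂ : ℝ) (i : ℤ) (m : ℕ) :
    ∫ ω, Real.log ‖blockProd θ H₂ (tailFrom ξ i ω) m‖ ∂P = meanLogNorm P ξ H₂ m θ :=
  ((identDistrib_tailFrom he.meas he.indep he.ident i 0).comp
    (measurable_norm_blockProd θ H₂ m).log).integral_eq

variable [IsProbabilityMeasure P]

theorem integrable_log_norm_blockProd (he : IsEnvironment P ξ c C) (θ H₂ : ℝ) (i : ℤ) (m : ℕ) :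
    Integrable (fun ω => Real.log ‖blockProd θ H₂ (tailFrom ξ i ω) m‖) P := by
  obtain ⟨K, hK, h⟩ := exists_log_norm_blockProd_bound H₂ (C := C) he.pos
  exact Integrable.of_bound
    ((measurable_norm_blockProd θ H₂ m).comp (measurable_tailFrom he.meas i)).log.aestronglyMeasurable
    (K * (m + 1)) (ae_of_all _ fun ω => h _ (fun k => he.box _ _) θ m)

theorem continuous_meanLogNorm (he : IsEnvironment P ξ c C) (H₂ : ℝ) (m : ℕ) :
    Continuous (meanLogNorm P ξ H₂ m) := by
  obtain ⟨K, hK, h⟩ := exists_log_norm_blockProd_bound H₂ (C := C) he.pos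
  refine continuous_of_dominated (bound := fun _ => K * (m + 1)) (fun θ => ?_) (fun θ => ?_)
    (integrable_const _) ?_
  · exact (integrable_log_norm_blockProd he θ H₂ 0 m).aestronglyMeasurable
  · exact ae_of_all _ fun ω => h _ (fun k => he.box _ _) θ m
  · refine ae_of_all _ fun ω => ?_
    exact (continuous_norm_blockProd H₂ _ m).log fun θ =>
      (norm_blockProd_pos θ H₂ (fun i => he.pos.trans_le (he.box _ _).2.1) m).ne'

theorem subadditive_meanLogNorm (he : IsEnvironment P ξ c C) (θ H₂ : ℝ) :
    Subadditive fun m => meanLogNorm P ξ H₂ m θ := by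
  intro p q
  change meanLogNorm P ξ H₂ (p + q) θ ≤ meanLogNorm P ξ H₂ p θ + meanLogNorm P ξ H₂ q θ
  rw [← integral_log_norm_tailFrom he θ H₂ p q, meanLogNorm, meanLogNorm,
    ← integral_add (integrable_log_norm_blockProd he θ H₂ 0 p)
      (integrable_log_norm_blockProd he θ H₂ p q)]
  refine integral_mono (integrable_log_norm_blockProd he θ H₂ 0 _)
    ((integrable_log_norm_blockProd he θ H₂ 0 p).add
      (integrable_log_norm_blockProd he θ H₂ p q)) fun ω => ?_
  have h := log_norm_blockProd_add_le θ H₂ (v := tailFrom ξ 0 ω)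
    (fun i => he.pos.trans_le (he.box _ _).2.1) p q
  have e : (fun k => tailFrom ξ 0 ω (p + k)) = tailFrom ξ p ω := by
    funext k
    simp only [tailFrom]
    push_cast
    rw [zero_add]
  rw [e] at h
  exact h

theorem integrable_log_snd (he : IsEnvironment P ξ c C) (y : ℤ) :
    Integrable (fun ω => Real.log (ξ y ω).2) P := by
  refine Integrable.of_bound (he.meas y).snd.log.aestronglyMeasurable
    (max |Real.log c| |Real.log C|) (ae_of_all _ fun ω => ?_)
  have h := (he.box y ω).2
  exact abs_le_max_abs_abs (Real.log_le_log he.pos h.1) (Real.log_le_log (he.pos.trans_le h.1) h.2)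

theorem integral_sum_log_snd (he : IsEnvironment P ξ c C) (i : ℤ) (m : ℕ) :
    ∫ ω, ∑ k ∈ Finset.range m, Real.log (tailFrom ξ i ω k).2 ∂P = 0 := by
  rw [integral_finsetSum]
  · refine Finset.sum_eq_zero fun k _ => ?_
    rw [← he.log_centred]
    exact ((he.ident (i + k)).comp (measurable_snd.log)).integral_eq
  · exact fun k _ => integrable_log_snd he _

theorem neg_log_two_le_meanLogNorm (he : IsEnvironment P ξ c C) (θ H₂ : ℝ) (m : ℕ) :
    -(Real.log 2 / 2) ≤ meanLogNorm P ξ H₂ m θ := by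
  have hi : Integrable (fun ω => ∑ k ∈ Finset.range m, Real.log (tailFrom ξ 0 ω k).2) P :=
    integrable_finsetSum _ fun k _ => integrable_log_snd he _
  have h : ∫ ω, (∑ k ∈ Finset.range m, Real.log (tailFrom ξ 0 ω k).2 - Real.log 2 / 2) ∂P ≤
      meanLogNorm P ξ H₂ m θ :=
    integral_mono (hi.sub (integrable_const _))
      (integrable_log_norm_blockProd he θ H₂ 0 m) fun ω =>
        sum_log_le_log_norm_blockProd θ H₂ (fun i => he.pos.trans_le (he.box _ _).2.1) m
  rw [integral_sub hi (integrable_const _), integral_sum_log_snd he] at h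
  simpa using h

theorem bddBelow_meanLogNorm_div (he : IsEnvironment P ξ c C) (θ H₂ : ℝ) :
    BddBelow (Set.range fun m : ℕ => meanLogNorm P ξ H₂ m θ / m) := by
  refine ⟨-(Real.log 2 / 2), ?_⟩
  rintro _ ⟨m, rfl⟩
  have hl2 : 0 < Real.log 2 := Real.log_pos (by norm_num)
  have h := neg_log_two_le_meanLogNorm he θ H₂ m
  rcases Nat.eq_zero_or_pos m with rfl | hm0
  · simp only [Nat.cast_zero, div_zero]
    linarith
  · have hm1 : (1 : ℝ) ≤ m := by exact_mod_cast hm0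
    simp only
    rw [le_div_iff₀ (by linarith)]
    nlinarith

theorem tendsto_meanLogNorm_div (he : IsEnvironment P ξ c C) (θ H₂ : ℝ) :
    Tendsto (fun m : ℕ => meanLogNorm P ξ H₂ m θ / m) atTop
      (𝓝 (lyapunov P (fun y ω => (ξ y ω).1) (fun y ω => (ξ y ω).2) θ H₂)) := by
  have h := (subadditive_meanLogNorm he θ H₂).tendsto_lim
    (bddBelow_meanLogNorm_div he θ H₂)
  have e : lyapunov P (fun y ω => (ξ y ω).1) (fun y ω => (ξ y ω).2) θ H₂ =
      (subadditive_meanLogNorm he θ H₂).lim := by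
    refine Tendsto.limUnder_eq ?_
    refine h.congr fun m => ?_
    rw [logNormProd_eq, div_eq_inv_mul, one_div]
    rfl
  rw [e]
  exact h

/-- By subadditivity, the Lyapunov exponent is the infimum of the means per row. -/
theorem lyapunov_le_meanLogNorm_div (he : IsEnvironment P ξ c C) (θ H₂ : ℝ) {m : ℕ}
    (hm0 : m ≠ 0) : lyapunov P (fun y ω => (ξ y ω).1) (fun y ω => (ξ y ω).2) θ H₂ ≤
      meanLogNorm P ξ H₂ m θ / m := by
  have hb := bddBelow_meanLogNorm_div he θ H₂
  have h := subadditive_meanLogNorm he θ H₂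
  rw [tendsto_nhds_unique (tendsto_meanLogNorm_div he θ H₂) (h.tendsto_lim hb)]
  exact h.lim_le_div hb hm0

/-- The exponent is non-negative because the determinants of the matrices have centred logarithms.
-/
theorem lyapunov_nonneg (he : IsEnvironment P ξ c C) (θ H₂ : ℝ) :
    0 ≤ lyapunov P (fun y ω => (ξ y ω).1) (fun y ω => (ξ y ω).2) θ H₂ := by
  have h0 : Tendsto (fun m : ℕ => -(Real.log 2 / 2) / (m : ℝ)) atTop (𝓝 0) :=
    tendsto_const_div_atTop_nhds_zero_nat _
  refine le_of_tendsto_of_tendsto' h0 (tendsto_meanLogNorm_div he θ H₂)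
    fun m => ?_
  have := neg_log_two_le_meanLogNorm he θ H₂ m
  gcongr

theorem hasTopLyapunovExponent_lyapunov (he : IsEnvironment P ξ c C) (θ H₂ : ℝ) :
    HasTopLyapunovExponent P
      (randomTransferMatrix (fun y ω => (ξ y ω).1) (fun y ω => (ξ y ω).2) θ H₂)
      (lyapunov P (fun y ω => (ξ y ω).1) (fun y ω => (ξ y ω).2) θ H₂) := by
  refine ⟨fun m => ?_, ?_⟩
  · rw [logNormProd_eq]
    exact integrable_log_norm_blockProd he θ H₂ 0 m
  · refine (tendsto_meanLogNorm_div he θ H₂).congr fun m => ?_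
    rw [logNormProd_eq, div_eq_inv_mul, one_div]
    rfl

theorem lyapunov_pi_sub (he : IsEnvironment P ξ c C) (θ H₂ : ℝ) :
    lyapunov P (fun y ω => (ξ y ω).1) (fun y ω => (ξ y ω).2) (Real.pi - θ) H₂ =
      lyapunov P (fun y ω => (ξ y ω).1) (fun y ω => (ξ y ω).2) θ H₂ := by
  refine tendsto_nhds_unique (tendsto_meanLogNorm_div he (Real.pi - θ) H₂) ?_
  simp only [meanLogNorm_pi_sub]
  exact tendsto_meanLogNorm_div he θ H₂

/-- The Lyapunov exponent is a pointwise limit of continuous functions of the angle. -/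
theorem measurable_lyapunov (he : IsEnvironment P ξ c C) (H₂ : ℝ) :
    Measurable fun θ => lyapunov P (fun y ω => (ξ y ω).1) (fun y ω => (ξ y ω).2) θ H₂ :=
  measurable_of_tendsto_metrizable
    (fun m : ℕ => ((continuous_meanLogNorm he H₂ m).div_const (m : ℝ)).measurable)
    (tendsto_pi_nhds.2 fun θ => tendsto_meanLogNorm_div he θ H₂)

/-- The means per row are bounded uniformly in the angle and the length. -/
theorem exists_meanLogNorm_div_bound (he : IsEnvironment P ξ c C) (H₂ : ℝ) :
    ∃ K : ℝ, 0 < K ∧ ∀ (m : ℕ) (θ : ℝ), |meanLogNorm P ξ H₂ m θ / m| ≤ K := by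
  obtain ⟨K, hK, h⟩ := exists_log_norm_blockProd_bound H₂ (C := C) he.pos
  refine ⟨2 * K, by linarith, fun m θ => ?_⟩
  have h1 : |meanLogNorm P ξ H₂ m θ| ≤ K * (m + 1) := by
    have := norm_integral_le_of_norm_le_const (μ := P)
      (f := fun ω => Real.log ‖blockProd θ H₂ (tailFrom ξ 0 ω) m‖)
      (ae_of_all P fun ω => h (tailFrom ξ 0 ω) (fun k => he.box _ _) θ m)
    simpa [meanLogNorm] using this
  rcases Nat.eq_zero_or_pos m with rfl | hm0
  · simp [hK.le]
  · have hm1 : (1 : ℝ) ≤ m := by exact_mod_cast hm0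
    rw [abs_div, abs_of_pos (show (0 : ℝ) < m by linarith), div_le_iff₀ (by linarith)]
    nlinarith

end LyapunovExponent

/-! ### Bounds by sums over the momenta -/

section FixedCircumference

attribute [local instance] Matrix.linftyOpNormedAddCommGroup

variable {Ω : Type*}

theorem tailFrom_add (ξ : ℤ → Ω → ℝ × ℝ) (i : ℤ) (p : ℕ) (ω : Ω) :
    (fun k => tailFrom ξ (2 * i) ω (2 * p + k)) = tailFrom ξ (2 * i + 2 * p) ω := by
  funext k
  simp only [tailFrom]
  push_cast
  rw [add_assoc]

variable [MeasurableSpace Ω] {P : Measure Ω} {ξ : ℤ → Ω → ℝ × ℝ} {c C : ℝ}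

theorem IsEnvironment.snd_pos (he : IsEnvironment P ξ c C) (i : ℤ) (ω : Ω) (k : ℕ) :
    0 < (tailFrom ξ i ω k).2 := he.pos.trans_le (he.box _ _).2.1

variable [IsProbabilityMeasure P]

theorem measurable_gProd (H₁ : ℝ) (m : ℕ) : Measurable fun v => gProd H₁ v m := by
  induction m with
  | zero => simp only [gProd, rangeProd_zero]; exact measurable_const
  | succ m ih =>
    simp only [gProd_succ]
    exact ih.mul ((measurable_pi_apply m).snd.mul_const _)

theorem integrable_log_gProd (he : IsEnvironment P ξ c C) (H₁ : ℝ) (i : ℤ) (m : ℕ) :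
    Integrable (fun ω => Real.log (gProd H₁ (tailFrom ξ i ω) m)) P := by
  simp only [log_gProd H₁ (he.snd_pos i _)]
  exact (integrable_finsetSum _ fun k _ => integrable_log_snd he _).sub (integrable_const _)

theorem integral_log_gProd (he : IsEnvironment P ξ c C) (H₁ : ℝ) (i : ℤ) (m : ℕ) :
    ∫ ω, Real.log (gProd H₁ (tailFrom ξ i ω) m) ∂P = -(m * H₁) := by
  have hi : Integrable (fun ω => ∑ k ∈ Finset.range m, Real.log (tailFrom ξ i ω k).2) P :=
    integrable_finsetSum _ fun k _ => integrable_log_snd he _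
  simp only [log_gProd H₁ (he.snd_pos i _)]
  rw [integral_sub hi (integrable_const _), integral_sum_log_snd he]
  simp

/-- The logarithm of the size of a mode dominates a variable whose mean is bounded below by the
Lyapunov exponent and by `|H₁|`. -/
theorem exists_le_log_modeSize (he : IsEnvironment P ξ c C) (θ H₁ H₂ : ℝ) (i : ℤ) {m : ℕ}
    (hm : m ≠ 0) : ∃ X : Ω → ℝ, Integrable X P ∧
      (∀ ω, X ω ≤ Real.log (modeSize θ H₁ H₂ (tailFrom ξ i ω) m)) ∧
      m * max (lyapunov P (fun y ω => (ξ y ω).1) (fun y ω => (ξ y ω).2) θ H₂) |H₁| ≤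
        ∫ ω, X ω ∂P := by
  have hg := fun H ω => gProd_pos H (he.snd_pos i ω) m
  have hn := fun ω => norm_blockProd_pos θ H₂ (he.snd_pos i ω) m
  have hm0 : (0 : ℝ) < m := by exact_mod_cast Nat.pos_of_ne_zero hm
  rcases le_total |H₁| (lyapunov P (fun y ω => (ξ y ω).1) (fun y ω => (ξ y ω).2) θ H₂) with h | h
  · refine ⟨_, integrable_log_norm_blockProd he θ H₂ i m, fun ω => ?_, ?_⟩
    · refine Real.log_le_log (hn ω) ?_
      have h1 := hg H₁ ω
      have h2 := hg (-H₁) ω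
      unfold modeSize
      linarith
    · rw [max_eq_left h, integral_log_norm_tailFrom he, ← le_div_iff₀' hm0]
      exact lyapunov_le_meanLogNorm_div he θ H₂ hm
  · rw [max_eq_right h]
    rcases abs_cases H₁ with ⟨h', -⟩ | ⟨h', -⟩
    · refine ⟨_, integrable_log_gProd he (-H₁) i m, fun ω => ?_, ?_⟩
      · refine Real.log_le_log (hg _ ω) ?_
        have h1 := hg H₁ ω
        have h2 := hn ω
        unfold modeSize
        linarith
      · rw [integral_log_gProd he, h']
        linarith
    · refine ⟨_, integrable_log_gProd he H₁ i m, fun ω => ?_, ?_⟩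
      · refine Real.log_le_log (hg _ ω) ?_
        have h1 := hg (-H₁) ω
        have h2 := hn ω
        unfold modeSize
        linarith
      · rw [integral_log_gProd he, h']
        linarith

variable {L : ℕ} [NeZero L]

theorem integrable_log_rowsSum (hL : 2 ≤ L) (he : IsEnvironment P ξ c C) (H₁ H₂ : ℝ) (i : ℤ)
    (m : ℕ) : Integrable (fun ω => Real.log (rowsSum L H₁ H₂ m (tailFrom ξ i ω))) P := by
  obtain ⟨K, hK, h⟩ := exists_log_rowsSum_bounds hL H₁ H₂ (C := C) he.pos
  exact Integrable.of_bound
    ((measurable_rowsSum H₁ H₂ m).comp (measurable_tailFrom he.meas i)).log.aestronglyMeasurable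
    (K * (m + 1)) (ae_of_all _ fun ω => (h _ (fun k => he.box _ _) m).1)

/-- The mean of the logarithm of the weight with free ends is bounded below by the sum over the
momenta of the Lyapunov exponents, for every offset `κ` of the momenta. -/
theorem le_integral_log_rowsSum (hL2 : 2 ≤ L) (hL : Even L) (he : IsEnvironment P ξ c C)
    (H₁ H₂ : ℝ) : ∃ K : ℝ, ∀ (κ : ℝ) (i : ℤ) {m : ℕ}, Even m → m ≠ 0 →
      m * ∑ j : Fin L, max (lyapunov P (fun y ω => (ξ y ω).1) (fun y ω => (ξ y ω).2)
        (Real.pi * (j : ℕ) / L + κ) H₂) |H₁| ≤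
      K + ∫ ω, Real.log (rowsSum L H₁ H₂ m (tailFrom ξ i ω)) ∂P := by
  obtain ⟨K, hK, h⟩ := prod_modeSize_le hL2 hL
  refine ⟨Real.log K, fun κ i m hm hm0 => ?_⟩
  choose X hX1 hX2 hX3 using fun j : Fin L =>
    exists_le_log_modeSize he (Real.pi * (j : ℕ) / L + κ) H₁ H₂ i hm0
  obtain ⟨K', -, h'⟩ := exists_log_rowsSum_bounds hL2 H₁ H₂ (C := C) he.pos
  have h1 : ∫ ω, ∑ j, X j ω ∂P ≤
      ∫ ω, (Real.log K + Real.log (rowsSum L H₁ H₂ m (tailFrom ξ i ω))) ∂P := by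
    refine integral_mono (integrable_finsetSum _ fun j _ => hX1 j)
      ((integrable_const _).add (integrable_log_rowsSum hL2 he H₁ H₂ i m)) fun ω => ?_
    have hS := (h' _ (fun k => he.box _ _ : ∀ k, InBox c C (tailFrom ξ i ω k)) m).2.2.2.2
    have h2 : ∏ j : Fin L, modeSize (Real.pi * (j : ℕ) / L + κ) H₁ H₂ (tailFrom ξ i ω) m ≤
        K * rowsSum L H₁ H₂ m (tailFrom ξ i ω) :=
      h H₁ H₂ κ (w := tailFrom ξ i ω) (fun k => he.pos.le.trans (he.box _ _).1.1)
        (he.snd_pos i ω) hm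
    have hpos := fun j : Fin L =>
      modeSize_pos (Real.pi * (j : ℕ) / L + κ) H₁ H₂ (he.snd_pos i ω) m
    calc ∑ j, X j ω ≤ ∑ j : Fin L, Real.log (modeSize (Real.pi * (j : ℕ) / L + κ) H₁ H₂
          (tailFrom ξ i ω) m) := Finset.sum_le_sum fun j _ => hX2 j ω
      _ = Real.log (∏ j : Fin L, modeSize (Real.pi * (j : ℕ) / L + κ) H₁ H₂
          (tailFrom ξ i ω) m) := (Real.log_prod fun j _ => (hpos j).ne').symm
      _ ≤ Real.log (K * rowsSum L H₁ H₂ m (tailFrom ξ i ω)) :=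
          Real.log_le_log (Finset.prod_pos fun j _ => hpos j) h2
      _ = _ := Real.log_mul hK.ne' hS.ne'
  rw [integral_add (integrable_const _) (integrable_log_rowsSum hL2 he H₁ H₂ i m),
    integral_finsetSum _ fun j _ => hX1 j] at h1
  rw [Finset.mul_sum]
  refine (Finset.sum_le_sum fun j _ => hX3 j).trans ?_
  simpa using h1

theorem tendsto_two_mul_add_one : Tendsto (fun M : ℕ => 2 * M + 1) atTop atTop :=
  tendsto_atTop_mono (fun M => by simp only [id]; omega) tendsto_id

/-- The limit is bounded below by the Riemann sums of the Lyapunov exponent, for every choice of the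
offset. -/
theorem sum_lyapunov_le (hL2 : 2 ≤ L) (hL : Even L) (he : IsEnvironment P ξ c C)
    (H₁ H₂ : ℝ) {G : ℝ} (hG : ∀ᵐ ω ∂P, Tendsto (fun M : ℕ =>
      Real.log (rowsSum L H₁ H₂ (2 * (2 * M + 1)) (tailFrom ξ (2 * -(M : ℤ)) ω)) /
        (2 * M + 1 : ℕ)) atTop (𝓝 G)) (κ : ℝ) :
    2 * ∑ j : Fin L, max (lyapunov P (fun y ω => (ξ y ω).1) (fun y ω => (ξ y ω).2)
        (Real.pi * (j : ℕ) / L + κ) H₂) |H₁| ≤ G := by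
  obtain ⟨K, hK, h⟩ := exists_log_rowsSum_bounds hL2 H₁ H₂ (C := C) he.pos
  have h1 : Tendsto (fun M : ℕ => ∫ ω,
      Real.log (rowsSum L H₁ H₂ (2 * (2 * M + 1)) (tailFrom ξ (2 * -(M : ℤ)) ω)) /
        (2 * M + 1 : ℕ) ∂P) atTop (𝓝 (∫ _, G ∂P)) := by
    refine tendsto_integral_of_dominated_convergence (fun _ => 3 * K) (fun M => ?_)
      (integrable_const _) (fun M => ae_of_all _ fun ω => ?_) hG
    · exact ((integrable_log_rowsSum hL2 he H₁ H₂ _ _).div_const _).aestronglyMeasurable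
    · have h2 := (h _ (fun k => he.box _ _ : ∀ k, InBox c C (tailFrom ξ (2 * -(M : ℤ)) ω k))
        (2 * (2 * M + 1))).1
      have hM : (1 : ℝ) ≤ (2 * M + 1 : ℕ) := by exact_mod_cast (by omega : 1 ≤ 2 * M + 1)
      rw [norm_div, Real.norm_eq_abs, Real.norm_of_nonneg (by positivity),
        div_le_iff₀ (by linarith)]
      refine h2.trans ?_
      push_cast at hM ⊢
      nlinarith
  obtain ⟨K', hK'⟩ := le_integral_log_rowsSum hL2 hL he H₁ H₂
  set S := ∑ j : Fin L, max (lyapunov P (fun y ω => (ξ y ω).1) (fun y ω => (ξ y ω).2)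
        (Real.pi * (j : ℕ) / L + κ) H₂) |H₁| with hS
  have h2 : Tendsto (fun M : ℕ => 2 * S - K' / (2 * M + 1 : ℕ)) atTop (𝓝 (2 * S - 0)) :=
    tendsto_const_nhds.sub ((tendsto_const_div_atTop_nhds_zero_nat K').comp tendsto_two_mul_add_one)
  rw [sub_zero] at h2
  rw [integral_const, probReal_univ, one_smul] at h1
  refine le_of_tendsto_of_tendsto' h2 h1 fun M => ?_
  have hM : (0 : ℝ) < (2 * M + 1 : ℕ) := by positivity
  have h3 := hK' κ (2 * -(M : ℤ)) (m := 2 * (2 * M + 1)) (even_two_mul _) (by omega)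
  rw [integral_div, le_div_iff₀ hM, sub_mul, div_mul_cancel₀ _ hM.ne']
  push_cast at h3 ⊢
  linarith

theorem exists_log_gProd_bound (H₁ : ℝ) {c C : ℝ} (hc : 0 < c) :
    ∃ K : ℝ, 0 < K ∧ ∀ v : ℕ → ℝ × ℝ, (∀ i, InBox c C (v i)) → ∀ m : ℕ,
      |Real.log (gProd H₁ v m)| ≤ K * (m + 1) := by
  set K := max |Real.log c| |Real.log C| + |H₁| + 1 with hK
  have h0 : 0 ≤ max |Real.log c| |Real.log C| := (abs_nonneg _).trans (le_max_left _ _)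
  have hK0 : 0 < K := by positivity
  refine ⟨K, hK0, fun v hv m => ?_⟩
  have hm0 : (0 : ℝ) ≤ m := Nat.cast_nonneg m
  rw [log_gProd H₁ fun i => hc.trans_le (hv i).2.1]
  have h1 : |∑ i ∈ Finset.range m, Real.log (v i).2| ≤ m * max |Real.log c| |Real.log C| := by
    refine (Finset.abs_sum_le_sum_abs _ _).trans
      ((Finset.sum_le_card_nsmul _ _ _ fun i _ => abs_le_max_abs_abs
        (Real.log_le_log hc (hv i).2.1) (Real.log_le_log (hc.trans_le
          (hv i).2.1) (hv i).2.2)).trans ?_)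
    rw [Finset.card_range, nsmul_eq_mul]
  refine (abs_sub _ _).trans ?_
  rw [abs_mul, abs_of_nonneg hm0]
  nlinarith

theorem gProd_add (H₁ : ℝ) (v : ℕ → ℝ × ℝ) (p q : ℕ) :
    gProd H₁ v (p + q) = gProd H₁ v p * gProd H₁ (fun k => v (p + k)) q := rangeProd_add _ _ _

/-- The asymptotic size of a mode is bounded through the mean over blocks of length `2q`. -/
theorem exists_ae_eventually_log_modeSize_le (he : IsEnvironment P ξ c C) (H₁ H₂ : ℝ) :
    ∃ K : ℝ, 0 < K ∧ ∀ (θ : ℝ) {q : ℕ}, 0 < q → ∀ᵐ ω ∂P, ∀ ε > 0, ∀ᶠ M : ℕ in atTop,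
      Real.log (modeSize θ H₁ H₂ (tailFrom ξ (2 * -(M : ℤ)) ω) (2 * (2 * M + 1))) ≤
        Real.log 3 + (2 * M + 1 : ℕ) *
          (2 * max (meanLogNorm P ξ H₂ (2 * q) θ / (2 * q : ℕ)) |H₁| + K / q + ε) := by
  obtain ⟨K₀, hK₀, hb⟩ := exists_log_norm_blockProd_bound H₂ (C := C) he.pos
  obtain ⟨K₁, hK₁, hg₁⟩ := exists_log_gProd_bound H₁ (C := C) he.pos
  obtain ⟨K₂, hK₂, hg₂⟩ := exists_log_gProd_bound (-H₁) (C := C) he.pos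
  set K := K₀ + K₁ + K₂ with hK
  refine ⟨K, by positivity, fun θ q hq => ?_⟩
  have hbox : ∀ i ω k, InBox c C (tailFrom ξ i ω k) := fun i ω k => he.box _ _
  have hgen : ∀ H : ℝ, (∀ v : ℕ → ℝ × ℝ, (∀ i, InBox c C (v i)) → ∀ m : ℕ,
      |Real.log (gProd H v m)| ≤ K * (m + 1)) → ∀ᵐ ω ∂P, ∀ ε > 0, ∀ᶠ M : ℕ in atTop,
      Real.log (gProd H (tailFrom ξ (2 * -(M : ℤ)) ω) (2 * (2 * M + 1))) ≤
        (2 * M + 1 : ℕ) * ((-((2 * q : ℕ) * H) + K) / q + ε) := by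
    intro H hH
    rw [← integral_log_gProd he H 0 (2 * q)]
    refine ae_eventually_le (f := fun m v => Real.log (gProd H v m)) he.meas he.indep he.ident
      (fun m => (measurable_gProd H m).log) (fun m v v' h => ?_) (K := K)
      (fun ω i m => hH _ (hbox i ω) m) (fun ω i p r => ?_) hq
    · simp only [gProd_congr H m h]
    · have h1 := gProd_pos H (he.snd_pos (2 * i) ω) (2 * p)
      have h2 := gProd_pos H (he.snd_pos (2 * i + 2 * p) ω) (2 * r)
      rw [gProd_add, tailFrom_add, Real.log_mul h1.ne' h2.ne']
      have : 0 ≤ K := by positivity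
      linarith
  have hnorm : ∀ᵐ ω ∂P, ∀ ε > 0, ∀ᶠ M : ℕ in atTop,
      Real.log ‖blockProd θ H₂ (tailFrom ξ (2 * -(M : ℤ)) ω) (2 * (2 * M + 1))‖ ≤
        (2 * M + 1 : ℕ) * ((meanLogNorm P ξ H₂ (2 * q) θ + K) / q + ε) := by
    refine ae_eventually_le (f := fun m v => Real.log ‖blockProd θ H₂ v m‖) he.meas he.indep
      he.ident (fun m => (measurable_norm_blockProd θ H₂ m).log) (fun m v v' h => ?_) (K := K)
      (fun ω i m => (hb _ (hbox i ω) θ m).trans ?_) (fun ω i p r => ?_) hq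
    · simp only [blockProd_congr θ H₂ m h]
    · have : K₀ ≤ K := by linarith
      gcongr
    · have h1 := log_norm_blockProd_add_le θ H₂ (he.snd_pos (2 * i) ω) (2 * p) (2 * r)
      rw [tailFrom_add] at h1
      have : 0 ≤ K := by positivity
      linarith
  have h1 := hgen H₁ fun v hv m => (hg₁ v hv m).trans (by
    have : K₁ ≤ K := by linarith
    gcongr)
  have h2 := hgen (-H₁) fun v hv m => (hg₂ v hv m).trans (by
    have : K₂ ≤ K := by linarith
    gcongr)
  filter_upwards [h1, h2, hnorm] with ω h1 h2 h3 ε hε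
  filter_upwards [h1 ε hε, h2 ε hε, h3 ε hε] with M h1 h2 h3
  have hq' : (0 : ℝ) < q := by exact_mod_cast hq
  have hM : (0 : ℝ) ≤ (2 * M + 1 : ℕ) := by positivity
  set R := (2 * M + 1 : ℕ) *
          (2 * max (meanLogNorm P ξ H₂ (2 * q) θ / (2 * q : ℕ)) |H₁| + K / q + ε) with hR
  have hpos1 := gProd_pos H₁ (he.snd_pos (2 * -(M : ℤ)) ω) (2 * (2 * M + 1))
  have hpos2 := gProd_pos (-H₁) (he.snd_pos (2 * -(M : ℤ)) ω) (2 * (2 * M + 1))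
  have hpos3 := norm_blockProd_pos θ H₂ (he.snd_pos (2 * -(M : ℤ)) ω) (2 * (2 * M + 1))
  have hle : ∀ {x y : ℝ}, 0 < x → Real.log x ≤ (2 * M + 1 : ℕ) * ((y + K) / q + ε) →
      y / q ≤ 2 * max (meanLogNorm P ξ H₂ (2 * q) θ / (2 * q : ℕ)) |H₁| → x ≤ Real.exp R := by
    intro x y hx hxy hy
    rw [← Real.log_le_iff_le_exp hx, hR]
    refine hxy.trans (mul_le_mul_of_nonneg_left ?_ hM)
    rw [add_div]
    linarith
  have hH : ∀ H : ℝ, -H ≤ |H₁| → -((2 * q : ℕ) * H) / (q : ℝ) ≤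
      2 * max (meanLogNorm P ξ H₂ (2 * q) θ / (2 * q : ℕ)) |H₁| := by
    intro H h
    have e : -((2 * q : ℕ) * H) / (q : ℝ) = 2 * -H := by push_cast; field_simp
    rw [e]
    have := le_max_right (meanLogNorm P ξ H₂ (2 * q) θ / (2 * q : ℕ)) |H₁|
    linarith
  have a1 := hle hpos1 h1 (hH _ (neg_le_abs H₁))
  have a2 := hle hpos2 h2 (hH _ (by rw [neg_neg]; exact le_abs_self H₁))
  have a3 := hle hpos3 h3 (by
    have e : meanLogNorm P ξ H₂ (2 * q) θ / q =
      2 * (meanLogNorm P ξ H₂ (2 * q) θ / (2 * q : ℕ)) := by push_cast; field_simp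
    rw [e]
    have := le_max_left (meanLogNorm P ξ H₂ (2 * q) θ / (2 * q : ℕ)) |H₁|
    linarith)
  have hsum : modeSize θ H₁ H₂ (tailFrom ξ (2 * -(M : ℤ)) ω) (2 * (2 * M + 1)) ≤
      3 * Real.exp R := by
    unfold modeSize
    linarith
  refine (Real.log_le_log (modeSize_pos θ H₁ H₂ (he.snd_pos _ ω) _) hsum).trans ?_
  rw [Real.log_mul (by norm_num) (Real.exp_pos _).ne', Real.log_exp]

/-- The limit is bounded above by the Riemann sums of the means over blocks of length `2q`, for one
of two offsets, up to an error that vanishes for large `q`. -/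
theorem exists_le_sum_meanLogNorm (he : IsEnvironment P ξ c C) (H₁ H₂ : ℝ) :
    ∃ K : ℝ, 0 < K ∧ ∀ (L : ℕ) [NeZero L], 2 ≤ L → Even L → ∀ {G : ℝ}, (∀ᵐ ω ∂P,
      Tendsto (fun M : ℕ => Real.log
        (rowsSum L H₁ H₂ (2 * (2 * M + 1)) (tailFrom ξ (2 * -(M : ℤ)) ω)) /
        (2 * M + 1 : ℕ)) atTop (𝓝 G)) → ∀ {q : ℕ}, 0 < q →
      G ≤ 2 * max
        (∑ j : Fin L, max (meanLogNorm P ξ H₂ (2 * q) (Real.pi * (j : ℕ) / L + 0) / (2 * q : ℕ)) |H₁|)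
        (∑ j : Fin L, max (meanLogNorm P ξ H₂ (2 * q)
          (Real.pi * (j : ℕ) / L + Real.pi / (2 * L)) / (2 * q : ℕ)) |H₁|) + L * (K / q) := by
  obtain ⟨K, hK, h⟩ := exists_ae_eventually_log_modeSize_le he H₁ H₂
  refine ⟨K, hK, fun L _ hL2 hL G hG q hq => ?_⟩
  obtain ⟨K', hK', hS⟩ := exists_log_rowsSum_bounds hL2 H₁ H₂ (C := C) he.pos
  have hall : ∀ κ : ℝ, ∀ᵐ ω ∂P, ∀ j : Fin L, ∀ ε > 0, ∀ᶠ M : ℕ in atTop,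
      Real.log (modeSize (Real.pi * (j : ℕ) / L + κ) H₁ H₂ (tailFrom ξ (2 * -(M : ℤ)) ω)
        (2 * (2 * M + 1))) ≤ Real.log 3 + (2 * M + 1 : ℕ) *
          (2 * max (meanLogNorm P ξ H₂ (2 * q) (Real.pi * (j : ℕ) / L + κ) / (2 * q : ℕ)) |H₁| +
            K / q + ε) := fun κ => ae_all_iff.2 fun j => h _ hq
  obtain ⟨ω, hω0, hω1, hωG⟩ := ((hall 0).and ((hall (Real.pi / (2 * L))).and hG)).exists
  set S : ℝ → ℝ := fun κ => ∑ j : Fin L,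
    max (meanLogNorm P ξ H₂ (2 * q) (Real.pi * (j : ℕ) / L + κ) / (2 * q : ℕ)) |H₁| with hSdef
  have hprod : ∀ κ : ℝ, (∀ j : Fin L, ∀ ε > 0, ∀ᶠ M : ℕ in atTop,
      Real.log (modeSize (Real.pi * (j : ℕ) / L + κ) H₁ H₂ (tailFrom ξ (2 * -(M : ℤ)) ω)
        (2 * (2 * M + 1))) ≤ Real.log 3 + (2 * M + 1 : ℕ) *
          (2 * max (meanLogNorm P ξ H₂ (2 * q) (Real.pi * (j : ℕ) / L + κ) / (2 * q : ℕ)) |H₁| +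
            K / q + ε)) → ∀ ε > 0, ∀ᶠ M : ℕ in atTop,
      ∏ j : Fin L, modeSize (Real.pi * (j : ℕ) / L + κ) H₁ H₂ (tailFrom ξ (2 * -(M : ℤ)) ω)
        (2 * (2 * M + 1)) ≤ Real.exp (L * Real.log 3 + (2 * M + 1 : ℕ) *
          (2 * S κ + L * (K / q + ε))) := by
    intro κ hκ ε hε
    filter_upwards [eventually_all.2 fun j => hκ j ε hε] with M hM
    have hpos := fun j : Fin L => modeSize_pos (Real.pi * (j : ℕ) / L + κ) H₁ H₂
      (he.snd_pos (2 * -(M : ℤ)) ω) (2 * (2 * M + 1))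
    rw [← Real.log_le_iff_le_exp (Finset.prod_pos fun j _ => hpos j),
      Real.log_prod fun j _ => (hpos j).ne']
    refine (Finset.sum_le_sum fun j _ => hM j).trans (le_of_eq ?_)
    simp only [hSdef, Finset.sum_add_distrib, ← Finset.mul_sum, Finset.sum_const, Finset.card_univ,
      Fintype.card_fin, nsmul_eq_mul]
    ring
  refine le_of_forall_pos_le_add fun ε hε => ?_
  have hL0 : (0 : ℝ) < L := by exact_mod_cast NeZero.pos L
  have hεL : 0 < ε / L := by positivity
  set B := Real.log 2 + L * Real.log 2 + L * Real.log 3 + K' with hB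
  set U := 2 * max (S 0) (S (Real.pi / (2 * L))) + L * (K / q + ε / L) with hU
  have hev : ∀ᶠ M : ℕ in atTop, Real.log
        (rowsSum L H₁ H₂ (2 * (2 * M + 1)) (tailFrom ξ (2 * -(M : ℤ)) ω)) /
        (2 * M + 1 : ℕ) ≤ B / (2 * M + 1 : ℕ) + U := by
    filter_upwards [hprod 0 hω0 _ hεL, hprod _ hω1 _ hεL] with M h0 h1
    have hM : (0 : ℝ) < (2 * M + 1 : ℕ) := by positivity
    obtain ⟨-, -, h3, h4, h5⟩ := hS (tailFrom ξ (2 * -(M : ℤ)) ω) (fun k => he.box _ _)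
      (2 * (2 * M + 1))
    have h2 := trace_rowWeight_le hL2 hL H₁ H₂ (he.snd_pos (2 * -(M : ℤ)) ω)
      (even_two_mul (2 * M + 1))
    set E := Real.exp (L * Real.log 3 + (2 * M + 1 : ℕ) * U) with hE
    have hE' : ∀ κ, S κ ≤ max (S 0) (S (Real.pi / (2 * L))) →
        Real.exp (L * Real.log 3 + (2 * M + 1 : ℕ) * (2 * S κ + L * (K / q + ε / L))) ≤ E := by
      intro κ hκ
      rw [hE, Real.exp_le_exp, hU]
      have := mul_le_mul_of_nonneg_left hκ hM.le
      nlinarith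
    have h6 : (rowsProd L H₁ H₂ (2 * (2 * M + 1)) (tailFrom ξ (2 * -(M : ℤ)) ω)).trace ≤
        2 * 2 ^ L * E := by
      refine h2.trans ?_
      have a0 := h0.trans (hE' 0 (le_max_left _ _))
      have a1 := h1.trans (hE' _ (le_max_right _ _))
      have h2L : (0 : ℝ) < 2 ^ L := by positivity
      have := mul_le_mul_of_nonneg_left a0 h2L.le
      have := mul_le_mul_of_nonneg_left a1 h2L.le
      linarith
    have h7 := Real.log_le_log h4 h6
    rw [Real.log_mul (by positivity) (Real.exp_pos _).ne', Real.log_mul (by norm_num) (by positivity),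
      Real.log_pow, Real.log_exp] at h7
    have h8 := (abs_le.1 h3).1
    rw [div_add' _ _ _ hM.ne', div_le_div_iff_of_pos_right hM]
    linarith
  have hlim : Tendsto (fun M : ℕ => B / (2 * M + 1 : ℕ) + U) atTop (𝓝 (0 + U)) :=
    ((tendsto_const_div_atTop_nhds_zero_nat B).comp tendsto_two_mul_add_one).add_const U
  have hfin := le_of_tendsto_of_tendsto hωG hlim hev
  rw [zero_add, hU] at hfin
  have e : (L : ℝ) * (K / q + ε / L) = L * (K / q) + ε := by field_simp
  rw [e] at hfin
  linarith

end FixedCircumference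

/-! ### Riemann sums -/

section RiemannSums

theorem integral_sum_shift_eq {f : ℝ → ℝ} (hf : ∀ a b, IntervalIntegrable f volume a b) {L : ℕ}
    (hL : 0 < L) :
    ∑ j ∈ Finset.range L, ∫ t in (0 : ℝ)..(Real.pi / L), f (Real.pi * (j : ℕ) / L + t) =
      ∫ t in (0 : ℝ)..Real.pi, f t := by
  have hL0 : (L : ℝ) ≠ 0 := by exact_mod_cast hL.ne'
  have h := intervalIntegral.sum_integral_adjacent_intervals (f := f) (μ := volume)
    (a := fun k : ℕ => Real.pi * (k : ℕ) / L) (n := L) fun k _ => hf _ _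
  have e0 : Real.pi * ((0 : ℕ) : ℝ) / L = 0 := by simp
  have e1 : Real.pi * ((L : ℕ) : ℝ) / L = Real.pi := by field_simp
  rw [e0, e1] at h
  rw [← h]
  refine Finset.sum_congr rfl fun j _ => ?_
  rw [intervalIntegral.integral_comp_add_left]
  congr 1
  · rw [add_zero]
  · push_cast
    ring

/-- Riemann sums of a continuous function converge, uniformly in the offset. -/
theorem eventually_sum_le_integral {F : ℝ → ℝ} (hF : Continuous F) {ε : ℝ} (hε : 0 < ε) :
    ∀ᶠ L : ℕ in atTop, ∀ κ ∈ Set.Icc 0 (Real.pi / L),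
      Real.pi / L * ∑ j ∈ Finset.range L, F (Real.pi * (j : ℕ) / L + κ) ≤
        (∫ t in (0 : ℝ)..Real.pi, F t) + Real.pi * ε := by
  have hpi := Real.pi_pos
  have huc := (isCompact_Icc (a := (0 : ℝ)) (b := Real.pi)).uniformContinuousOn_of_continuous
    hF.continuousOn
  rw [Metric.uniformContinuousOn_iff] at huc
  obtain ⟨δ, hδ, h⟩ := huc ε hε
  have hsmall : ∀ᶠ L : ℕ in atTop, Real.pi / (L : ℝ) < δ :=
    (tendsto_const_div_atTop_nhds_zero_nat Real.pi).eventually (gt_mem_nhds hδ)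
  filter_upwards [hsmall, eventually_gt_atTop 0] with L hL hL0 κ hκ
  have hL0' : (0 : ℝ) < L := by exact_mod_cast hL0
  rw [← integral_sum_shift_eq (fun a b => hF.intervalIntegrable a b) hL0, Finset.mul_sum]
  have hpL : 0 < Real.pi / L := by positivity
  have key : ∀ j ∈ Finset.range L, Real.pi / L * F (Real.pi * (j : ℕ) / L + κ) ≤
      (∫ t in (0 : ℝ)..(Real.pi / L), F (Real.pi * (j : ℕ) / L + t)) + Real.pi / L * ε := by
    intro j hj
    have hj' : ((j : ℝ) + 1) ≤ L := by exact_mod_cast Finset.mem_range.1 hj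
    have hmem : ∀ t ∈ Set.Icc 0 (Real.pi / L), Real.pi * (j : ℕ) / L + t ∈ Set.Icc 0 Real.pi := by
      intro t ht
      refine ⟨by have := ht.1; positivity, ?_⟩
      calc Real.pi * (j : ℕ) / L + t ≤ Real.pi * (j : ℕ) / L + Real.pi / L := by linarith [ht.2]
        _ = Real.pi * ((j : ℝ) + 1) / L := by ring
        _ ≤ Real.pi * L / L := by gcongr
        _ = Real.pi := by field_simp
    have hle : ∫ t in (0 : ℝ)..(Real.pi / L), (F (Real.pi * (j : ℕ) / L + κ) - ε) ≤
        ∫ t in (0 : ℝ)..(Real.pi / L), F (Real.pi * (j : ℕ) / L + t) := by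
      refine intervalIntegral.integral_mono_on hpL.le (by simp)
        ((hF.comp (by fun_prop)).intervalIntegrable _ _) fun t ht => ?_
      have h1 := h _ (hmem κ hκ) _ (hmem t ht) (by
        rw [Real.dist_eq, abs_lt]
        constructor <;> linarith [hκ.1, hκ.2, ht.1, ht.2])
      rw [Real.dist_eq] at h1
      linarith [(abs_lt.1 h1).2]
    rw [intervalIntegral.integral_const, smul_eq_mul, sub_zero] at hle
    linarith
  refine (Finset.sum_le_sum key).trans (le_of_eq ?_)
  rw [Finset.sum_add_distrib, Finset.sum_const, Finset.card_range, nsmul_eq_mul]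
  congr 1
  field_simp

/-- A sequence squeezed between the Riemann sums of `f` with arbitrary offset and those of
continuous approximations of `f` converges to the integral of `f`. No continuity of `f` is needed,
because the lower bound may be averaged over the offset. -/
theorem tendsto_of_riemann_sums {f : ℝ → ℝ} {F : ℕ → ℝ → ℝ} {G : ℕ → ℝ} {K B : ℝ} {S : Set ℕ}
    (hf : Measurable f) (hfB : ∀ θ, |f θ| ≤ B) (hF : ∀ q, Continuous (F q))
    (hFB : ∀ q θ, |F q θ| ≤ B) (hlim : ∀ θ, Tendsto (fun q => F q θ) atTop (𝓝 (f θ)))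
    (hlo : ∀ L ∈ S, 0 < L → ∀ κ, 2 * ∑ j ∈ Finset.range L, f (Real.pi * (j : ℕ) / L + κ) ≤ G L)
    (hup : ∀ L ∈ S, 0 < L → ∀ q : ℕ, 0 < q → G L ≤ 2 * max
        (∑ j ∈ Finset.range L, F q (Real.pi * (j : ℕ) / L + 0))
        (∑ j ∈ Finset.range L, F q (Real.pi * (j : ℕ) / L + Real.pi / (2 * L))) + L * (K / q)) :
    Tendsto (fun L : ℕ => G L / (4 * L)) (atTop ⊓ 𝓟 S)
      (𝓝 (1 / (2 * Real.pi) * ∫ θ in (0 : ℝ)..Real.pi, f θ)) := by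
  have hpi := Real.pi_pos
  have hfi : ∀ a b, IntervalIntegrable f volume a b := fun a b =>
    (intervalIntegrable_const (c := B)).mono_fun hf.aestronglyMeasurable
      (ae_of_all _ fun θ => (hfB θ).trans (le_abs_self B))
  -- average the lower bound over the offsets `κ ∈ [0, π / L]`
  have hlower : ∀ L ∈ S, 0 < L →
      1 / (2 * Real.pi) * ∫ θ in (0 : ℝ)..Real.pi, f θ ≤ G L / (4 * L) := by
    intro L hLS hL0
    have hL0' : (0 : ℝ) < L := by exact_mod_cast hL0
    have hpL : 0 < Real.pi / L := by positivity
    have hint : ∀ j : ℕ, IntervalIntegrable (fun t => f (Real.pi * (j : ℕ) / L + t)) volume 0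
        (Real.pi / L) := fun j =>
      (intervalIntegrable_const (c := B)).mono_fun
        (hf.comp (measurable_const_add _)).aestronglyMeasurable
        (ae_of_all _ fun θ => (hfB _).trans (le_abs_self B))
    have h1 : ∫ t in (0 : ℝ)..(Real.pi / L), 2 * ∑ j ∈ Finset.range L,
        f (Real.pi * (j : ℕ) / L + t) ≤ ∫ t in (0 : ℝ)..(Real.pi / L), G L := by
      refine intervalIntegral.integral_mono_on hpL.le ?_ (by simp) fun t _ => hlo L hLS hL0 t
      have hs := (IntervalIntegrable.sum (Finset.range L) fun j _ => hint j).const_mul 2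
      simpa only [Finset.sum_apply] using hs
    rw [intervalIntegral.integral_const_mul, intervalIntegral.integral_finsetSum fun j _ => hint j,
      integral_sum_shift_eq hfi hL0, intervalIntegral.integral_const, smul_eq_mul, sub_zero] at h1
    rw [div_mul_eq_mul_div, one_mul, div_le_div_iff₀ (by positivity) (by positivity)]
    have h2 : Real.pi / L * G L * L = Real.pi * G L := by field_simp
    have := mul_le_mul_of_nonneg_right h1 hL0'.le
    nlinarith
  have hFlim : Tendsto (fun q => ∫ θ in (0 : ℝ)..Real.pi, F q θ) atTop
      (𝓝 (∫ θ in (0 : ℝ)..Real.pi, f θ)) :=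
    intervalIntegral.tendsto_integral_filter_of_dominated_convergence (fun _ => B)
      (Eventually.of_forall fun q => (hF q).aestronglyMeasurable)
      (Eventually.of_forall fun q => ae_of_all _ fun θ _ => hFB q θ) (by simp)
      (ae_of_all _ fun θ _ => hlim θ)
  set I := ∫ θ in (0 : ℝ)..Real.pi, f θ with hI
  have hupper : ∀ ε > 0, ∀ᶠ L in atTop ⊓ 𝓟 S, G L / (4 * L) < 1 / (2 * Real.pi) * I + ε := by
    intro ε hε
    have hKq : Tendsto (fun q : ℕ => K / (q : ℝ)) atTop (𝓝 0) :=
      tendsto_const_div_atTop_nhds_zero_nat K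
    obtain ⟨q, hq0, hq1, hq2⟩ := ((eventually_gt_atTop 0).and
      ((hFlim.eventually (gt_mem_nhds (show I < I + ε by linarith))).and
        (hKq.eventually (gt_mem_nhds hε)))).exists
    rw [eventually_inf_principal]
    filter_upwards [eventually_sum_le_integral (hF q) (show 0 < ε / 4 by positivity),
      eventually_gt_atTop 0] with L hL hL0 hLS
    have hL0' : (0 : ℝ) < L := by exact_mod_cast hL0
    have h0 := hL 0 ⟨le_rfl, by positivity⟩
    have h1 := hL (Real.pi / (2 * L)) ⟨by positivity, by
      rw [div_le_div_iff₀ (by positivity) hL0']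
      nlinarith⟩
    have h2 := hup L hLS hL0 q hq0
    set S₀ := ∑ j ∈ Finset.range L, F q (Real.pi * (j : ℕ) / L + 0)
    set S₁ := ∑ j ∈ Finset.range L, F q (Real.pi * (j : ℕ) / L + Real.pi / (2 * L))
    have h3 : Real.pi / L * max S₀ S₁ ≤ (I + ε) + Real.pi * (ε / 4) := by
      rcases max_choice S₀ S₁ with h | h <;> rw [h] <;> linarith
    have hpi3 := Real.pi_gt_three
    have h4 : G L / (4 * L) ≤ 1 / (2 * Real.pi) * (Real.pi / L * max S₀ S₁) + K / q / 4 := by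
      rw [div_le_iff₀ (by positivity)]
      refine h2.trans (le_of_eq ?_)
      field_simp
      ring
    have h5 : 1 / (2 * Real.pi) * (Real.pi / L * max S₀ S₁) ≤
        1 / (2 * Real.pi) * ((I + ε) + Real.pi * (ε / 4)) := by gcongr
    have h6 : 1 / (2 * Real.pi) * ((I + ε) + Real.pi * (ε / 4)) =
        1 / (2 * Real.pi) * I + 1 / (2 * Real.pi) * ε + ε / 8 := by
      field_simp
      ring
    have h7 : 1 / (2 * Real.pi) * ε ≤ 1 / 6 * ε := by
      gcongr
      linarith
    linarith
  rw [tendsto_order]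
  constructor
  · intro a ha
    rw [eventually_inf_principal]
    filter_upwards [eventually_gt_atTop 0] with L hL0 hLS
    exact ha.trans_le (hlower L hLS hL0)
  · intro a ha
    have := hupper (a - 1 / (2 * Real.pi) * I) (by linarith)
    filter_upwards [this] with L hL
    linarith

/-- The integral over `[0, π]` of a function that is symmetric about `π / 2`. -/
theorem integral_pi_of_symm {f : ℝ → ℝ} (hf : ∀ a b, IntervalIntegrable f volume a b)
    (hs : ∀ θ, f (Real.pi - θ) = f θ) :
    ∫ θ in (0 : ℝ)..Real.pi, f θ = 2 * ∫ θ in (0 : ℝ)..(Real.pi / 2), f θ := by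
  have h : ∫ θ in (0 : ℝ)..(Real.pi / 2), f (Real.pi - θ) = ∫ θ in (Real.pi / 2)..Real.pi, f θ := by
    rw [intervalIntegral.integral_comp_sub_left]
    congr 1
    · ring
    · ring
  rw [← intervalIntegral.integral_add_adjacent_intervals (hf 0 (Real.pi / 2)) (hf _ _), ← h]
  simp only [hs]
  ring

end RiemannSums

section Limit

variable {Ω : Type*} [MeasurableSpace Ω] {P : Measure Ω} [IsProbabilityMeasure P]
  {ξ : ℤ → Ω → ℝ × ℝ} {c C : ℝ}

/-- The Lyapunov exponent and its approximations are bounded uniformly in the angle. -/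
theorem exists_abs_max_lyapunov_le (he : IsEnvironment P ξ c C) (H₁ H₂ : ℝ) : ∃ B : ℝ,
    (∀ θ, |max (lyapunov P (fun y ω => (ξ y ω).1) (fun y ω => (ξ y ω).2) θ H₂) (|H₁|)| ≤ B) ∧
    ∀ (m : ℕ) θ, |max (meanLogNorm P ξ H₂ m θ / m) (|H₁|)| ≤ B := by
  obtain ⟨K, hK, h⟩ := exists_meanLogNorm_div_bound he H₂
  have h0 : ∀ x : ℝ, |x| ≤ K → |max x (|H₁|)| ≤ K + |H₁| := by
    intro x hx
    have := abs_nonneg H₁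
    have h1 := abs_le.1 hx
    rw [abs_le]
    refine ⟨?_, max_le (by linarith) (by linarith)⟩
    have := le_max_right x |H₁|
    linarith
  refine ⟨K + |H₁|, fun θ => h0 _ ?_, fun m θ => h0 _ (h m θ)⟩
  have ht := (tendsto_meanLogNorm_div he θ H₂).abs
  exact le_of_tendsto' ht fun m => h m θ

theorem intervalIntegrable_max_lyapunov (he : IsEnvironment P ξ c C) (H₁ H₂ a b : ℝ) :
    IntervalIntegrable (fun θ => max (lyapunov P (fun y ω => (ξ y ω).1) (fun y ω => (ξ y ω).2) θ H₂)
      |H₁|) volume a b := by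
  obtain ⟨B, hB, -⟩ := exists_abs_max_lyapunov_le he H₁ H₂
  exact (intervalIntegrable_const (c := B)).mono_fun
    ((measurable_lyapunov he H₂).max measurable_const).aestronglyMeasurable
      (ae_of_all _ fun θ => (hB θ).trans (le_abs_self B))

/-- The values of the free energies for fixed `L` converge to the integral of the Lyapunov
exponent. -/
theorem tendsto_limit_div (he : IsEnvironment P ξ c C) (H₁ H₂ : ℝ) {G : ℕ → ℝ}
    (hG : ∀ (L : ℕ) [NeZero L], Even L → ∀ᵐ ω ∂P, Tendsto (fun M : ℕ =>
      Real.log (rowsSum L H₁ H₂ (2 * (2 * M + 1)) (tailFrom ξ (2 * -(M : ℤ)) ω)) /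
        (2 * M + 1 : ℕ)) atTop (𝓝 (G L))) :
    Tendsto (fun L : ℕ => G L / (4 * L)) (atTop ⊓ 𝓟 {L : ℕ | Even L})
      (𝓝 (1 / Real.pi * ∫ θ in (0 : ℝ)..(Real.pi / 2),
        max (lyapunov P (fun y ω => (ξ y ω).1) (fun y ω => (ξ y ω).2) θ H₂) |H₁|)) := by
  obtain ⟨B, hB, hB'⟩ := exists_abs_max_lyapunov_le he H₁ H₂
  obtain ⟨K, hK, hup⟩ := exists_le_sum_meanLogNorm he H₁ H₂
  have htwo : ∀ L : ℕ, 0 < L → Even L → 2 ≤ L := by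
    rintro L hL ⟨l, rfl⟩; omega
  have h := tendsto_of_riemann_sums (S := {L : ℕ | Even L}) (G := G) (K := K)
    (F := fun q θ => max (meanLogNorm P ξ H₂ (2 * q) θ / (2 * q : ℕ)) |H₁|)
    ((measurable_lyapunov he H₂).max measurable_const) hB
    (fun q => ((continuous_meanLogNorm he H₂ _).div_const _).max continuous_const)
    (fun q θ => hB' (2 * q) θ)
    (fun θ => (((tendsto_meanLogNorm_div he θ H₂).comp
      (tendsto_id.const_mul_atTop' (by norm_num : 0 < 2))).max tendsto_const_nhds))
    (fun L hLe hL0 κ => by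
      have : NeZero L := ⟨hL0.ne'⟩
      have := sum_lyapunov_le (htwo L hL0 hLe) hLe he H₁ H₂ (hG L hLe) κ
      rwa [Fin.sum_univ_eq_sum_range fun j => max (lyapunov P (fun y ω => (ξ y ω).1)
        (fun y ω => (ξ y ω).2) (Real.pi * (j : ℕ) / L + κ) H₂) |H₁|] at this)
    (fun L hLe hL0 q hq => by
      have : NeZero L := ⟨hL0.ne'⟩
      have := hup L (htwo L hL0 hLe) hLe (hG L hLe) hq
      rwa [Fin.sum_univ_eq_sum_range fun j => max (meanLogNorm P ξ H₂ (2 * q)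
          (Real.pi * (j : ℕ) / L + 0) / (2 * q : ℕ)) |H₁|,
        Fin.sum_univ_eq_sum_range fun j => max (meanLogNorm P ξ H₂ (2 * q)
          (Real.pi * (j : ℕ) / L + Real.pi / (2 * L)) / (2 * q : ℕ)) |H₁|] at this)
  rw [integral_pi_of_symm (fun a b => intervalIntegrable_max_lyapunov he H₁ H₂ a b)
    fun θ => by rw [lyapunov_pi_sub he]] at h
  convert h using 2
  field_simp

end Limit

/-! ### Integrability of the free energy -/

section CrudeBounds

variable {L N : ℕ} {w₁ w₂ : ℤ → ℝ} {H₁ H₂ c C : ℝ}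

theorem horizontalWeight_mem_Icc (hc : 0 < c) (hw : ∀ y, InBox c C (w₁ y, w₂ y))
    (p : Vertex L N) :
    horizontalWeight w₁ H₂ p ∈ Set.Icc (c * Real.exp (-|H₂|)) (C * Real.exp |H₂|) := by
  obtain ⟨⟨h1, h2⟩, -⟩ := hw (row p)
  simp only at h1 h2
  have h3 : Real.exp (-|H₂|) ≤ Real.exp H₂ := Real.exp_le_exp.2 (neg_abs_le _)
  have h4 : Real.exp (-|H₂|) ≤ Real.exp (-H₂) := Real.exp_le_exp.2 (neg_le_neg (le_abs_self _))
  have h5 : Real.exp H₂ ≤ Real.exp |H₂| := Real.exp_le_exp.2 (le_abs_self _)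
  have h6 : Real.exp (-H₂) ≤ Real.exp |H₂| := Real.exp_le_exp.2 (neg_le_abs _)
  have hC : 0 ≤ C := by linarith
  have h7 := hc.le.trans h1
  unfold horizontalWeight
  split_ifs <;> constructor <;> gcongr

theorem verticalWeight_mem_Icc (hc : 0 < c) (hw : ∀ y, InBox c C (w₁ y, w₂ y))
    (p : Vertex L N) :
    verticalWeight w₂ H₁ p ∈ Set.Icc (c * Real.exp (-|H₁|)) (C * Real.exp |H₁|) := by
  obtain ⟨-, ⟨h1, h2⟩⟩ := hw (row p)
  simp only at h1 h2
  have h3 : Real.exp (-|H₁|) ≤ Real.exp H₁ := Real.exp_le_exp.2 (neg_abs_le _)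
  have h4 : Real.exp (-|H₁|) ≤ Real.exp (-H₁) := Real.exp_le_exp.2 (neg_le_neg (le_abs_self _))
  have h5 : Real.exp H₁ ≤ Real.exp |H₁| := Real.exp_le_exp.2 (le_abs_self _)
  have h6 : Real.exp (-H₁) ≤ Real.exp |H₁| := Real.exp_le_exp.2 (neg_le_abs _)
  have hC : 0 ≤ C := by linarith
  have h7 := hc.le.trans h1
  unfold verticalWeight
  split_ifs <;> constructor <;> gcongr

theorem exists_edgeWeight_mem_Icc (H₁ H₂ : ℝ) (hc : 0 < c) : ∃ a b : ℝ, 0 < a ∧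
    ∀ {L N : ℕ} {w₁ w₂ : ℤ → ℝ}, (∀ y, InBox c C (w₁ y, w₂ y)) →
      ∀ e ∈ (torusGraph L N).edgeSet, edgeWeight w₁ w₂ H₁ H₂ e ∈ Set.Icc a b := by
  refine ⟨min (c * Real.exp (-|H₂|)) (c * Real.exp (-|H₁|)),
    2 * (C * Real.exp |H₂|) + 2 * (C * Real.exp |H₁|), by positivity, ?_⟩
  intro L N w₁ w₂ hw e
  induction e using Sym2.inductionOn with
  | hf p q =>
    intro he
    have hcC : c ≤ C := (hw 0).1.1.trans (hw 0).1.2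
    have ha : 0 < c * Real.exp (-|H₂|) := by positivity
    have ha' : 0 < c * Real.exp (-|H₁|) := by positivity
    have h0 : 0 ≤ C * Real.exp |H₂| := by have := hc.le.trans hcC; positivity
    have h0' : 0 ≤ C * Real.exp |H₁| := by have := hc.le.trans hcC; positivity
    have hh := horizontalWeight_mem_Icc (H₂ := H₂) hc hw (L := L) (N := N)
    have hv := verticalWeight_mem_Icc (H₁ := H₁) hc hw (L := L) (N := N)
    have hb : ∀ (P : Prop) [Decidable P] (x A B : ℝ), 0 < A → x ∈ Set.Icc A B →
        (0 ≤ if P then x else 0) ∧ (if P then x else 0) ≤ B ∧ (P → A ≤ if P then x else 0) := by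
      intro P _ x A B hA hx
      split_ifs with h
      · exact ⟨hA.le.trans hx.1, hx.2, fun _ => hx.1⟩
      · exact ⟨le_rfl, (hA.le.trans hx.1).trans hx.2, fun h' => absurd h' h⟩
    obtain ⟨a1, b1, c1⟩ := hb (q = right p) _ _ _ ha (hh p)
    obtain ⟨a2, b2, c2⟩ := hb (p = right q) _ _ _ ha (hh q)
    obtain ⟨a3, b3, c3⟩ := hb (q = up p) _ _ _ ha' (hv p)
    obtain ⟨a4, b4, c4⟩ := hb (p = up q) _ _ _ ha' (hv q)
    simp only [edgeWeight, Sym2.lift_mk]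
    have hm1 := min_le_left (c * Real.exp (-|H₂|)) (c * Real.exp (-|H₁|))
    have hm2 := min_le_right (c * Real.exp (-|H₂|)) (c * Real.exp (-|H₁|))
    refine ⟨?_, by linarith⟩
    rcases (he : q = right p ∨ p = right q ∨ q = up p ∨ p = up q) with h | h | h | h
    · linarith [c1 h]
    · linarith [c2 h]
    · linarith [c3 h]
    · linarith [c4 h]

/-- In a fixed volume `log Z` is bounded, uniformly over weights in a box. This holds also on tori
without perfect matchings, where `Z = 0` and `log Z = 0`. -/
theorem exists_abs_log_partitionFunction_le (L N : ℕ) [NeZero L] [NeZero N] (H₁ H₂ : ℝ)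
    (hc : 0 < c) : ∃ K : ℝ, ∀ {w₁ w₂ : ℤ → ℝ}, (∀ y, InBox c C (w₁ y, w₂ y)) →
      |Real.log (partitionFunction L N w₁ w₂ H₁ H₂)| ≤ K := by
  classical
  obtain ⟨a, b, ha, hab⟩ := exists_edgeWeight_mem_Icc H₁ H₂ (C := C) hc
  let S := {D : (torusGraph L N).Subgraph // D.IsPerfectMatching}
  have : Fintype S := Fintype.ofFinite S
  have (D : S) : Fintype D.1.edgeSet := Fintype.ofFinite _
  let A : ℝ := ∑ D : S, a ^ Fintype.card D.1.edgeSet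
  let B : ℝ := ∑ D : S, b ^ Fintype.card D.1.edgeSet
  refine ⟨max |Real.log A| |Real.log B|, fun {w₁ w₂} hw => ?_⟩
  have hZ : partitionFunction L N w₁ w₂ H₁ H₂ =
      ∑ D : S, ∏ e : D.1.edgeSet, edgeWeight w₁ w₂ H₁ H₂ e.1 := by
    rw [partitionFunction, finsum_eq_sum_of_fintype]
    exact Finset.sum_congr rfl fun D _ => finprod_eq_prod_of_fintype _
  have he : ∀ (D : S) (e : D.1.edgeSet), edgeWeight w₁ w₂ H₁ H₂ e.1 ∈ Set.Icc a b :=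
    fun D e => hab hw e.1 (D.1.edgeSet_subset e.2)
  rcases isEmpty_or_nonempty S with hS | hS
  · rw [hZ, Finset.univ_eq_empty, Finset.sum_empty, Real.log_zero, abs_zero]
    positivity
  have hAZ : A ≤ partitionFunction L N w₁ w₂ H₁ H₂ := by
    rw [hZ]
    refine Finset.sum_le_sum fun D _ => ?_
    rw [← Finset.card_univ, ← Finset.prod_const]
    exact Finset.prod_le_prod (fun _ _ => ha.le) fun e _ => (he D e).1
  have hZB : partitionFunction L N w₁ w₂ H₁ H₂ ≤ B := by
    rw [hZ]
    refine Finset.sum_le_sum fun D _ => ?_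
    rw [← Finset.card_univ, ← Finset.prod_const]
    exact Finset.prod_le_prod (fun e _ => ha.le.trans (he D e).1) fun e _ => (he D e).2
  have hA : 0 < A := Finset.sum_pos (fun D _ => pow_pos ha _) Finset.univ_nonempty
  exact abs_le_max_abs_abs (Real.log_le_log hA hAZ) (Real.log_le_log (hA.trans_le hAZ) hZB)

theorem measurable_partitionFunction {Ω : Type*} [MeasurableSpace Ω] (L N : ℕ) [NeZero L]
    [NeZero N] (H₁ H₂ : ℝ) {w₁ w₂ : ℤ → Ω → ℝ} (h₁ : ∀ y, Measurable (w₁ y))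
    (h₂ : ∀ y, Measurable (w₂ y)) :
    Measurable fun ω => partitionFunction L N (fun y => w₁ y ω) (fun y => w₂ y ω) H₁ H₂ := by
  classical
  have hh : ∀ p : Vertex L N, Measurable fun ω => horizontalWeight (fun y => w₁ y ω) H₂ p := by
    intro p
    unfold horizontalWeight
    split_ifs <;> exact (h₁ _).mul_const _
  have hv : ∀ p : Vertex L N, Measurable fun ω => verticalWeight (fun y => w₂ y ω) H₁ p := by
    intro p
    unfold verticalWeight
    split_ifs <;> exact (h₂ _).mul_const _
  have hE : ∀ e : Sym2 (Vertex L N), Measurable fun ω =>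
      edgeWeight (fun y => w₁ y ω) (fun y => w₂ y ω) H₁ H₂ e := by
    intro e
    induction e using Sym2.inductionOn with
    | hf p q =>
      have hi : ∀ (P : Prop) [Decidable P] (f : Ω → ℝ), Measurable f →
          Measurable fun ω => if P then f ω else 0 := by
        intro P _ f hf
        split_ifs
        exacts [hf, measurable_const]
      simp only [edgeWeight, Sym2.lift_mk]
      exact (((hi _ _ (hh p)).add (hi _ _ (hh q))).add (hi _ _ (hv p))).add (hi _ _ (hv q))
  let S := {D : (torusGraph L N).Subgraph // D.IsPerfectMatching}
  have : Fintype S := Fintype.ofFinite S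
  have (D : S) : Fintype D.1.edgeSet := Fintype.ofFinite _
  simp only [partitionFunction, finsum_eq_sum_of_fintype, finprod_eq_prod_of_fintype]
  exact Finset.measurable_sum _ fun D _ => Finset.measurable_prod _ fun e _ => hE _

end CrudeBounds

/-! ### Convergence of the free energy -/

section FreeEnergy

variable {Ω : Type*}

/-- The row with label `-N + 1 = -2M` is even, so the rows of the torus with `N = 2M + 1` are those
of the transfer matrices started in row `-2M`. -/
theorem freeEnergy_odd (L : ℕ) [NeZero L] (hL : 2 ≤ L) (H₁ H₂ : ℝ) {M : ℕ} (hM : 1 ≤ M)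
    (ξ : ℤ → Ω → ℝ × ℝ) (ω : Ω) :
    freeEnergy L (2 * M + 1) (fun y => (ξ y ω).1) (fun y => (ξ y ω).2) H₁ H₂ =
      Real.log (rowsProd L H₁ H₂ (2 * (2 * M + 1)) (tailFrom ξ (2 * -(M : ℤ)) ω)).trace /
        (2 * M + 1 : ℕ) / (4 * L) := by
  rw [freeEnergy, partitionFunction_eq_trace hL (by omega)]
  have hrows : rangeProd (fun i : ℕ => envRow L H₁ H₂ (fun y => ((ξ y ω).1, (ξ y ω).2))
        (-((2 * M + 1 : ℕ) : ℤ) + 1 + i)) (2 * (2 * M + 1)) =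
      rowsProd L H₁ H₂ (2 * (2 * M + 1)) (tailFrom ξ (2 * -(M : ℤ)) ω) := by
    refine rangeProd_congr fun i _ => ?_
    have h1 : -((2 * M + 1 : ℕ) : ℤ) + 1 + i = 2 * -(M : ℤ) + i := by push_cast; ring
    have h2 : ((2 * -(M : ℤ) + i : ℤ) : ZMod 2) = (i : ZMod 2) := by
      push_cast
      rw [show (2 : ZMod 2) = 0 from rfl, zero_mul, zero_add]
    rw [h1, envRow, h2]
    rfl
  rw [hrows]
  have h1 : ((2 * M + 1 : ℕ) : ℝ) ≠ 0 := by positivity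
  have h2 : (L : ℝ) ≠ 0 := Nat.cast_ne_zero.2 (NeZero.ne L)
  field_simp

variable [MeasurableSpace Ω] {P : Measure Ω} {ξ : ℤ → Ω → ℝ × ℝ} {c C : ℝ}

theorem measurable_freeEnergy (he : IsEnvironment P ξ c C) (L N : ℕ) [NeZero L] [NeZero N]
    (H₁ H₂ : ℝ) : Measurable fun ω =>
      freeEnergy L N (fun y => (ξ y ω).1) (fun y => (ξ y ω).2) H₁ H₂ :=
  ((measurable_partitionFunction L N H₁ H₂ (fun y => (he.meas y).fst)
    fun y => (he.meas y).snd).log).const_mul _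

theorem exists_abs_freeEnergy_le (he : IsEnvironment P ξ c C) (L : ℕ) [NeZero L] (hL : 2 ≤ L)
    (H₁ H₂ : ℝ) : ∃ B : ℝ, ∀ M : ℕ, 1 ≤ M → ∀ ω,
      |freeEnergy L (2 * M + 1) (fun y => (ξ y ω).1) (fun y => (ξ y ω).2) H₁ H₂| ≤ B := by
  obtain ⟨K, hK0, hK⟩ := exists_log_rowsSum_bounds hL H₁ H₂ (C := C) he.pos
  refine ⟨3 * K / (4 * L), fun M hM ω => ?_⟩
  obtain ⟨-, h, -⟩ := hK (tailFrom ξ (2 * -(M : ℤ)) ω) (fun k => he.box _ _) (2 * (2 * M + 1))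
  have hM0 : (0 : ℝ) < (2 * M + 1 : ℕ) := by positivity
  have hL0 : (0 : ℝ) < 4 * L := by positivity
  rw [freeEnergy_odd L hL H₁ H₂ hM, abs_div, abs_div, abs_of_pos hM0, abs_of_pos hL0]
  gcongr
  rw [div_le_iff₀ hM0]
  refine h.trans ?_
  push_cast
  have : (0 : ℝ) ≤ M := Nat.cast_nonneg M
  nlinarith

theorem ae_tendsto_freeEnergy (he : IsEnvironment P ξ c C) (L : ℕ) [NeZero L] (hL : 2 ≤ L)
    (H₁ H₂ : ℝ) {G : ℝ} (hG : ∀ᵐ ω ∂P, Tendsto (fun M : ℕ =>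
      Real.log (rowsSum L H₁ H₂ (2 * (2 * M + 1)) (tailFrom ξ (2 * -(M : ℤ)) ω)) /
        (2 * M + 1 : ℕ)) atTop (𝓝 G)) :
    ∀ᵐ ω ∂P, Tendsto (fun M : ℕ =>
      freeEnergy L (2 * M + 1) (fun y => (ξ y ω).1) (fun y => (ξ y ω).2) H₁ H₂) atTop
        (𝓝 (G / (4 * L))) := by
  obtain ⟨K, hK0, hK⟩ := exists_log_rowsSum_bounds hL H₁ H₂ (C := C) he.pos
  filter_upwards [hG] with ω hω
  have h := (tendsto_log_div_of_abs_sub_le (K := K) (u := fun M : ℕ =>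
    Real.log (rowsProd L H₁ H₂ (2 * (2 * M + 1)) (tailFrom ξ (2 * -(M : ℤ)) ω)).trace)
    (fun M => (hK (tailFrom ξ (2 * -(M : ℤ)) ω) (fun k => he.box _ _) _).2.2.1) hω).div_const
      (4 * (L : ℝ))
  refine h.congr' ?_
  filter_upwards [eventually_ge_atTop 1] with M hM
  rw [freeEnergy_odd L hL H₁ H₂ hM]

variable [IsProbabilityMeasure P]

theorem integrable_freeEnergy (he : IsEnvironment P ξ c C) (L N : ℕ) [NeZero L] [NeZero N]
    (H₁ H₂ : ℝ) : Integrable (fun ω =>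
      freeEnergy L N (fun y => (ξ y ω).1) (fun y => (ξ y ω).2) H₁ H₂) P := by
  obtain ⟨K, hK⟩ := exists_abs_log_partitionFunction_le L N H₁ H₂ (C := C) he.pos
  have hm := measurable_partitionFunction L N H₁ H₂ (fun y => (he.meas y).fst)
    fun y => (he.meas y).snd
  exact (Integrable.of_bound hm.log.aestronglyMeasurable K
    (ae_of_all _ fun ω => hK fun y => he.box y ω)).const_mul _

/-- Almost sure convergence upgrades to convergence in `L¹`, the free energies being bounded. -/
theorem tendsto_integral_abs_freeEnergy_sub (he : IsEnvironment P ξ c C) (L : ℕ) [NeZero L]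
    (hL : 2 ≤ L) (H₁ H₂ : ℝ) {g : ℝ} (hg : ∀ᵐ ω ∂P, Tendsto (fun M : ℕ =>
      freeEnergy L (2 * M + 1) (fun y => (ξ y ω).1) (fun y => (ξ y ω).2) H₁ H₂) atTop (𝓝 g)) :
    Tendsto (fun M : ℕ => ∫ ω, |freeEnergy L (2 * M + 1) (fun y => (ξ y ω).1)
      (fun y => (ξ y ω).2) H₁ H₂ - g| ∂P) atTop (𝓝 0) := by
  obtain ⟨B, hB⟩ := exists_abs_freeEnergy_le he L hL H₁ H₂
  have h := tendsto_integral_filter_of_dominated_convergence (μ := P) (l := atTop)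
    (F := fun (M : ℕ) ω => |freeEnergy L (2 * M + 1) (fun y => (ξ y ω).1)
      (fun y => (ξ y ω).2) H₁ H₂ - g|) (f := fun _ => (0 : ℝ)) (fun _ => B + |g|)
    (Eventually.of_forall fun M =>
      ((measurable_freeEnergy he L (2 * M + 1) H₁ H₂).sub_const g).norm.aestronglyMeasurable)
    (by
      filter_upwards [eventually_ge_atTop 1] with M hM
      refine ae_of_all _ fun ω => ?_
      rw [Real.norm_eq_abs, abs_abs]
      exact (abs_sub _ _).trans (by linarith [hB M hM ω]))
    (integrable_const _)
    (by
      filter_upwards [hg] with ω hω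
      have := (hω.sub_const g).abs
      rwa [sub_self, abs_zero] at this)
  simpa using h

theorem exists_tendsto_freeEnergy (he : IsEnvironment P ξ c C) (H₁ H₂ : ℝ) : ∃ Φ : ℕ → ℝ,
    (∀ L : ℕ, 0 < L → Even L →
      (∀ᵐ ω ∂P, Tendsto (fun N : ℕ =>
        freeEnergy L N (fun y => (ξ y ω).1) (fun y => (ξ y ω).2) H₁ H₂)
        (atTop ⊓ 𝓟 {N : ℕ | Odd N}) (𝓝 (Φ L))) ∧
      (∀ N : ℕ, Odd N → Integrable (fun ω =>
        freeEnergy L N (fun y => (ξ y ω).1) (fun y => (ξ y ω).2) H₁ H₂) P) ∧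
      Tendsto (fun N : ℕ => ∫ ω, |freeEnergy L N (fun y => (ξ y ω).1) (fun y => (ξ y ω).2) H₁ H₂
          - Φ L| ∂P) (atTop ⊓ 𝓟 {N : ℕ | Odd N}) (𝓝 0)) ∧
    Tendsto Φ (atTop ⊓ 𝓟 {L : ℕ | Even L}) (𝓝 (1 / Real.pi * ∫ θ in (0 : ℝ)..(Real.pi / 2),
      max (lyapunov P (fun y ω => (ξ y ω).1) (fun y ω => (ξ y ω).2) θ H₂) |H₁|)) := by
  have htwo : ∀ L : ℕ, 0 < L → Even L → 2 ≤ L := by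
    rintro L hL ⟨l, rfl⟩; omega
  have hex : ∀ L : ℕ, ∃ G : ℝ, ∀ [NeZero L], Even L → ∀ᵐ ω ∂P, Tendsto (fun M : ℕ =>
      Real.log (rowsSum L H₁ H₂ (2 * (2 * M + 1)) (tailFrom ξ (2 * -(M : ℤ)) ω)) /
        (2 * M + 1 : ℕ)) atTop (𝓝 G) := by
    intro L
    by_cases h : 0 < L ∧ Even L
    · have : NeZero L := ⟨h.1.ne'⟩
      obtain ⟨G, hG⟩ := exists_ae_tendsto_log_rowsSum (htwo L h.1 h.2) H₁ H₂ he.pos he.meas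
        he.indep he.ident he.box
      exact ⟨G, fun _ => hG⟩
    · exact ⟨0, fun {hL} hLe => absurd ⟨Nat.pos_of_ne_zero hL.ne, hLe⟩ h⟩
  choose G hG using hex
  refine ⟨fun L => G L / (4 * L), fun L hL hLe => ?_, tendsto_limit_div he H₁ H₂ fun L _ hLe =>
    hG L hLe⟩
  have : NeZero L := ⟨hL.ne'⟩
  have hae := ae_tendsto_freeEnergy he L (htwo L hL hLe) H₁ H₂ (hG L hLe)
  refine ⟨?_, fun N hN => ?_, ?_⟩
  · filter_upwards [hae] with ω hω
    exact tendsto_of_tendsto_odd hω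
  · have : NeZero N := ⟨hN.pos.ne'⟩
    exact integrable_freeEnergy he L N H₁ H₂
  · exact tendsto_of_tendsto_odd
      (tendsto_integral_abs_freeEnergy_sub he L (htwo L hL hLe) H₁ H₂ hae)

end FreeEnergy

/-! ### Reduction to bounded weights -/

section Reduction

variable {Ω : Type*} [MeasurableSpace Ω] {P : Measure Ω}

theorem exists_Icc_of_isCompact {K : Set ℝ} (hK : IsCompact K) (h0 : K ⊆ Set.Ioi 0) :
    ∃ c C : ℝ, 0 < c ∧ K ⊆ Set.Icc c C := by
  rcases K.eq_empty_or_nonempty with rfl | hne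
  · exact ⟨1, 1, one_pos, Set.empty_subset _⟩
  obtain ⟨a, ha, hmin⟩ := hK.exists_isMinOn hne continuousOn_id
  obtain ⟨b, hb, hmax⟩ := hK.exists_isMaxOn hne continuousOn_id
  exact ⟨a, b, h0 ha, fun x hx => ⟨hmin hx, hmax hx⟩⟩

/-- The Lyapunov exponent depends on the weights up to almost sure equality only. -/
theorem lyapunov_congr {w₁ w₂ v₁ v₂ : ℤ → Ω → ℝ}
    (h : ∀ᵐ ω ∂P, ∀ y, w₁ y ω = v₁ y ω ∧ w₂ y ω = v₂ y ω) (θ H₂ : ℝ) :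
    lyapunov P w₁ w₂ θ H₂ = lyapunov P v₁ v₂ θ H₂ ∧
    ∀ γ, HasTopLyapunovExponent P (randomTransferMatrix v₁ v₂ θ H₂) γ →
      HasTopLyapunovExponent P (randomTransferMatrix w₁ w₂ θ H₂) γ := by
  have hae : ∀ n, logNormProd (randomTransferMatrix w₁ w₂ θ H₂) n =ᵐ[P]
      logNormProd (randomTransferMatrix v₁ v₂ θ H₂) n := by
    intro n
    filter_upwards [h] with ω hω
    have h1 : ∀ i : ℕ, randomTransferMatrix w₁ w₂ θ H₂ i ω =
        randomTransferMatrix v₁ v₂ θ H₂ i ω := fun i => by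
      simp only [randomTransferMatrix, (hω i).1, (hω i).2]
    simp only [logNormProd, h1]
  have hint : (fun n : ℕ => 1 / (n : ℝ) *
      ∫ ω, logNormProd (randomTransferMatrix w₁ w₂ θ H₂) n ω ∂P) = fun n : ℕ => 1 / (n : ℝ) *
      ∫ ω, logNormProd (randomTransferMatrix v₁ v₂ θ H₂) n ω ∂P :=
    funext fun n => by rw [integral_congr_ae (hae n)]
  refine ⟨by rw [lyapunov, lyapunov, topLyapunovExponent, topLyapunovExponent, hint],
    fun γ hγ => ⟨fun n => (hγ.1 n).congr (hae n).symm, ?_⟩⟩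
  rw [hint]
  exact hγ.2

/-- Compactly supported weights agree almost surely with weights that are everywhere bounded: clamp
them to an interval `[c, C]` containing the supports. -/
theorem exists_isEnvironment [IsProbabilityMeasure P] {w₁ w₂ : ℤ → Ω → ℝ}
    (hw₁_meas : ∀ y, Measurable (w₁ y)) (hw₂_meas : ∀ y, Measurable (w₂ y))
    (h_indep : iIndepFun (fun (y : ℤ) (ω : Ω) => (w₁ y ω, w₂ y ω)) P)
    (h_ident : ∀ y : ℤ,
      IdentDistrib (fun ω => (w₁ y ω, w₂ y ω)) (fun ω => (w₁ 0 ω, w₂ 0 ω)) P P)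
    (hw₁_supp : ∃ K : Set ℝ, IsCompact K ∧ K ⊆ Set.Ioi 0 ∧ ∀ᵐ ω ∂P, w₁ 0 ω ∈ K)
    (hw₂_supp : ∃ K : Set ℝ, IsCompact K ∧ K ⊆ Set.Ioi 0 ∧ ∀ᵐ ω ∂P, w₂ 0 ω ∈ K)
    (hw₂_log : ∫ ω, Real.log (w₂ 0 ω) ∂P = 0) :
    ∃ (ξ : ℤ → Ω → ℝ × ℝ) (c C : ℝ), IsEnvironment P ξ c C ∧
      ∀ᵐ ω ∂P, ∀ y, w₁ y ω = (ξ y ω).1 ∧ w₂ y ω = (ξ y ω).2 := by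
  obtain ⟨K₁, hK₁, h₁pos, h₁⟩ := hw₁_supp
  obtain ⟨K₂, hK₂, h₂pos, h₂⟩ := hw₂_supp
  obtain ⟨c₁, C₁, hc₁, hKc₁⟩ := exists_Icc_of_isCompact hK₁ h₁pos
  obtain ⟨c₂, C₂, hc₂, hKc₂⟩ := exists_Icc_of_isCompact hK₂ h₂pos
  set c := min c₁ c₂ with hc_def
  set C := max c (max C₁ C₂) with hC_def
  have hc : 0 < c := lt_min hc₁ hc₂
  have hcC : c ≤ C := le_max_left _ _
  have hbox0 : ∀ᵐ ω ∂P, InBox c C (w₁ 0 ω, w₂ 0 ω) := by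
    filter_upwards [h₁, h₂] with ω ha hb
    have ha' := hKc₁ ha
    have hb' := hKc₂ hb
    exact ⟨⟨(min_le_left _ _).trans ha'.1,
      ha'.2.trans ((le_max_left _ _).trans (le_max_right _ _))⟩,
      (min_le_right _ _).trans hb'.1,
      hb'.2.trans ((le_max_right _ _).trans (le_max_right _ _))⟩
  have hbox : ∀ᵐ ω ∂P, ∀ y, InBox c C (w₁ y ω, w₂ y ω) := by
    rw [ae_all_iff]
    intro y
    have hms : MeasurableSet (Set.Icc c C ×ˢ Set.Icc c C : Set (ℝ × ℝ)) :=
      measurableSet_Icc.prod measurableSet_Icc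
    exact (h_ident y).symm.ae_snd hms hbox0
  let clamp : ℝ × ℝ → ℝ × ℝ := fun w => (max c (min C w.1), max c (min C w.2))
  have hclamp : Measurable clamp := by fun_prop
  have hclamp_eq : ∀ w, InBox c C w → clamp w = w := fun w hw => by
    simp only [clamp]
    rw [min_eq_right hw.1.2, min_eq_right hw.2.2, max_eq_right hw.1.1, max_eq_right hw.2.1]
  have heq : ∀ᵐ ω ∂P, ∀ y, w₁ y ω = (clamp (w₁ y ω, w₂ y ω)).1 ∧
      w₂ y ω = (clamp (w₁ y ω, w₂ y ω)).2 := by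
    filter_upwards [hbox] with ω hω y
    rw [hclamp_eq _ (hω y)]
    exact ⟨rfl, rfl⟩
  refine ⟨fun y ω => clamp (w₁ y ω, w₂ y ω), c, C, ⟨hc, fun y => hclamp.comp
    ((hw₁_meas y).prodMk (hw₂_meas y)), h_indep.comp (fun _ => clamp) fun _ => hclamp,
    fun y => (h_ident y).comp hclamp, fun y ω => ⟨⟨le_max_left _ _, max_le hcC (min_le_left _ _)⟩,
      le_max_left _ _, max_le hcC (min_le_left _ _)⟩, ?_⟩, heq⟩
  rw [← hw₂_log]
  refine integral_congr_ae ?_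
  filter_upwards [heq] with ω hω
  simp only [← (hω 0).2]

end Reduction

end LayeredDimer

theorem proposition1p1 {Ω : Type*} [MeasurableSpace Ω] (P : Measure Ω) [IsProbabilityMeasure P]
    (w₁ w₂ : ℤ → Ω → ℝ)
    (hw₁_meas : ∀ y, Measurable (w₁ y)) (hw₂_meas : ∀ y, Measurable (w₂ y))
    -- the pairs `(w₁(y), w₂(y))`, `y ∈ ℤ`, are i.i.d.
    (h_indep : iIndepFun (fun (y : ℤ) (ω : Ω) => (w₁ y ω, w₂ y ω)) P)
    (h_ident : ∀ y : ℤ,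
      IdentDistrib (fun ω => (w₁ y ω, w₂ y ω)) (fun ω => (w₁ 0 ω, w₂ 0 ω)) P P)
    -- the two weights are independent and compactly supported in `(0, ∞)`
    (h_indep₁₂ : IndepFun (w₁ 0) (w₂ 0) P)
    (hw₁_supp : ∃ K : Set ℝ, IsCompact K ∧ K ⊆ Set.Ioi 0 ∧ ∀ᵐ ω ∂P, w₁ 0 ω ∈ K)
    (hw₂_supp : ∃ K : Set ℝ, IsCompact K ∧ K ⊆ Set.Ioi 0 ∧ ∀ᵐ ω ∂P, w₂ 0 ω ∈ K)
    -- the vertical weight is not deterministic and its logarithm is centred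
    (hw₂_nondet : ¬ ∃ c : ℝ, ∀ᵐ ω ∂P, w₂ 0 ω = c)
    (hw₂_log : ∫ ω, Real.log (w₂ 0 ω) ∂P = 0)
    (H₁ H₂ : ℝ) :
    -- the top Lyapunov exponent `𝓛(θ, H₂)` exists and is non-negative
    (∀ θ : ℝ,
      LayeredDimer.HasTopLyapunovExponent P (LayeredDimer.randomTransferMatrix w₁ w₂ θ H₂)
        (LayeredDimer.lyapunov P w₁ w₂ θ H₂) ∧
      0 ≤ LayeredDimer.lyapunov P w₁ w₂ θ H₂) ∧
    IntervalIntegrable (fun θ => max (LayeredDimer.lyapunov P w₁ w₂ θ H₂) |H₁|) volume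
      0 (Real.pi / 2) ∧
    -- the iterated limit of the free energy (first `N → ∞`, then `L → ∞`), with `L` even, `N` odd
    ∃ Φ : ℕ → ℝ,
      (∀ L : ℕ, 0 < L → Even L →
        (∀ᵐ ω ∂P, Tendsto
          (fun N : ℕ =>
            LayeredDimer.freeEnergy L N (fun y => w₁ y ω) (fun y => w₂ y ω) H₁ H₂)
          (atTop ⊓ 𝓟 {N : ℕ | Odd N}) (𝓝 (Φ L))) ∧
        (∀ N : ℕ, Odd N → Integrable
          (fun ω => LayeredDimer.freeEnergy L N (fun y => w₁ y ω) (fun y => w₂ y ω) H₁ H₂) P) ∧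
        Tendsto
          (fun N : ℕ => ∫ ω, |LayeredDimer.freeEnergy L N (fun y => w₁ y ω) (fun y => w₂ y ω) H₁ H₂
            - Φ L| ∂P)
          (atTop ⊓ 𝓟 {N : ℕ | Odd N}) (𝓝 0)) ∧
      Tendsto Φ (atTop ⊓ 𝓟 {L : ℕ | Even L})
        (𝓝 (1 / Real.pi *
          ∫ θ in (0 : ℝ)..(Real.pi / 2), max (LayeredDimer.lyapunov P w₁ w₂ θ H₂) |H₁|)) := by
  obtain ⟨ξ, c, C, he, hae⟩ := LayeredDimer.exists_isEnvironment hw₁_meas hw₂_meas h_indep h_ident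
    hw₁_supp hw₂_supp hw₂_log
  have hlyap : ∀ θ, LayeredDimer.lyapunov P w₁ w₂ θ H₂ =
      LayeredDimer.lyapunov P (fun y ω => (ξ y ω).1) (fun y ω => (ξ y ω).2) θ H₂ :=
    fun θ => (LayeredDimer.lyapunov_congr hae θ H₂).1
  have hfree : ∀ᵐ ω ∂P, ∀ L N : ℕ,
      LayeredDimer.freeEnergy L N (fun y => w₁ y ω) (fun y => w₂ y ω) H₁ H₂ =
        LayeredDimer.freeEnergy L N (fun y => (ξ y ω).1) (fun y => (ξ y ω).2) H₁ H₂ := by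
    filter_upwards [hae] with ω hω L N
    simp only [hω]
  simp only [hlyap]
  refine ⟨fun θ => ⟨(LayeredDimer.lyapunov_congr hae θ H₂).2 _
    (LayeredDimer.hasTopLyapunovExponent_lyapunov he θ H₂),
    LayeredDimer.lyapunov_nonneg he θ H₂⟩,
    LayeredDimer.intervalIntegrable_max_lyapunov he H₁ H₂ _ _, ?_⟩
  obtain ⟨Φ, hΦ, hlim⟩ := LayeredDimer.exists_tendsto_freeEnergy he H₁ H₂
  refine ⟨Φ, fun L hL hLe => ?_, hlim⟩
  obtain ⟨h1, h2, h3⟩ := hΦ L hL hLe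
  refine ⟨?_, fun N hN => (h2 N hN).congr ?_, h3.congr fun N => integral_congr_ae ?_⟩
  · filter_upwards [h1, hfree] with ω hω hfω
    simpa only [hfω] using hω
  · filter_upwards [hfree] with ω hω
    rw [hω]
  · filter_upwards [hfree] with ω hω
    rw [hω]
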